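/- **Setting.** Let $X(\vartheta)=\sum_{l\in\mathbb Z}w_l e^{il\vartheta}$ be a real, jointly measurable, zero-mean isotropic random field on the circle $\mathbb R/2\pi\mathbb Z$, the series converging in mean square for every $\vartheta$, where the $w_l$ are square-integrable complex random variables with $w_0=0$, $w_{-l}=\overline{w_l}$, $Ew_l=0$, $E|w_l|^2=C_l$, $E[w_l\overline{w_{l'}}]=0$ for $l\ne l'$, and $\sum_l C_l<\infty$. Let $a:\mathbb R\to\mathbb R$ be an even $C^\infty$ function with $a^2(\xi)=\phi(\xi/2)-\phi(\xi)$, where $\phi$ is $C^\infty$, $0\le\phi\le1$, $\phi=1$ on $|\xi|\le\frac12$ and $\phi=0$ for $|\xi|>1$ (so $a$ vanishes unless $\frac12<|\xi|<2$). For $N=2^{j+2}$, $j=0,1,2,\dots$, and $\tau=2\pi/N$ put $$\psi_N(t)=\frac1{\sqrt N}\sum_{l\in\mathbb Z}a\big(\tfrac{4l}N\big)e^{ilt},\qquad \beta_{Nk}=\frac1{2\pi}\int_{-\pi}^{\pi}X(\vartheta)\,\psi_N(\vartheta-k\tau)\,d\vartheta,$$ $$\sigma_N^2=\frac1N\sum_{l}C_l\,a^2\big(\tfrac{4l}N\big),\qquad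 \widehat\beta_{Nk}=\beta_{Nk}/\sigma_N,$$ $$S_N=\frac1{\sqrt N}\sum_{k=1}^N\widehat\beta_{Nk}^{\,3},\qquad U_N=\frac1{\sqrt N}\sum_{k=1}^N\big(\widehat\beta_{Nk}^{\,4}-3\big).$$ Let $K_N(t)=\frac1{2\pi N}\big|\sum_{k=1}^Ne^{itk}\big|^2$ be Fejér's kernel, write $q_l=C_l\,a^2(4l/N)$, and set $$\sigma_{S_N}^2=\frac{12\pi}{\sigma_N^6N^3}\sum_{l_1,l_2,l_3}q_{l_1}q_{l_2}q_{l_3}K_N\big((l_1+l_2+l_3)\tau\big),$$ $$\sigma_{U_N}^2=\frac{72}{\sigma_N^4}\frac{2\pi}{N^2}\sum_{l_1,l_2}q_{l_1}q_{l_2}K_N\big((l_1+l_2)\tau\big)+\frac{24}{\sigma_N^8}\frac{2\pi}{N^4}\sum_{l_1,\dots,l_4}q_{l_1}q_{l_2}q_{l_3}q_{l_4}K_N\big((l_1+l_2+l_3+l_4)\tau\big).$$ **Assumption A1.** There are $0<c_1\le c_2$, $\alpha>1$ and $g:\mathbb N\to[c_1,c_2]$ such that $C_l=g(l)\,l^{-\alpha}$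 for all $l\ge1$. **Assumption B.** The field $X$ is Gaussian. **Theorem.** Under Assumptions A1 and B, $\sigma_{S_N}>0$ and $\sigma_{U_N}>0$ for all sufficiently large $N=2^{j+2}$, and for all integers $p_1,p_2\ge0$ the joint moments below are finite and $$\lim_{N\to\infty}E\Big[\Big(\frac{S_N}{\sigma_{S_N}}\Big)^{p_1}\Big(\frac{U_N}{\sigma_{U_N}}\Big)^{p_2}\Big]=\begin{cases}(p_1-1)!!\,(p_2-1)!!&\text{if }p_1,p_2\text{ are even},\\0&\text{otherwise,}\end{cases}$$ with $(-1)!!=1$; that is, every joint moment converges to the corresponding moment of $N(0,I_2)$. Hence $\big(S_N/\sigma_{S_N},\,U_N/\sigma_{U_N}\big)$ converges in distribution to $N(0,I_2)$ as $N\to\infty$ along $N=2^{j+2}$. (A quotient with vanishing denominator, which can only occur for finitely many $N$, is read as $0$.) -/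

import Mathlib

open MeasureTheory ProbabilityTheory Filter Topology
open scoped ComplexConjugate

noncomputable section

namespace Needlet

/-- A Littlewood-Paley window on the line: `a` is real, smooth and even, and
`a(ξ)² = φ(ξ/2) - φ(ξ)` for some smooth `φ` with values in `[0,1]`, equal to `1` on `|ξ| ≤ 1/2` and
vanishing for `|ξ| > 1`. In particular `a` vanishes unless `1/2 < |ξ| < 2`. -/
structure IsWindow (a : ℝ → ℝ) : Prop where
  smooth : ContDiff ℝ (⊤ : ℕ∞) a
  even : ∀ ξ, a (-ξ) = a ξ
  littlewoodPaley : ∃ φ : ℝ → ℝ, ContDiff ℝ (⊤ : ℕ∞) φ ∧ (∀ ξ, 0 ≤ φ ξ ∧ φ ξ ≤ 1) ∧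
    (∀ ξ, |ξ| ≤ 1 / 2 → φ ξ = 1) ∧ (∀ ξ, 1 < |ξ| → φ ξ = 0) ∧
    ∀ ξ, a ξ ^ 2 = φ (ξ / 2) - φ ξ

/-- The frequencies `l ∈ ℤ` with `N/8 ≤ |l| ≤ N/2`. -/
def band (N : ℕ) : Finset ℤ :=
  (Finset.Icc (-(N : ℤ)) N).filter fun l => (N : ℤ) ≤ 8 * |l| ∧ 2 * |l| ≤ N

/-- `a(4l/N) = 0` when `l` is not in `band N`: sums over `ℤ` of terms that carry
a factor `a(4l/N)` are sums over `band N`. -/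
theorem IsWindow.eq_zero_of_notMem_band {a : ℝ → ℝ} (ha : IsWindow a) {N : ℕ} (hN : 0 < N)
    {l : ℤ} (hl : l ∉ band N) : a (4 * l / N) = 0 := by
  obtain ⟨φ, -, -, h1, h0, h⟩ := ha.littlewoodPaley
  have hN' : (0 : ℝ) < N := by exact_mod_cast hN
  have habs : |4 * (l : ℝ) / N| = 4 * |(l : ℝ)| / N := by
    rw [abs_div, abs_mul, abs_of_pos hN']; norm_num
  rw [← sq_eq_zero_iff, h]
  have key : (8 * |l| < N) ∨ ((N : ℤ) < 2 * |l|) := by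
    by_contra! hc
    refine hl (Finset.mem_filter.2 ⟨Finset.mem_Icc.2 ?_, hc.1, hc.2⟩)
    rw [← abs_le]
    have := abs_nonneg l
    omega
  rcases key with hk | hk
  · have hk' : 8 * |(l : ℝ)| < N := by exact_mod_cast hk
    have hb : 4 * |(l : ℝ)| / N ≤ 1 / 2 := by rw [div_le_iff₀ hN']; linarith
    have hnn : 0 ≤ 4 * |(l : ℝ)| / N := by positivity
    rw [h1 _ (by rw [abs_div, habs, abs_two]; linarith), h1 _ (by rw [habs]; exact hb), sub_self]
  · have hk' : (N : ℝ) < 2 * |(l : ℝ)| := by exact_mod_cast hk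
    have hb : 2 < 4 * |(l : ℝ)| / N := by rw [lt_div_iff₀ hN']; linarith
    rw [h0 _ (by rw [abs_div, habs, abs_two]; linarith), h0 _ (by rw [habs]; linarith), sub_self]

/-- `ψ_N(t) = N^{-1/2} ∑_l a(4l/N) e^{ilt}`, as a complex number. -/
def psiC (a : ℝ → ℝ) (N : ℕ) (t : ℝ) : ℂ :=
  (1 / Real.sqrt N : ℝ) * ∑ l ∈ band N, (a (4 * l / N) : ℂ) * Complex.exp (Complex.I * l * t)

/-- `ψ_N` is real-valued because the window is even. -/
theorem IsWindow.conj_psiC {a : ℝ → ℝ} (ha : IsWindow a) (N : ℕ) (t : ℝ) :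
    conj (psiC a N t) = psiC a N t := by
  unfold psiC
  rw [map_mul, Complex.conj_ofReal, map_sum]
  congr 1
  refine Finset.sum_bij' (fun l _ => -l) (fun l _ => -l) ?_ ?_ ?_ ?_ ?_
  · intro l hl
    simp only [band, Finset.mem_filter, Finset.mem_Icc, abs_neg] at hl ⊢
    exact ⟨⟨by omega, by omega⟩, hl.2⟩
  · intro l hl
    simp only [band, Finset.mem_filter, Finset.mem_Icc, abs_neg] at hl ⊢
    exact ⟨⟨by omega, by omega⟩, hl.2⟩
  · intro l _; simp
  · intro l _; simp
  · intro l _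
    have he : a (4 * ((-l : ℤ) : ℝ) / N) = a (4 * (l : ℝ) / N) := by
      rw [← ha.even]; congr 1; push_cast; ring
    rw [map_mul, Complex.conj_ofReal, he, ← Complex.exp_conj]
    congr 2
    simp

/-- The (real-valued) needlet `ψ_N`. -/
def psi (a : ℝ → ℝ) (N : ℕ) (t : ℝ) : ℝ := (psiC a N t).re

/-- `X` is a real, mean-square continuous, zero-mean isotropic random field on the circle, in its
spectral representation `X(θ) = ∑_l w_l e^{ilθ}` (convergence in mean square for every `θ`), with
angular power spectrum `C_l = E|w_l|²`. -/
structure IsField {Ω : Type*} [MeasurableSpace Ω] (μ : Measure Ω)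
    (X : ℝ → Ω → ℝ) (w : ℤ → Ω → ℂ) (C : ℤ → ℝ) : Prop where
  measurable : Measurable (Function.uncurry X)
  memLp : ∀ l, MemLp (w l) 2 μ
  zero : w 0 =ᵐ[μ] 0
  hermitian : ∀ l, w (-l) =ᵐ[μ] fun ω => conj (w l ω)
  mean : ∀ l, ∫ ω, w l ω ∂μ = 0
  variance : ∀ l, ∫ ω, ‖w l ω‖ ^ 2 ∂μ = C l
  uncorrelated : ∀ l l', l ≠ l' → ∫ ω, w l ω * conj (w l' ω) ∂μ = 0
  summable : Summable C
  series : ∀ θ : ℝ, Tendsto (fun L : ℕ => eLpNorm (fun ω => (X θ ω : ℂ) -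
    ∑ l ∈ Finset.Icc (-(L : ℤ)) L, w l ω * Complex.exp (Complex.I * l * θ)) 2 μ) atTop (𝓝 0)

/-- `C_l = g(l) l^{-α}` for `l ≥ 1`, with `α > 1` and `g` bounded and bounded away from zero. -/
def RegularSpectrum (C : ℤ → ℝ) : Prop :=
  ∃ (c₁ c₂ α : ℝ) (g : ℕ → ℝ), 0 < c₁ ∧ 1 < α ∧ (∀ l, g l ∈ Set.Icc c₁ c₂) ∧
    ∀ l : ℕ, 1 ≤ l → C l = g l * (l : ℝ) ^ (-α)

/-- The wavelet coefficient `β_{Nk} = (1/2π) ∫_{-π}^{π} X(θ) ψ_N(θ - 2πk/N) dθ`. -/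
def beta {Ω : Type*} (X : ℝ → Ω → ℝ) (a : ℝ → ℝ) (N k : ℕ) (ω : Ω) : ℝ :=
  1 / (2 * Real.pi) *
    ∫ θ in (-Real.pi)..Real.pi, X θ ω * psi a N (θ - k * (2 * Real.pi / N))

/-- `C_l a²(4l/N)`. -/
def weight (C : ℤ → ℝ) (a : ℝ → ℝ) (N : ℕ) (l : ℤ) : ℝ := C l * a (4 * l / N) ^ 2

/-- `σ_N² = (1/N) ∑_{N/8 ≤ |l| ≤ N/2} C_l a²(4l/N)`. -/
def sigmaSq (C : ℤ → ℝ) (a : ℝ → ℝ) (N : ℕ) : ℝ := 1 / N * ∑ l ∈ band N, weight C a N l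

/-- The normalized coefficient `β_{Nk} / σ_N`. -/
def betaHat {Ω : Type*} (X : ℝ → Ω → ℝ) (C : ℤ → ℝ) (a : ℝ → ℝ) (N k : ℕ) (ω : Ω) : ℝ :=
  beta X a N k ω / Real.sqrt (sigmaSq C a N)

/-- The skewness `S_N`. -/
def skewness {Ω : Type*} (X : ℝ → Ω → ℝ) (C : ℤ → ℝ) (a : ℝ → ℝ) (N : ℕ) (ω : Ω) : ℝ :=
  1 / Real.sqrt N * ∑ k ∈ Finset.Icc 1 N, betaHat X C a N k ω ^ 3

/-- The kurtosis `U_N`. -/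
def kurtosis {Ω : Type*} (X : ℝ → Ω → ℝ) (C : ℤ → ℝ) (a : ℝ → ℝ) (N : ℕ) (ω : Ω) : ℝ :=
  1 / Real.sqrt N * ∑ k ∈ Finset.Icc 1 N, (betaHat X C a N k ω ^ 4 - 3)

/-- Fejér's kernel `K_N(t) = (1/(2πN)) |∑_{k=1}^N e^{itk}|²`. -/
def fejer (N : ℕ) (t : ℝ) : ℝ :=
  1 / (2 * Real.pi * N) * ‖∑ k ∈ Finset.Icc 1 N, Complex.exp (Complex.I * t * k)‖ ^ 2

/-- `σ_{S_N}²`; `σ_N⁶` is the third power of `σ_N²`. -/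
def sigmaSSq (C : ℤ → ℝ) (a : ℝ → ℝ) (N : ℕ) : ℝ :=
  12 * Real.pi / sigmaSq C a N ^ 3 * (1 / (N : ℝ) ^ 3) *
    ∑ l₁ ∈ band N, ∑ l₂ ∈ band N, ∑ l₃ ∈ band N,
      weight C a N l₁ * weight C a N l₂ * weight C a N l₃ *
        fejer N ((l₁ + l₂ + l₃) * (2 * Real.pi / N))

/-- `σ_{1U_N}²`. -/
def sigmaU1Sq (C : ℤ → ℝ) (a : ℝ → ℝ) (N : ℕ) : ℝ :=
  72 / sigmaSq C a N ^ 2 * (2 * Real.pi / (N : ℝ) ^ 2) *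
    ∑ l₁ ∈ band N, ∑ l₂ ∈ band N,
      weight C a N l₁ * weight C a N l₂ * fejer N ((l₁ + l₂) * (2 * Real.pi / N))

/-- `σ_{2U_N}²`. -/
def sigmaU2Sq (C : ℤ → ℝ) (a : ℝ → ℝ) (N : ℕ) : ℝ :=
  24 / sigmaSq C a N ^ 4 * (2 * Real.pi / (N : ℝ) ^ 4) *
    ∑ l₁ ∈ band N, ∑ l₂ ∈ band N, ∑ l₃ ∈ band N, ∑ l₄ ∈ band N,
      weight C a N l₁ * weight C a N l₂ * weight C a N l₃ * weight C a N l₄ *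
        fejer N ((l₁ + l₂ + l₃ + l₄) * (2 * Real.pi / N))

/-- `σ_{S_N}`. -/
def sigmaS (C : ℤ → ℝ) (a : ℝ → ℝ) (N : ℕ) : ℝ := Real.sqrt (sigmaSSq C a N)

/-- `σ_{U_N}`, where `σ_{U_N}² = σ_{1U_N}² + σ_{2U_N}²`. -/
def sigmaU (C : ℤ → ℝ) (a : ℝ → ℝ) (N : ℕ) : ℝ :=
  Real.sqrt (sigmaU1Sq C a N + sigmaU2Sq C a N)

/-- `S_N / σ_{S_N}`. -/
def normSkewness {Ω : Type*} (X : ℝ → Ω → ℝ) (C : ℤ → ℝ) (a : ℝ → ℝ) (N : ℕ) (ω : Ω) : ℝ :=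
  skewness X C a N ω / sigmaS C a N

/-- `U_N / σ_{U_N}`. -/
def normKurtosis {Ω : Type*} (X : ℝ → Ω → ℝ) (C : ℤ → ℝ) (a : ℝ → ℝ) (N : ℕ) (ω : Ω) : ℝ :=
  kurtosis X C a N ω / sigmaU C a N

/-- The resolutions `N = 2^{j+2}`. -/
def res (j : ℕ) : ℕ := 2 ^ (j + 2)

end Needlet

end

/-! The normalized coefficients `b_k` form a centred Gaussian vector whose covariance depends only
on the difference of indices mod `N`, so they are linear forms in finitely many independent standard
Gaussians (`IsField.map_betaVec`, with the explicit matrix `hartley`). Every frequency in the band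
is nonzero mod `N`, hence these forms sum to zero. Therefore the skewness is exactly the normalized
sum of `H_3(b_k)`, and the kurtosis is that of `H_4(b_k) + 6 H_2(b_k)`, with `H_q` the Hermite
polynomials. All moments become Gaussian expectations of polynomials.

Gaussian integration by parts expresses `E[S^(a+1) U^b]` and `E[U^(b+1)]` through expectations of
lower powers multiplied by `(1/N) ∑ cov(k,l) H_p(b_k) H_q(b_l)`. If these factors are replaced by
their means, the means with `p ≠ q` vanish by orthogonality, which decouples `S` from `U`; those
with `p = q` add up to the variances. What remains is the recursion `m(a+1) = a m(a-1)` of the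
normal moments.

The replacement costs `O(N^(-1/2))` by Cauchy-Schwarz. The variance of the double sum is `O(N)`, by
repeated use of the Poincaré inequality, which reduces it to sums of covariance powers around a
four-cycle (`variance_pairPoly_cov_le`). Moments of `S` and `U` are bounded uniformly in `N`, again
by Poincaré (`exists_gaussE_sum_singlePoly_sq_pow_le`). Both estimates rest on a spectral fact: each
residue class mod `N` carries a share `O(1/N)` of the variance, so a four-cycle sum is at most `N^4
(O(1/N))^3 = O(N)` (`IsSpectrum.cycle_le`).

The Fejér-kernel expressions for the variances are exact identities (`skewVar_hartley`,
`kurtVar_hartley`). They stay away from zero because the band contains order `N` frequencies `l` and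
order `N^2` triples with `l₁ + l₂ + l₃ = 0` carrying shares of order `1/N`. Convergence in
distribution follows from convergence of moments by Taylor expansion of characteristic functions. -/

noncomputable section

namespace Needlet

set_option linter.unusedSectionVars false

/-! ### Gaussian calculus for polynomials: integration by parts and Poincaré -/

section

/-! ### The expectation of a polynomial in independent standard Gaussian variables -/

theorem hasDerivAt_gaussianPDFReal (x : ℝ) :
    HasDerivAt (gaussianPDFReal 0 1) (-x * gaussianPDFReal 0 1 x) x := by
  have h : gaussianPDFReal 0 1 = fun x => (Real.sqrt (2 * Real.pi))⁻¹ * Real.exp (-x ^ 2 / 2) := by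
    ext y; simp [gaussianPDFReal]
  rw [h]
  have := (((hasDerivAt_id x).pow 2).neg.div_const 2).exp.const_mul (Real.sqrt (2 * Real.pi))⁻¹
  refine this.congr_deriv ?_
  simp; ring

theorem integrable_pow_gaussianReal (n : ℕ) :
    Integrable (fun x : ℝ => x ^ n) (gaussianReal 0 1) := by
  have := (memLp_id_gaussianReal' (μ := 0) (v := 1) (n : ENNReal) (by simp)).integrable_norm_pow'
  refine (integrable_norm_iff (by fun_prop)).1 ?_
  simpa using this

/-- Integration by parts against the density, whose derivative is `-x` times itself. For `n = 0` the
truncated exponent is harmless, being multiplied by zero. -/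
theorem integral_pow_succ_gaussianReal (n : ℕ) :
    ∫ x : ℝ, x ^ (n + 1) ∂gaussianReal 0 1 = n * ∫ x : ℝ, x ^ (n - 1) ∂gaussianReal 0 1 := by
  have hi : ∀ n : ℕ, Integrable (fun x : ℝ => gaussianPDFReal 0 1 x * x ^ n) := by
    intro n
    have := integrable_pow_gaussianReal n
    rw [gaussianReal_of_var_ne_zero _ one_ne_zero,
      integrable_withDensity_iff_integrable_smul' (measurable_gaussianPDF 0 1) (by simp [gaussianPDF])] at this
    simpa [gaussianPDF, ENNReal.toReal_ofReal (gaussianPDFReal_nonneg _ _ _)] using this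
  have key := integral_mul_deriv_eq_deriv_mul_of_integrable
    (u := fun x : ℝ => x ^ n) (v := gaussianPDFReal 0 1) (u' := fun x => n * x ^ (n - 1))
    (v' := fun x => -x * gaussianPDFReal 0 1 x) (fun x _ => by simpa using hasDerivAt_pow n x)
    (fun x _ => hasDerivAt_gaussianPDFReal x)
    (((hi (n + 1)).neg).congr (Eventually.of_forall fun x => by
      simp only [Pi.neg_apply, Pi.mul_apply]; ring))
    (((hi (n - 1)).const_mul n).congr (Eventually.of_forall fun x => by
      simp only [Pi.mul_apply]; ring))
    ((hi n).congr (Eventually.of_forall fun x => by simp only [Pi.mul_apply]; ring))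
  rw [integral_gaussianReal_eq_integral_smul one_ne_zero,
    integral_gaussianReal_eq_integral_smul one_ne_zero, ← integral_const_mul]
  have e1 : ∫ x : ℝ, x ^ n * (-x * gaussianPDFReal 0 1 x) =
      -∫ x : ℝ, gaussianPDFReal 0 1 x • x ^ (n + 1) := by
    rw [← integral_neg]; congr 1; ext x; simp only [smul_eq_mul]; ring
  rw [e1] at key
  have := neg_injective key
  rw [this]; congr 1; ext x; simp only [smul_eq_mul]; ring

variable {ι : Type*} [Fintype ι]

/-- The standard Gaussian measure on `ι → ℝ`. -/
abbrev gaussPi (ι : Type*) [Fintype ι] : Measure (ι → ℝ) := Measure.pi fun _ => gaussianReal 0 1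

theorem integrable_eval (f : MvPolynomial ι ℝ) :
    Integrable (fun x => MvPolynomial.eval x f) (gaussPi ι) := by
  simp_rw [MvPolynomial.eval_eq']
  refine integrable_finsetSum _ fun s _ => Integrable.const_mul ?_ _
  exact Integrable.fintype_prod fun i => integrable_pow_gaussianReal (s i)

/-- The expectation of a polynomial in independent standard Gaussian variables. -/
def gaussE : MvPolynomial ι ℝ →ₗ[ℝ] ℝ where
  toFun f := ∫ x, MvPolynomial.eval x f ∂gaussPi ι
  map_add' f g := by
    simp only [map_add]
    exact integral_add (integrable_eval f) (integrable_eval g)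
  map_smul' c f := by
    simp only [MvPolynomial.smul_eval, RingHom.id_apply, smul_eq_mul]
    exact integral_const_mul _ _

theorem gaussE_apply (f : MvPolynomial ι ℝ) :
    gaussE f = ∫ x, MvPolynomial.eval x f ∂gaussPi ι := rfl

open MvPolynomial

theorem gaussE_mono {f g : MvPolynomial ι ℝ} (h : ∀ x, eval x f ≤ eval x g) :
    gaussE f ≤ gaussE g :=
  integral_mono (integrable_eval f) (integrable_eval g) h

theorem gaussE_nonneg {f : MvPolynomial ι ℝ} (h : ∀ x, 0 ≤ eval x f) : 0 ≤ gaussE f :=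
  integral_nonneg h

@[simp] theorem gaussE_C (c : ℝ) : gaussE (C c : MvPolynomial ι ℝ) = c := by
  simp [gaussE_apply]

@[simp] theorem gaussE_one : gaussE (1 : MvPolynomial ι ℝ) = 1 := by
  rw [← C_1, gaussE_C]

@[simp] theorem gaussE_C_mul (c : ℝ) (f : MvPolynomial ι ℝ) : gaussE (C c * f) = c * gaussE f := by
  rw [← smul_eq_C_mul, map_smul, smul_eq_mul]

theorem gaussE_sq_nonneg (f : MvPolynomial ι ℝ) : 0 ≤ gaussE (f ^ 2) :=
  gaussE_nonneg fun x => by rw [map_pow]; positivity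

/-- Cauchy-Schwarz, from the discriminant of the nonnegative quadratic `t ↦ E[(f + t g)^2]`. -/
theorem gaussE_mul_sq_le (f g : MvPolynomial ι ℝ) :
    gaussE (f * g) ^ 2 ≤ gaussE (f ^ 2) * gaussE (g ^ 2) := by
  have h : ∀ t : ℝ, 0 ≤ gaussE (g ^ 2) * (t * t) + (2 * gaussE (f * g)) * t + gaussE (f ^ 2) := by
    intro t
    have := gaussE_sq_nonneg (f + C t * g)
    have e : (f + C t * g) ^ 2 = f ^ 2 + C (2 * t) * (f * g) + C (t * t) * g ^ 2 := by
      simp only [C_mul, map_ofNat]; ring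
    rw [e, map_add, map_add, gaussE_C_mul, gaussE_C_mul] at this
    linarith
  have := discrim_le_zero h
  unfold discrim at this
  nlinarith

theorem gaussE_monomial (s : ι →₀ ℕ) (c : ℝ) :
    gaussE (monomial s c) = c * ∏ i, ∫ x : ℝ, x ^ s i ∂gaussianReal 0 1 := by
  rw [gaussE_apply]
  simp_rw [eval_monomial, Finsupp.prod_fintype _ _ (fun i => pow_zero _)]
  rw [integral_const_mul]
  congr 1
  exact integral_fintype_prod_eq_prod (fun i (x : ℝ) => x ^ s i)

/-- Gaussian integration by parts. -/
theorem gaussE_X_mul [DecidableEq ι] (i : ι) (f : MvPolynomial ι ℝ) :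
    gaussE (X i * f) = gaussE (pderiv i f) := by
  induction f using MvPolynomial.induction_on' with
  | add p q hp hq => rw [mul_add, map_add, hp, hq, map_add, map_add]
  | monomial s c =>
    rw [pderiv_monomial, X, monomial_mul, gaussE_monomial, gaussE_monomial, one_mul, mul_assoc]
    congr 1
    rw [Fintype.prod_eq_mul_prod_compl i, Fintype.prod_eq_mul_prod_compl i, ← mul_assoc]
    congr 1
    · have := integral_pow_succ_gaussianReal (s i)
      simpa [add_comm] using this
    · refine Finset.prod_congr rfl fun j hj => ?_
      have hj' : j ≠ i := by simpa using hj
      simp [hj'.symm]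

/-! ### The number operator and the Poincaré inequality -/

/-- The number operator `∑ X_i ∂_i - ∂_i²`. -/
def numberOp (f : MvPolynomial ι ℝ) : MvPolynomial ι ℝ :=
  ∑ i, (X i * pderiv i f - pderiv i (pderiv i f))

theorem numberOp_add (f g : MvPolynomial ι ℝ) : numberOp (f + g) = numberOp f + numberOp g := by
  simp only [numberOp, map_add, mul_add, ← Finset.sum_add_distrib]
  exact Finset.sum_congr rfl fun i _ => by ring

theorem numberOp_smul (c : ℝ) (f : MvPolynomial ι ℝ) : numberOp (c • f) = c • numberOp f := by
  simp only [numberOp, Finset.smul_sum, smul_sub, mul_smul_comm, Derivation.map_smul]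

/-- Integrating the `X i` by parts cancels the second derivatives and leaves the Dirichlet form, so
the operator is symmetric and nonnegative. -/
theorem gaussE_mul_numberOp [DecidableEq ι] (f g : MvPolynomial ι ℝ) :
    gaussE (f * numberOp g) = ∑ i, gaussE (pderiv i f * pderiv i g) := by
  rw [numberOp, Finset.mul_sum, map_sum]
  refine Finset.sum_congr rfl fun i _ => ?_
  have e : f * (X i * pderiv i g - pderiv i (pderiv i g)) =
      X i * (f * pderiv i g) - f * pderiv i (pderiv i g) := by ring
  rw [e, map_sub, gaussE_X_mul, Derivation.leibniz, map_add, smul_eq_mul, smul_eq_mul,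
    mul_comm (pderiv i g)]
  ring

theorem pderiv_comm (i j : ι) (f : MvPolynomial ι ℝ) :
    pderiv i (pderiv j f) = pderiv j (pderiv i f) := by
  classical
  induction f using MvPolynomial.induction_on' with
  | add p q hp hq => simp only [map_add, hp, hq]
  | monomial s c =>
    by_cases h : i = j
    · rw [h]
    · simp only [pderiv_monomial]
      have h1 : (s - Finsupp.single j 1 : ι →₀ ℕ) i = s i := by simp [Ne.symm h]
      have h2 : (s - Finsupp.single i 1 : ι →₀ ℕ) j = s j := by simp [h]
      rw [h1, h2, tsub_right_comm]
      congr 1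
      ring

/-- The commutator of `∂_j` with the number operator is `∂_j`, since only the coefficient `X j`
reacts to `∂_j`. -/
theorem pderiv_numberOp [DecidableEq ι] (j : ι) (f : MvPolynomial ι ℝ) :
    pderiv j (numberOp f) = numberOp (pderiv j f) + pderiv j f := by
  have h : ∀ i, pderiv j (X i * pderiv i f - pderiv i (pderiv i f)) =
      (X i * pderiv i (pderiv j f) - pderiv i (pderiv i (pderiv j f))) +
        if i = j then pderiv i f else 0 := by
    intro i
    rw [map_sub, Derivation.leibniz, pderiv_X, pderiv_comm j i f, pderiv_comm j i (pderiv i f),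
      pderiv_comm j i f]
    split_ifs with h
    · subst h; simp; ring
    · simp [h]
  simp only [numberOp, map_sum, h, Finset.sum_add_distrib]
  simp

/-- Poisson's equation is solvable in polynomials. On a monomial of degree `d` Euler's identity
makes the first-order part multiplication by `d`, and the second-order part has lower degree; divide
by `d` and induct. -/
theorem exists_numberOp_eq [DecidableEq ι] (f : MvPolynomial ι ℝ) :
    ∃ h : MvPolynomial ι ℝ, ∃ c : ℝ, f = numberOp h + C c := by
  suffices H : ∀ d : ℕ, ∀ f : MvPolynomial ι ℝ, f.totalDegree ≤ d →
      ∃ h : MvPolynomial ι ℝ, ∃ c : ℝ, f = numberOp h + C c from H _ f le_rfl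
  intro d
  induction d using Nat.strong_induction_on with
  | _ d ih =>
    have hadd : ∀ f g : MvPolynomial ι ℝ, (∃ h : MvPolynomial ι ℝ, ∃ c : ℝ, f = numberOp h + C c) →
        (∃ h : MvPolynomial ι ℝ, ∃ c : ℝ, g = numberOp h + C c) →
        ∃ h : MvPolynomial ι ℝ, ∃ c : ℝ, f + g = numberOp h + C c := by
      rintro f g ⟨h, c, rfl⟩ ⟨h', c', rfl⟩
      exact ⟨h + h', c + c', by rw [numberOp_add, C_add]; ring⟩
    have hsmul : ∀ (a : ℝ) (f : MvPolynomial ι ℝ),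
        (∃ h : MvPolynomial ι ℝ, ∃ c : ℝ, f = numberOp h + C c) →
        ∃ h : MvPolynomial ι ℝ, ∃ c : ℝ, a • f = numberOp h + C c := by
      rintro a f ⟨h, c, rfl⟩
      exact ⟨a • h, a * c, by rw [numberOp_smul, smul_add, C_mul, smul_eq_C_mul (C c)]⟩
    have hsum : ∀ (T : Finset (ι →₀ ℕ)) (F : (ι →₀ ℕ) → MvPolynomial ι ℝ),
        (∀ s ∈ T, ∃ h : MvPolynomial ι ℝ, ∃ c : ℝ, F s = numberOp h + C c) →
        ∃ h : MvPolynomial ι ℝ, ∃ c : ℝ, ∑ s ∈ T, F s = numberOp h + C c := by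
      intro T F
      classical
      induction T using Finset.induction_on with
      | empty => intro _; exact ⟨0, 0, by simp [numberOp]⟩
      | insert s T hs ihT =>
        intro H
        rw [Finset.sum_insert hs]
        exact hadd _ _ (H s (by simp)) (ihT fun t ht => H t (by simp [ht]))
    intro f hf
    rw [f.as_sum]
    refine hsum _ _ fun s hs => ?_
    have hsd : s.degree ≤ d := (MvPolynomial.le_totalDegree hs).trans hf
    by_cases h0 : s = 0
    · subst h0; exact ⟨0, coeff 0 f, by simp [numberOp]⟩
    have hpos : 0 < s.degree := by
      rw [pos_iff_ne_zero]; rwa [Ne, Finsupp.degree_eq_zero_iff]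
    have euler := (isHomogeneous_monomial (d := s) (coeff s f) rfl).sum_X_mul_pderiv
    set m := monomial s (coeff s f) with hm
    have hN : (s.degree : ℝ) • m = numberOp m + ∑ i, pderiv i (pderiv i m) := by
      rw [numberOp, Finset.sum_sub_distrib, euler, sub_add_cancel, Nat.cast_smul_eq_nsmul]
    have hlow : ∃ h : MvPolynomial ι ℝ, ∃ c : ℝ,
        ∑ i, pderiv i (pderiv i m) = numberOp h + C c := by
      refine ih (d - 1) (by omega) _ ?_
      refine totalDegree_finsetSum_le fun i _ => ?_
      have hh : (pderiv i (pderiv i m)).IsHomogeneous (s.degree - 1 - 1) :=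
        ((isHomogeneous_monomial (d := s) (coeff s f) rfl).pderiv).pderiv
      exact hh.totalDegree_le.trans (by omega)
    have hm' : m = (s.degree : ℝ)⁻¹ • (numberOp m + ∑ i, pderiv i (pderiv i m)) := by
      rw [← hN, smul_smul, inv_mul_cancel₀ (by positivity), one_smul]
    rw [hm']
    exact hsmul _ _ (hadd _ _ ⟨m, 0, by simp⟩ hlow)

/-- The Gaussian Poincaré inequality. -/
theorem gaussE_sq_le [DecidableEq ι] (f : MvPolynomial ι ℝ) :
    gaussE (f ^ 2) ≤ gaussE f ^ 2 + ∑ i, gaussE (pderiv i f ^ 2) := by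
  obtain ⟨h, c, rfl⟩ := exists_numberOp_eq f
  have hmean : gaussE (numberOp h) = 0 := by
    have := gaussE_mul_numberOp (1 : MvPolynomial ι ℝ) h
    simpa using this
  have e1 : gaussE ((numberOp h + C c) ^ 2) = gaussE (numberOp h ^ 2) + c ^ 2 := by
    have : (numberOp h + C c) ^ 2 = numberOp h ^ 2 + C (2 * c) * numberOp h + C (c ^ 2) := by
      simp only [C_mul, C_pow, map_ofNat]; ring
    rw [this, map_add, map_add, gaussE_C_mul, hmean, gaussE_C]; ring
  have e2 : ∀ i, pderiv i (numberOp h + C c) = numberOp (pderiv i h) + pderiv i h := by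
    intro i; rw [map_add, pderiv_C, add_zero, pderiv_numberOp]
  have e3 : gaussE (numberOp h ^ 2) = ∑ i, (∑ j, gaussE (pderiv j (pderiv i h) ^ 2) +
      gaussE (pderiv i h ^ 2)) := by
    rw [sq, gaussE_mul_numberOp]
    refine Finset.sum_congr rfl fun i _ => ?_
    rw [pderiv_numberOp, add_mul, map_add, mul_comm, gaussE_mul_numberOp]
    simp only [sq]
  have e4 : ∀ i, gaussE (pderiv i (numberOp h + C c) ^ 2) = gaussE (numberOp (pderiv i h) ^ 2) +
      2 * ∑ j, gaussE (pderiv j (pderiv i h) ^ 2) + gaussE (pderiv i h ^ 2) := by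
    intro i
    have : (numberOp (pderiv i h) + pderiv i h) ^ 2 = numberOp (pderiv i h) ^ 2 +
        C 2 * (pderiv i h * numberOp (pderiv i h)) + pderiv i h ^ 2 := by
      simp only [map_ofNat]; ring
    rw [e2, this, map_add, map_add, gaussE_C_mul, gaussE_mul_numberOp]
    simp only [sq]
  -- With `f = Lh + c` the variance is the sum of squares of the second and first derivatives of
  -- `h`. The Dirichlet energy of `f` contains the same terms plus another copy of the second-order
  -- ones and the squares of `L ∂_i h`.
  rw [e1, e3, map_add, hmean, gaussE_C, zero_add, add_comm]
  gcongr with i _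
  rw [e4]
  have h1 := gaussE_sq_nonneg (numberOp (pderiv i h))
  have h2 : 0 ≤ ∑ j, gaussE (pderiv j (pderiv i h) ^ 2) :=
    Finset.sum_nonneg fun j _ => gaussE_sq_nonneg _
  linarith

end

/-! ### Hermite sums: orthogonality, variance of double sums, moment bounds -/

section

open MvPolynomial

/-! ### Hermite polynomials of correlated Gaussian variables -/

/-- The probabilists' Hermite polynomials evaluated at an element of a commutative ring. -/
def herm {R : Type*} [CommRing R] (b : R) : ℕ → R
  | 0 => 1
  | 1 => b
  | n + 2 => b * herm b (n + 1) - (n + 1) * herm b n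

theorem herm_succ {R : Type*} [CommRing R] (b : R) (n : ℕ) :
    herm b (n + 1) = b * herm b n - n * herm b (n - 1) := by
  cases n with
  | zero => simp [herm]
  | succ n => simp [herm]

theorem map_herm {R S : Type*} [CommRing R] [CommRing S] (f : R →+* S) (b : R) (n : ℕ) :
    f (herm b n) = herm (f b) n := by
  induction n using Nat.twoStepInduction with
  | zero => simp [herm]
  | one => simp [herm]
  | more n h1 h2 => simp [herm, h1, h2]

variable {ι : Type} {K V : Type} [Fintype ι] [DecidableEq ι] [Fintype K] [Fintype V]

theorem pderiv_herm (i : ι) (b : MvPolynomial ι ℝ) (n : ℕ) :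
    pderiv i (herm b n) = n * herm b (n - 1) * pderiv i b := by
  induction n using Nat.twoStepInduction with
  | zero => simp [herm]
  | one => simp [herm]
  | more n h1 h2 =>
    have hc : ∀ m : ℕ, pderiv i ((m : MvPolynomial ι ℝ)) = 0 := fun m => by
      rw [← map_natCast C m, pderiv_C]
    have e : herm b (n + 2) = b * herm b (n + 1) - ((n + 1 : ℕ) : MvPolynomial ι ℝ) * herm b n := by
      rw [herm_succ]; simp
    rw [e, map_sub, Derivation.leibniz, Derivation.leibniz, hc, h1, h2]
    simp only [smul_eq_mul, Nat.succ_sub_one]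
    rw [herm_succ b n]
    push_cast
    ring

/-- The linear form `∑_i A_{ki} X_i`. -/
def lin (A : K → ι → ℝ) (k : K) : MvPolynomial ι ℝ := ∑ i, C (A k i) * X i

/-- The covariance `∑_i A_{ki} A_{li}` of two linear forms. -/
def cov (A : K → ι → ℝ) (k l : K) : ℝ := ∑ i, A k i * A l i

/-- The Hermite polynomial of a linear form. -/
abbrev hermLin (A : K → ι → ℝ) (n : ℕ) (k : K) : MvPolynomial ι ℝ := herm (lin A k) n

theorem cov_comm (A : K → ι → ℝ) (k l : K) : cov A k l = cov A l k :=
  Finset.sum_congr rfl fun _ _ => mul_comm _ _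

theorem pderiv_lin (A : K → ι → ℝ) (k : K) (i : ι) : pderiv i (lin A k) = C (A k i) := by
  simp only [lin, map_sum, pderiv_C_mul, pderiv_X]
  rw [Finset.sum_eq_single i] <;> simp +contextual [eq_comm]

theorem gaussE_lin_mul (A : K → ι → ℝ) (k : K) (f : MvPolynomial ι ℝ) :
    gaussE (lin A k * f) = ∑ i, A k i * gaussE (pderiv i f) := by
  simp only [lin, Finset.sum_mul, map_sum, mul_assoc, gaussE_C_mul, gaussE_X_mul]

/-- Raising the Hermite degree is adjoint to the directional derivative. Unit variance is what makes
the derivative of `H_n` cancel the second term of the Hermite recursion. -/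
theorem gaussE_hermLin_succ_mul (A : K → ι → ℝ) (k : K) (hk : cov A k k = 1) (n : ℕ)
    (f : MvPolynomial ι ℝ) :
    gaussE (hermLin A (n + 1) k * f) = ∑ i, A k i * gaussE (hermLin A n k * pderiv i f) := by
  have hd : ∀ i, gaussE (pderiv i (herm (lin A k) n * f)) =
      gaussE (hermLin A n k * pderiv i f) + A k i * (n * gaussE (herm (lin A k) (n - 1) * f)) := by
    intro i
    rw [Derivation.leibniz, pderiv_herm, pderiv_lin, map_add, smul_eq_mul, smul_eq_mul]
    congr 1
    rw [← gaussE_C_mul, ← gaussE_C_mul, map_natCast]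
    congr 1; ring
  rw [hermLin, herm_succ, sub_mul, map_sub, mul_assoc, gaussE_lin_mul]
  simp only [hd, mul_add, Finset.sum_add_distrib, ← mul_assoc]
  rw [← Finset.sum_mul, ← Finset.sum_mul, show ∑ i, A k i * A k i = 1 from hk, one_mul,
    ← map_natCast C, mul_assoc (C _), gaussE_C_mul]
  ring

/-- Each integration by parts lowers both degrees by one and releases a factor `b * cov A k l`;
unequal degrees run out at different times and give zero. -/
theorem gaussE_hermLin_mul_hermLin (A : K → ι → ℝ) (hA : ∀ k, cov A k k = 1) (a b : ℕ) (k l : K) :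
    gaussE (hermLin A a k * hermLin A b l) =
      if a = b then (a.factorial : ℝ) * cov A k l ^ a else 0 := by
  induction a generalizing b with
  | zero =>
    cases b with
    | zero => simp [hermLin, herm]
    | succ b =>
      rw [mul_comm, gaussE_hermLin_succ_mul A l (hA l)]
      simp [hermLin, herm]
  | succ a ih =>
    rw [gaussE_hermLin_succ_mul A k (hA k)]
    have e : ∀ i, gaussE (hermLin A a k * pderiv i (hermLin A b l)) =
        A l i * (b * gaussE (hermLin A a k * hermLin A (b - 1) l)) := by
      intro i
      rw [pderiv_herm, pderiv_lin, ← gaussE_C_mul, ← gaussE_C_mul, map_natCast]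
      congr 1; ring
    simp only [e, ← mul_assoc]
    rw [← Finset.sum_mul, ← Finset.sum_mul, show ∑ i, A k i * A l i = cov A k l from rfl, ih]
    cases b with
    | zero => simp
    | succ b =>
      simp only [Nat.add_sub_cancel, Nat.add_right_cancel_iff]
      split_ifs with h
      · subst h; rw [Nat.factorial_succ, pow_succ]; push_cast; ring
      · simp

/-! ### Quadratic sums of Hermite polynomials -/

/-- `∑_{k,l} c_{kl} H_a(b_k) H_b(b_l)`. -/
def pairPoly (A : K → ι → ℝ) (c : K → K → ℝ) (a b : ℕ) : MvPolynomial ι ℝ :=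
  ∑ k, ∑ l, C (c k l) * (hermLin A a k * hermLin A b l)

theorem pderiv_pairPoly (A : K → ι → ℝ) (c : K → K → ℝ) (a b : ℕ) (i : ι) :
    pderiv i (pairPoly A c a b) = C (a : ℝ) * pairPoly A (fun k l => c k l * A k i) (a - 1) b +
      C (b : ℝ) * pairPoly A (fun k l => c k l * A l i) a (b - 1) := by
  simp only [pairPoly, map_sum, Derivation.leibniz, pderiv_herm, pderiv_lin, pderiv_C,
    Finset.mul_sum, ← Finset.sum_add_distrib]
  refine Finset.sum_congr rfl fun k _ => Finset.sum_congr rfl fun l _ => ?_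
  simp only [smul_eq_mul, C_mul, map_natCast]
  ring

theorem gaussE_pairPoly (A : K → ι → ℝ) (hA : ∀ k, cov A k k = 1) (c : K → K → ℝ) (a b : ℕ) :
    gaussE (pairPoly A c a b) =
      if a = b then (a.factorial : ℝ) * ∑ k, ∑ l, c k l * cov A k l ^ a else 0 := by
  simp only [pairPoly, map_sum, gaussE_C_mul, gaussE_hermLin_mul_hermLin A hA]
  split_ifs with h
  · simp only [Finset.mul_sum]
    refine Finset.sum_congr rfl fun k _ => Finset.sum_congr rfl fun l _ => by ring
  · simp

/-- The constants `5^{a+b} (a! b!)²`. -/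
def pairConst (a b : ℕ) : ℝ := 5 ^ (a + b) * ((a.factorial : ℝ) * b.factorial) ^ 2

theorem pairConst_comm (a b : ℕ) : pairConst a b = pairConst b a := by
  simp only [pairConst, add_comm, mul_comm]

/-- The base 5 closes the induction below: the two derivative terms use at most `2/5` of the
constant each, and the mean the remaining `1/5`. -/
theorem sq_mul_pairConst_le (a b : ℕ) : 5 * ((a : ℝ) ^ 2 * pairConst (a - 1) b) ≤ pairConst a b := by
  cases a with
  | zero => simp only [pairConst]; simp
  | succ a =>
    simp only [pairConst, Nat.add_sub_cancel, Nat.factorial_succ]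
    apply le_of_eq
    push_cast
    ring

theorem gaussE_add_sq_le (f g : MvPolynomial ι ℝ) :
    gaussE ((f + g) ^ 2) ≤ 2 * gaussE (f ^ 2) + 2 * gaussE (g ^ 2) := by
  have h := gaussE_sq_nonneg (f - g)
  have e1 : (f + g) ^ 2 = f ^ 2 + g ^ 2 + C 2 * (f * g) := by simp only [map_ofNat]; ring
  have e2 : (f - g) ^ 2 = f ^ 2 + g ^ 2 - C 2 * (f * g) := by simp only [map_ofNat]; ring
  rw [e2, map_sub, map_add] at h
  rw [e1, map_add, map_add]
  linarith

theorem gaussE_pderiv_pairPoly_sq_le (A : K → ι → ℝ) (c : K → K → ℝ) (a b : ℕ) (i : ι) :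
    gaussE (pderiv i (pairPoly A c a b) ^ 2) ≤
      2 * (a : ℝ) ^ 2 * gaussE (pairPoly A (fun k l => c k l * A k i) (a - 1) b ^ 2) +
      2 * (b : ℝ) ^ 2 * gaussE (pairPoly A (fun k l => c k l * A l i) a (b - 1) ^ 2) := by
  rw [pderiv_pairPoly]
  refine (gaussE_add_sq_le _ _).trans (le_of_eq ?_)
  rw [mul_pow, mul_pow, ← C_pow, ← C_pow, gaussE_C_mul, gaussE_C_mul]
  ring

/-- The hypothesis that `M` bounds all four-cycle sums of powers of the covariance. -/
def CycleBound (A : K → ι → ℝ) (M : ℝ) : Prop :=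
  ∀ s j j' : ℕ, 1 ≤ s → 1 ≤ j + j' → ∑ k, ∑ l, ∑ k', ∑ l',
    cov A k l ^ s * cov A k' l' ^ s * cov A k k' ^ j * cov A l l' ^ j' ≤ M

/-- Squaring produces two copies `(k,l)` and `(k',l')`. Summation over `v` couples them through the
Gram kernel of `c`, which turns squared means into four-cycle sums. -/
theorem sum_sum_mul_cov_sq (A : K → ι → ℝ) (c : V → K → K → ℝ) (s j j' n : ℕ)
    (hc : ∀ k l k' l', ∑ v, c v k l * c v k' l' =
      cov A k l ^ s * cov A k' l' ^ s * cov A k k' ^ j * cov A l l' ^ j') :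
    ∑ v, (∑ k, ∑ l, c v k l * cov A k l ^ n) ^ 2 = ∑ k, ∑ l, ∑ k', ∑ l',
      cov A k l ^ (s + n) * cov A k' l' ^ (s + n) * cov A k k' ^ j * cov A l l' ^ j' := by
  have e : ∀ v, (∑ k, ∑ l, c v k l * cov A k l ^ n) ^ 2 = ∑ k, ∑ l, ∑ k', ∑ l',
      (c v k l * c v k' l') * (cov A k l ^ n * cov A k' l' ^ n) := by
    intro v
    rw [sq, Finset.sum_mul]
    refine Finset.sum_congr rfl fun k _ => ?_
    rw [Finset.sum_mul]
    refine Finset.sum_congr rfl fun l _ => ?_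
    rw [Finset.mul_sum]
    refine Finset.sum_congr rfl fun k' _ => ?_
    rw [Finset.mul_sum]
    exact Finset.sum_congr rfl fun l' _ => by ring
  simp only [e]
  rw [Finset.sum_comm]
  refine Finset.sum_congr rfl fun k _ => ?_
  rw [Finset.sum_comm]
  refine Finset.sum_congr rfl fun l _ => ?_
  rw [Finset.sum_comm]
  refine Finset.sum_congr rfl fun k' _ => ?_
  rw [Finset.sum_comm]
  refine Finset.sum_congr rfl fun l' _ => ?_
  rw [← Finset.sum_mul, hc]
  ring

/-- Induction on `a + b` by Poincaré. A derivative lowers one Hermite degree and enlarges the index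
set from `V` to `V × ι`, which multiplies the Gram kernel by one more factor `cov A k k'` or `cov A
l l'`. The shape of the hypothesis is thus preserved, and the squared means are four-cycle sums at
every stage. The condition on `j + j'` says that the two copies are linked. -/
theorem sum_gaussE_pairPoly_sq_le (A : K → ι → ℝ) (hA : ∀ k, cov A k k = 1) {M : ℝ} (hM0 : 0 ≤ M)
    (hM : CycleBound A M) (a b : ℕ) (c : V → K → K → ℝ) (s j j' : ℕ) (hs : 1 ≤ s)
    (hj : 1 ≤ j + j')
    (hc : ∀ k l k' l', ∑ v, c v k l * c v k' l' =
      cov A k l ^ s * cov A k' l' ^ s * cov A k k' ^ j * cov A l l' ^ j') :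
    ∑ v, gaussE (pairPoly A (c v) a b ^ 2) ≤ pairConst a b * M := by
  induction hn : a + b using Nat.strong_induction_on generalizing a b V c j j' with
  | _ n ih =>
    have hmean : ∑ v, gaussE (pairPoly A (c v) a b) ^ 2 ≤
        ((a.factorial : ℝ) * b.factorial) ^ 2 * M := by
      simp only [gaussE_pairPoly A hA]
      split_ifs with h
      · subst h
        simp only [mul_pow _ (∑ k, _), ← Finset.mul_sum]
        rw [sum_sum_mul_cov_sq A c s j j' a hc]
        have h1 := hM (s + a) j j' (by omega) hj
        have h2 : (a.factorial : ℝ) ^ 2 ≤ ((a.factorial : ℝ) * a.factorial) ^ 2 := by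
          have : (1 : ℝ) ≤ a.factorial := by exact_mod_cast Nat.factorial_pos a
          gcongr
          nlinarith
        calc _ ≤ (a.factorial : ℝ) ^ 2 * M := by gcongr
          _ ≤ _ := by gcongr
      · simp; positivity
    have hd1 : a ≠ 0 → ∑ v, ∑ i, gaussE (pairPoly A (fun k l => c v k l * A k i) (a - 1) b ^ 2) ≤
        pairConst (a - 1) b * M := by
      intro ha
      have := ih (a - 1 + b) (by omega) (a - 1) b (V := V × ι)
        (fun w k l => c w.1 k l * A k w.2) (j + 1) j' (by omega) (fun k l k' l' => by
          rw [Fintype.sum_prod_type]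
          have : ∀ v i, c v k l * A k i * (c v k' l' * A k' i) =
            (c v k l * c v k' l') * (A k i * A k' i) := fun v i => by ring
          simp only [this, ← Finset.mul_sum, ← Finset.sum_mul, hc]
          rw [show ∑ i, A k i * A k' i = cov A k k' from rfl]; ring) rfl
      rwa [Fintype.sum_prod_type] at this
    have hd2 : b ≠ 0 → ∑ v, ∑ i, gaussE (pairPoly A (fun k l => c v k l * A l i) a (b - 1) ^ 2) ≤
        pairConst a (b - 1) * M := by
      intro ha
      have := ih (a + (b - 1)) (by omega) a (b - 1) (V := V × ι)
        (fun w k l => c w.1 k l * A l w.2) j (j' + 1) (by omega) (fun k l k' l' => by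
          rw [Fintype.sum_prod_type]
          have : ∀ v i, c v k l * A l i * (c v k' l' * A l' i) =
            (c v k l * c v k' l') * (A l i * A l' i) := fun v i => by ring
          simp only [this, ← Finset.mul_sum, ← Finset.sum_mul, hc]
          rw [show ∑ i, A l i * A l' i = cov A l l' from rfl]; ring) rfl
      rwa [Fintype.sum_prod_type] at this
    have hd1' : (a : ℝ) ^ 2 * ∑ v, ∑ i, gaussE (pairPoly A (fun k l => c v k l * A k i) (a - 1) b ^ 2)
        ≤ (a : ℝ) ^ 2 * pairConst (a - 1) b * M := by
      by_cases ha : a = 0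
      · simp [ha]
      · rw [mul_assoc]; exact mul_le_mul_of_nonneg_left (hd1 ha) (by positivity)
    have hd2' : (b : ℝ) ^ 2 * ∑ v, ∑ i, gaussE (pairPoly A (fun k l => c v k l * A l i) a (b - 1) ^ 2)
        ≤ (b : ℝ) ^ 2 * pairConst a (b - 1) * M := by
      by_cases ha : b = 0
      · simp [ha]
      · rw [mul_assoc]; exact mul_le_mul_of_nonneg_left (hd2 ha) (by positivity)
    have hP : ∑ v, gaussE (pairPoly A (c v) a b ^ 2) ≤ ∑ v, gaussE (pairPoly A (c v) a b) ^ 2 +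
        (2 * ((a : ℝ) ^ 2 * ∑ v, ∑ i, gaussE (pairPoly A (fun k l => c v k l * A k i) (a - 1) b ^ 2))
        + 2 * ((b : ℝ) ^ 2 *
          ∑ v, ∑ i, gaussE (pairPoly A (fun k l => c v k l * A l i) a (b - 1) ^ 2))) := by
      simp only [Finset.mul_sum, ← Finset.sum_add_distrib]
      refine Finset.sum_le_sum fun v _ => (gaussE_sq_le _).trans ?_
      gcongr with i _
      refine (gaussE_pderiv_pairPoly_sq_le A (c v) a b i).trans (le_of_eq (by ring))
    have k1 : 5 * ((a : ℝ) ^ 2 * pairConst (a - 1) b * M) ≤ pairConst a b * M := by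
      have := mul_le_mul_of_nonneg_right (sq_mul_pairConst_le a b) hM0
      linarith
    have k2 : 5 * ((b : ℝ) ^ 2 * pairConst a (b - 1) * M) ≤ pairConst a b * M := by
      have := mul_le_mul_of_nonneg_right (sq_mul_pairConst_le b a) hM0
      rw [pairConst_comm (b - 1), pairConst_comm b] at this
      linarith
    rcases Nat.eq_zero_or_pos (a + b) with h0 | h0
    · have ha : a = 0 := by omega
      have hb : b = 0 := by omega
      subst ha hb
      simp only [CharP.cast_eq_zero] at hP
      have : pairConst 0 0 = 1 := by simp [pairConst]
      rw [this, one_mul]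
      simp only [Nat.factorial_zero, Nat.cast_one, mul_one, one_pow, one_mul] at hmean
      linarith
    · have k3 : 5 * (((a.factorial : ℝ) * b.factorial) ^ 2 * M) ≤ pairConst a b * M := by
        rw [pairConst, ← mul_assoc]
        gcongr
        calc (5 : ℝ) = 5 ^ 1 := by norm_num
          _ ≤ 5 ^ (a + b) := by gcongr <;> norm_num; omega
      linarith

/-- Centring removes the mean from the first Poincaré step, so only derivatives remain, and these
already link the two copies. Uncentred, one would meet the unlinked case `j = j' = 0`, the square of
a double sum, which `CycleBound` does not cover. -/
theorem variance_pairPoly_cov_le (A : K → ι → ℝ) (hA : ∀ k, cov A k k = 1) {M : ℝ} (hM0 : 0 ≤ M)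
    (hM : CycleBound A M) (a b : ℕ) :
    gaussE ((pairPoly A (cov A) a b - C (gaussE (pairPoly A (cov A) a b))) ^ 2) ≤
      4 * (a ^ 2 * pairConst (a - 1) b + b ^ 2 * pairConst a (b - 1)) * M := by
  have h1 := sum_gaussE_pairPoly_sq_le A hA hM0 hM (a - 1) b (fun i k l => cov A k l * A k i) 1 1 0
    le_rfl (by omega) (fun k l k' l' => by
      have : ∀ i, cov A k l * A k i * (cov A k' l' * A k' i) =
        cov A k l * cov A k' l' * (A k i * A k' i) := fun i => by ring
      simp only [this, ← Finset.mul_sum]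
      rw [show ∑ i, A k i * A k' i = cov A k k' from rfl]; ring)
  have h2 := sum_gaussE_pairPoly_sq_le A hA hM0 hM a (b - 1) (fun i k l => cov A k l * A l i) 1 0 1
    le_rfl (by omega) (fun k l k' l' => by
      have : ∀ i, cov A k l * A l i * (cov A k' l' * A l' i) =
        cov A k l * cov A k' l' * (A l i * A l' i) := fun i => by ring
      simp only [this, ← Finset.mul_sum]
      rw [show ∑ i, A l i * A l' i = cov A l l' from rfl]; ring)
  have h1' := mul_le_mul_of_nonneg_left h1 (sq_nonneg (a : ℝ))
  have h2' := mul_le_mul_of_nonneg_left h2 (sq_nonneg (b : ℝ))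
  have hp := gaussE_sq_le (pairPoly A (cov A) a b - C (gaussE (pairPoly A (cov A) a b)))
  rw [map_sub, gaussE_C, sub_self] at hp
  simp only [map_sub, pderiv_C, sub_zero] at hp
  have h3 : ∑ i, gaussE (pderiv i (pairPoly A (cov A) a b) ^ 2) ≤
      2 * ((a : ℝ) ^ 2 * ∑ i, gaussE (pairPoly A (fun k l => cov A k l * A k i) (a - 1) b ^ 2)) +
      2 * ((b : ℝ) ^ 2 * ∑ i, gaussE (pairPoly A (fun k l => cov A k l * A l i) a (b - 1) ^ 2)) := by
    simp only [Finset.mul_sum, ← Finset.sum_add_distrib]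
    refine Finset.sum_le_sum fun i _ => ?_
    refine (gaussE_pderiv_pairPoly_sq_le A (cov A) a b i).trans (le_of_eq (by ring))
  have h4 : 0 ≤ (a ^ 2 * pairConst (a - 1) b + b ^ 2 * pairConst a (b - 1)) * M := by
    unfold pairConst; positivity
  nlinarith

/-! ### Moments of linear sums of Hermite polynomials -/

/-- `∑_k c_k H_a(b_k)`. -/
def singlePoly (A : K → ι → ℝ) (c : K → ℝ) (a : ℕ) : MvPolynomial ι ℝ :=
  ∑ k, C (c k) * hermLin A a k

theorem pderiv_singlePoly (A : K → ι → ℝ) (c : K → ℝ) (a : ℕ) (i : ι) :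
    pderiv i (singlePoly A c a) = C (a : ℝ) * singlePoly A (fun k => c k * A k i) (a - 1) := by
  simp only [singlePoly, map_sum, pderiv_C_mul, pderiv_herm, pderiv_lin, Finset.mul_sum]
  refine Finset.sum_congr rfl fun k _ => ?_
  simp only [C_mul, map_natCast]
  ring

/-- A crude Young inequality: whichever of `t` and `2y` is larger dominates. The coefficient `1/2`
of `t ^ (n + 1)` allows it to be absorbed later. -/
theorem pow_mul_le_add_pow {t y : ℝ} (ht : 0 ≤ t) (hy : 0 ≤ y) (n : ℕ) :
    t ^ n * y ≤ (t ^ (n + 1) + (2 * y) ^ (n + 1)) / 2 := by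
  rcases le_total (2 * y) t with h | h
  · have : t ^ n * (2 * y) ≤ t ^ n * t := by gcongr
    have h2 : 0 ≤ (2 * y) ^ (n + 1) := by positivity
    rw [pow_succ t]; linarith
  · have : t ^ n * (2 * y) ≤ (2 * y) ^ n * (2 * y) := by gcongr
    have h2 : 0 ≤ t ^ (n + 1) := by positivity
    rw [pow_succ (2 * y)]; linarith

/-- The Poincaré inequality for powers of the squared norm of a vector of polynomials. -/
theorem gaussE_sum_sq_pow_le (R : V → MvPolynomial ι ℝ) {r : ℕ} (hr : 1 ≤ r) :
    gaussE ((∑ v, R v ^ 2) ^ (2 * r)) ≤ 2 * gaussE ((∑ v, R v ^ 2) ^ r) ^ 2 +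
      (8 * (r : ℝ) ^ 2) ^ (2 * r) * gaussE ((∑ v, ∑ i, pderiv i (R v) ^ 2) ^ (2 * r)) := by
  set t := ∑ v, R v ^ 2 with ht
  set y := ∑ v, ∑ i, pderiv i (R v) ^ 2 with hy
  -- Poincaré for `t ^ r` controls the exponent `2r` by the exponent `r` and a gradient term.
  have hP := gaussE_sq_le (t ^ r)
  rw [← pow_mul, mul_comm r 2, ← map_sum] at hP
  have hder : ∀ i, pderiv i (t ^ r) = C (2 * r : ℝ) * t ^ (r - 1) * ∑ v, R v * pderiv i (R v) := by
    intro i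
    rw [Derivation.leibniz_pow, ht, map_sum]
    have : ∀ v, pderiv i (R v ^ 2) = C 2 * (R v * pderiv i (R v)) := fun v => by
      rw [Derivation.leibniz_pow]; simp [map_ofNat]
    simp only [this, ← Finset.mul_sum, smul_eq_mul, nsmul_eq_mul, C_mul, map_natCast]
    ring
  have hmono : gaussE (∑ i, pderiv i (t ^ r) ^ 2) ≤
      gaussE (C (1 / 2 : ℝ) * t ^ (2 * r) + C (1 / 2 * (8 * (r : ℝ) ^ 2) ^ (2 * r)) * y ^ (2 * r)) := by
    refine gaussE_mono fun x => ?_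
    have hT : eval x t = ∑ v, eval x (R v) ^ 2 := by simp [ht]
    have hY : eval x y = ∑ v, ∑ i, eval x (pderiv i (R v)) ^ 2 := by simp [hy]
    have hT0 : 0 ≤ eval x t := hT ▸ Finset.sum_nonneg fun v _ => sq_nonneg _
    have hY0 : 0 ≤ eval x y :=
      hY ▸ Finset.sum_nonneg fun v _ => Finset.sum_nonneg fun i _ => sq_nonneg _
    -- Cauchy-Schwarz in `v` for each direction `i`.
    have hcs : ∑ i, (∑ v, eval x (R v) * eval x (pderiv i (R v))) ^ 2 ≤ eval x t * eval x y := by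
      rw [hY, Finset.sum_comm, Finset.mul_sum, hT]
      exact Finset.sum_le_sum fun i _ => Finset.sum_mul_sq_le_sq_mul_sq _ _ _
    have e : eval x (∑ i, pderiv i (t ^ r) ^ 2) = 4 * (r : ℝ) ^ 2 * eval x t ^ (2 * r - 2) *
        ∑ i, (∑ v, eval x (R v) * eval x (pderiv i (R v))) ^ 2 := by
      simp only [hder, map_sum, map_pow, map_mul, eval_C, mul_pow, ← pow_mul]
      rw [show (r - 1) * 2 = 2 * r - 2 by omega, ← Finset.mul_sum]
      ring
    rw [e]
    -- The doubled second argument is the source of `8 r^2`. Half of `E[t^(2r)]` appears on the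
    -- right; absorbing it doubles the other terms.
    have h1 := pow_mul_le_add_pow hT0 (y := 4 * (r : ℝ) ^ 2 * eval x y) (by positivity) (2 * r - 1)
    rw [show 2 * r - 1 + 1 = 2 * r by omega] at h1
    have e2 : 4 * (r : ℝ) ^ 2 * eval x t ^ (2 * r - 2) * (eval x t * eval x y) =
        eval x t ^ (2 * r - 1) * (4 * (r : ℝ) ^ 2 * eval x y) := by
      rw [show 2 * r - 1 = 2 * r - 2 + 1 by omega, pow_succ]; ring
    have h2 : 4 * (r : ℝ) ^ 2 * eval x t ^ (2 * r - 2) *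
        ∑ i, (∑ v, eval x (R v) * eval x (pderiv i (R v))) ^ 2 ≤
        4 * (r : ℝ) ^ 2 * eval x t ^ (2 * r - 2) * (eval x t * eval x y) := by gcongr
    refine h2.trans (e2 ▸ h1.trans (le_of_eq ?_))
    simp only [map_add, map_mul, map_pow, eval_C]
    rw [← mul_assoc 2, mul_pow (2 * _)]
    ring
  rw [map_add, gaussE_C_mul, gaussE_C_mul] at hmono
  linarith

/-- Uniform bounds for the moments of a vector of sums of Hermite polynomials of degree `a`. -/
theorem exists_gaussE_sum_singlePoly_sq_pow_le (B : ℝ) (s a : ℕ) : ∃ B' : ℝ, 0 ≤ B' ∧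
    ∀ (K ι V : Type) [Fintype K] [Fintype ι] [DecidableEq ι] [Fintype V] (A : K → ι → ℝ)
      (_ : ∀ k, cov A k k = 1) (D : ℝ) (_ : ∀ b : ℕ, 2 ≤ b → D * ∑ k, ∑ l, cov A k l ^ b ≤ B)
      (c : V → K → ℝ) (m : ℕ) (_ : 2 ≤ a + m)
      (_ : ∀ k l, ∑ v, c v k * c v l = D * cov A k l ^ m),
      gaussE ((∑ v, singlePoly A (c v) a ^ 2) ^ 2 ^ s) ≤ B' := by
  -- The outer induction doubles the exponent. The inner one, on `a`, treats the gradient, which has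
  -- Hermite degree `a - 1` and Gram exponent `m + 1`; the sum `a + m` is preserved, so only
  -- covariance powers of order at least two ever occur.
  induction s generalizing a with
  | zero =>
    -- For exponent one the expectation is an exact second moment; the maximum with zero covers a
    -- negative `B`.
    refine ⟨max (a.factorial * B) 0, le_max_right _ _, ?_⟩
    intro K ι V _ _ _ _ A hA D hB c m hm hc
    refine le_max_of_le_left ?_
    have e : ∀ v, gaussE (singlePoly A (c v) a ^ 2) =
        a.factorial * ∑ k, ∑ l, c v k * c v l * cov A k l ^ a := by
      intro v
      rw [sq, singlePoly, Finset.sum_mul_sum, map_sum, Finset.mul_sum]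
      refine Finset.sum_congr rfl fun k _ => ?_
      rw [map_sum, Finset.mul_sum]
      refine Finset.sum_congr rfl fun l _ => ?_
      rw [mul_mul_mul_comm, ← C_mul, gaussE_C_mul, gaussE_hermLin_mul_hermLin A hA, if_pos rfl]
      ring
    rw [pow_zero, pow_one, map_sum]
    simp only [e, ← Finset.mul_sum]
    refine mul_le_mul_of_nonneg_left ?_ (by positivity)
    refine le_trans (le_of_eq ?_) (hB (a + m) hm)
    rw [Finset.sum_comm, Finset.mul_sum]
    refine Finset.sum_congr rfl fun k _ => ?_
    rw [Finset.sum_comm, Finset.mul_sum]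
    refine Finset.sum_congr rfl fun l _ => ?_
    rw [← Finset.sum_mul, hc]; ring
  | succ s ih =>
    induction a with
    | zero =>
      obtain ⟨B₁, hB₁, h₁⟩ := ih 0
      refine ⟨2 * B₁ ^ 2, by positivity, ?_⟩
      intro K ι V _ _ _ _ A hA D hB c m hm hc
      have h1 := h₁ K ι V A hA D hB c m hm hc
      have h := gaussE_sum_sq_pow_le (fun v => singlePoly A (c v) 0) (r := 2 ^ s) Nat.one_le_two_pow
      simp only [pderiv_singlePoly] at h
      rw [pow_succ' 2 s]
      have h0 : 2 * 2 ^ s ≠ 0 := by positivity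
      refine h.trans ?_
      simp only [CharP.cast_eq_zero, zero_mul, ne_eq, OfNat.ofNat_ne_zero, not_false_eq_true,
        zero_pow, Finset.sum_const_zero, zero_pow h0, map_zero, mul_zero, add_zero]
      have h2 : 0 ≤ gaussE ((∑ v, singlePoly A (c v) 0 ^ 2) ^ 2 ^ s) :=
        gaussE_nonneg fun x => by
          simp only [map_pow, map_sum]; positivity
      gcongr
    | succ a iha =>
      obtain ⟨B₁, hB₁, h₁⟩ := ih (a + 1)
      obtain ⟨B₂, hB₂, h₂⟩ := iha
      refine ⟨2 * B₁ ^ 2 + (8 * ((2 ^ s : ℕ) : ℝ) ^ 2) ^ (2 * 2 ^ s) *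
        ((((a + 1 : ℕ) : ℝ) ^ 2) ^ (2 * 2 ^ s) * B₂), by positivity, ?_⟩
      intro K ι V _ _ _ _ A hA D hB c m hm hc
      have h1 := h₁ K ι V A hA D hB c m hm hc
      have h2 := h₂ K ι (V × ι) A hA D hB (fun w k => c w.1 k * A k w.2) (m + 1) (by omega)
        (fun k l => by
          rw [Fintype.sum_prod_type]
          have : ∀ v i, c v k * A k i * (c v l * A l i) = (c v k * c v l) * (A k i * A l i) :=
            fun v i => by ring
          simp only [this, ← Finset.mul_sum, ← Finset.sum_mul, hc]
          rw [show ∑ i, A k i * A l i = cov A k l from rfl]; ring)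
      rw [Fintype.sum_prod_type] at h2
      have h := gaussE_sum_sq_pow_le (fun v => singlePoly A (c v) (a + 1)) (r := 2 ^ s)
        Nat.one_le_two_pow
      simp only [pderiv_singlePoly, mul_pow (C _), ← Finset.mul_sum, ← C_pow, gaussE_C_mul] at h
      rw [Nat.add_sub_cancel] at h
      rw [pow_succ' 2 s] at h2 ⊢
      refine h.trans ?_
      have h3 : 0 ≤ gaussE ((∑ v, singlePoly A (c v) (a + 1) ^ 2) ^ 2 ^ s) :=
        gaussE_nonneg fun x => by
          simp only [map_pow, map_sum]; positivity
      gcongr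

end

/-! ### Fourier analysis on the cyclic group: double sums and four-cycles -/

section

/-! ### Spectral bounds for positive definite functions on `ℤ/N` -/

variable {N : ℕ} [NeZero N]

/-- `f` is the Fourier transform of `p` on `ℤ/N`. -/
def IsSpectrum (p f : ZMod N → ℝ) : Prop :=
  ∀ m, (f m : ℂ) = ∑ x, (p x : ℂ) * ZMod.stdAddChar (x * m)

theorem sum_stdAddChar_mul (x : ZMod N) :
    ∑ m, (ZMod.stdAddChar (x * m) : ℂ) = if x = 0 then (N : ℂ) else 0 := by
  have h := AddChar.sum_mulShift x (ZMod.isPrimitive_stdAddChar N)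
  simp only [ZMod.card] at h
  simpa [mul_comm] using h

theorem conj_stdAddChar (x : ZMod N) :
    conj (ZMod.stdAddChar x : ℂ) = ZMod.stdAddChar (-x) := by
  rw [AddChar.map_neg_eq_conj]

/-- Cyclic convolution of weights. -/
def cconv (p q : ZMod N → ℝ) (z : ZMod N) : ℝ := ∑ x, p x * q (z - x)

theorem IsSpectrum.mul {p f q g : ZMod N → ℝ} (hp : IsSpectrum p f) (hq : IsSpectrum q g) :
    IsSpectrum (cconv p q) (fun m => f m * g m) := by
  intro m
  simp only [cconv]
  push_cast
  rw [hp, hq, Finset.sum_mul_sum]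
  simp only [Finset.sum_mul]
  rw [Finset.sum_comm]
  rw [Finset.sum_comm]
  refine Eq.symm ?_
  rw [Finset.sum_comm]
  refine Finset.sum_congr rfl fun x _ => ?_
  refine (Fintype.sum_equiv (Equiv.subRight x) _ _ fun z => ?_)
  simp only [Equiv.subRight_apply]
  have : z * m = x * m + (z - x) * m := by ring
  rw [this, AddChar.map_add_eq_mul]
  ring

/-- A probability weight on `ℤ/N`. -/
structure IsWeight (p : ZMod N → ℝ) : Prop where
  nonneg : ∀ x, 0 ≤ p x
  sum_eq_one : ∑ x, p x = 1

theorem IsWeight.cconv {p q : ZMod N → ℝ} (hp : IsWeight p) (hq : IsWeight q) :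
    IsWeight (cconv p q) where
  nonneg z := Finset.sum_nonneg fun x _ => mul_nonneg (hp.nonneg x) (hq.nonneg _)
  sum_eq_one := by
    simp only [Needlet.cconv]
    rw [Finset.sum_comm]
    simp only [← Finset.mul_sum]
    have : ∀ x, ∑ z, q (z - x) = 1 := fun x => by
      rw [← hq.sum_eq_one]
      exact Fintype.sum_equiv (Equiv.subRight x) _ _ fun z => rfl
    simp [this, hp.sum_eq_one]

theorem cconv_le {p q : ZMod N → ℝ} (hq : IsWeight q) {B : ℝ}
    (hB : ∀ x, p x ≤ B) (z : ZMod N) : cconv p q z ≤ B := by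
  calc cconv p q z ≤ ∑ x, B * q (z - x) :=
        Finset.sum_le_sum fun x _ => mul_le_mul_of_nonneg_right (hB x) (hq.nonneg _)
    _ = B := by
      rw [← Finset.mul_sum, Fintype.sum_equiv (Equiv.subLeft z) (fun x => q (z - x)) q fun x => rfl,
        hq.sum_eq_one, mul_one]

/-- Powers of the transform come from convolution powers of the weight, and convolving with a
probability weight does not raise the supremum. The zeroth power is a point mass, which need not
satisfy the bound. -/
theorem IsSpectrum.exists_pow {p f : ZMod N → ℝ} (h : IsSpectrum p f) (hp : IsWeight p) {B : ℝ}
    (hB : ∀ x, p x ≤ B) (n : ℕ) :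
    ∃ q : ZMod N → ℝ, IsWeight q ∧ IsSpectrum q (fun m => f m ^ n) ∧
      (1 ≤ n → ∀ x, q x ≤ B) := by
  induction n with
  | zero =>
    refine ⟨fun x => if x = 0 then 1 else 0, ⟨fun x => by split_ifs <;> simp, by simp⟩, ?_, by simp⟩
    intro m
    rw [Finset.sum_eq_single 0] <;> simp +contextual
  | succ n ih =>
    obtain ⟨q, hq, hs, -⟩ := ih
    refine ⟨Needlet.cconv p q, hp.cconv hq, ?_, fun _ => cconv_le hq hB⟩
    have := h.mul hs
    simpa only [pow_succ'] using this

/-- Summing the characters over `l` leaves only equal frequencies, with a factor `N`. The result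
depends on `k` and `m` through their difference alone. -/
theorem IsSpectrum.sum_mul_sub {p f q g : ZMod N → ℝ} (hp : IsSpectrum p f) (hq : IsSpectrum q g)
    (k m : ZMod N) : ((∑ l, f (k - l) * g (l - m) : ℝ) : ℂ) =
      ∑ x, ((N * (p x * q x) : ℝ) : ℂ) * ZMod.stdAddChar (x * (k - m)) := by
  push_cast
  have e : ∀ l, (f (k - l) : ℂ) * g (l - m) = ∑ x, ∑ y, (p x : ℂ) * q y *
      (ZMod.stdAddChar (x * k - y * m) * ZMod.stdAddChar ((y - x) * l)) := by
    intro l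
    rw [hp, hq, Finset.sum_mul_sum]
    refine Finset.sum_congr rfl fun x _ => Finset.sum_congr rfl fun y _ => ?_
    rw [← AddChar.map_add_eq_mul, mul_mul_mul_comm, ← AddChar.map_add_eq_mul]
    congr 2
    ring
  simp only [e]
  rw [Finset.sum_comm]
  refine Finset.sum_congr rfl fun x _ => ?_
  rw [Finset.sum_comm]
  simp only [← Finset.mul_sum, sum_stdAddChar_mul, sub_eq_zero, mul_ite, mul_zero]
  rw [Finset.sum_ite_eq' Finset.univ x, if_pos (Finset.mem_univ _), mul_sub]
  ring

theorem IsSpectrum.conv {p f q g : ZMod N → ℝ} (hp : IsSpectrum p f) (hq : IsSpectrum q g) :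
    IsSpectrum (fun x => N * (p x * q x)) (fun m => ∑ l, f (m - l) * g l) := by
  intro m
  simpa using hp.sum_mul_sub hq m 0

theorem IsSpectrum.sum_mul_sub_eq {p f q g : ZMod N → ℝ} (hp : IsSpectrum p f)
    (hq : IsSpectrum q g) (k m : ZMod N) :
    ∑ l, f (k - l) * g (l - m) = ∑ l, f (k - m - l) * g l := by
  have h := hp.conv hq (k - m)
  rw [← hp.sum_mul_sub hq k m] at h
  exact (Complex.ofReal_injective h).symm

theorem sum_sum_sub (f : ZMod N → ℝ) : ∑ k, ∑ l, f (k - l) = N * ∑ m, f m := by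
  have : ∀ k, ∑ l, f (k - l) = ∑ m, f m := fun k =>
    Fintype.sum_equiv (Equiv.subLeft k) _ _ fun l => rfl
  simp [this, ZMod.card]

theorem IsSpectrum.sum_eq {p f : ZMod N → ℝ} (hp : IsSpectrum p f) : ∑ m, f m = N * p 0 := by
  have : ((∑ m, f m : ℝ) : ℂ) = N * p 0 := by
    push_cast
    simp only [hp _]
    rw [Finset.sum_comm]
    simp only [← Finset.mul_sum, sum_stdAddChar_mul, mul_ite, mul_zero]
    rw [Finset.sum_ite_eq' Finset.univ 0, if_pos (Finset.mem_univ _)]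
    ring
  exact_mod_cast this

theorem IsSpectrum.sum_sum_pow_le {p f : ZMod N → ℝ} (h : IsSpectrum p f) (hp : IsWeight p) {B : ℝ}
    (hB : ∀ x, p x ≤ B) {n : ℕ} (hn : 1 ≤ n) : ∑ k, ∑ l, f (k - l) ^ n ≤ N ^ 2 * B := by
  obtain ⟨q, -, hs, hle⟩ := h.exists_pow hp hB n
  rw [sum_sum_sub fun m => f m ^ n, hs.sum_eq, ← mul_assoc, ← sq]
  gcongr
  exact hle hn 0

/-- The cycle consists of two paths from `k` to `l'`, one through `l` and one through `k'`. Each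
path is a convolution, so the whole is `N^4` times a single frequency sum of a product of four
weights. Three of them are bounded by `B`, and the fourth sums to one. -/
theorem IsSpectrum.cycle_le {p f : ZMod N → ℝ} (h : IsSpectrum p f) (hp : IsWeight p) {B : ℝ}
    (hB : ∀ x, p x ≤ B) {s j j' : ℕ} (hs : 1 ≤ s) (hj : 1 ≤ j + j') :
    ∑ k, ∑ l, ∑ k', ∑ l', f (k - l) ^ s * f (k' - l') ^ s * f (k - k') ^ j * f (l - l') ^ j' ≤
      N ^ 4 * B ^ 3 := by
  have hB0 : 0 ≤ B := (hp.nonneg 0).trans (hB 0)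
  obtain ⟨q, hq, hqs, hqB⟩ := h.exists_pow hp hB s
  obtain ⟨u, hu, hus, huB⟩ := h.exists_pow hp hB j
  obtain ⟨w, hw, hws, hwB⟩ := h.exists_pow hp hB j'
  have hqB := hqB hs
  have e1 : ∑ k, ∑ l, ∑ k', ∑ l', f (k - l) ^ s * f (k' - l') ^ s * f (k - k') ^ j * f (l - l') ^ j'
      = ∑ k, ∑ l', (∑ l, f (k - l) ^ s * f (l - l') ^ j') *
        (∑ k', f (k - k') ^ j * f (k' - l') ^ s) := by
    refine Finset.sum_congr rfl fun k _ => ?_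
    simp only [Finset.sum_mul_sum]
    rw [Finset.sum_comm' (t' := Finset.univ) (s' := fun _ => Finset.univ) (by simp)]
    rw [Finset.sum_comm]
    have : ∀ l, ∑ k', ∑ l', f (k - l) ^ s * f (k' - l') ^ s * f (k - k') ^ j * f (l - l') ^ j' =
        ∑ l', ∑ k', f (k - l) ^ s * f (l - l') ^ j' * (f (k - k') ^ j * f (k' - l') ^ s) := by
      intro l
      rw [Finset.sum_comm]
      exact Finset.sum_congr rfl fun _ _ => Finset.sum_congr rfl fun _ _ => by ring
    simp only [this]
    rw [Finset.sum_comm]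
  have e2 := (hqs.conv hws).mul (hus.conv hqs)
  rw [e1]
  simp only [hqs.sum_mul_sub_eq hws, hus.sum_mul_sub_eq hqs]
  rw [sum_sum_sub fun m => (∑ l, f (m - l) ^ s * f l ^ j') * ∑ l, f (m - l) ^ j * f l ^ s,
    e2.sum_eq]
  have e5 : N * (N * cconv (fun x => N * (q x * w x)) (fun x => N * (u x * q x)) 0) =
      N ^ 4 * ∑ x, q x * w x * (u (-x) * q (-x)) := by
    simp only [cconv, Finset.mul_sum]
    refine Finset.sum_congr rfl fun x _ => ?_
    rw [zero_sub]; ring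
  rw [e5]
  gcongr
  -- If one of `j`, `j'` vanishes, its weight has no pointwise bound by `B`; that weight is then the
  -- one left to be summed.
  have hxy : ∀ x, q x * w x * (u (-x) * q (-x)) ≤ B ^ 3 * (if 1 ≤ j then w x else u (-x)) := by
    intro x
    have h1 := hq.nonneg x
    have h2 := hw.nonneg x
    have h3 := hu.nonneg (-x)
    have h4 := hq.nonneg (-x)
    split_ifs with hj1
    · calc q x * w x * (u (-x) * q (-x)) ≤ B * w x * (B * B) := by
            gcongr <;> first | exact hqB _ | exact huB hj1 _
        _ = _ := by ring
    · calc q x * w x * (u (-x) * q (-x)) ≤ B * B * (u (-x) * B) := by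
            gcongr <;> first | exact hqB _ | exact hwB (by omega) _
        _ = _ := by ring
  calc _ ≤ ∑ x, B ^ 3 * (if 1 ≤ j then w x else u (-x)) := Finset.sum_le_sum fun x _ => hxy x
    _ = B ^ 3 := by
      rw [← Finset.mul_sum]
      split_ifs
      · rw [hw.sum_eq_one, mul_one]
      · rw [Fintype.sum_equiv (Equiv.neg _) (fun x => u (-x)) u fun x => rfl, hu.sum_eq_one,
          mul_one]

end

/-! ### Approximate recursion for the joint moments of skewness and kurtosis -/

section

open MvPolynomial

/-! ### Moments of the skewness and kurtosis polynomials -/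

variable {ι : Type} {K : Type} [Fintype ι] [DecidableEq ι] [Fintype K]

theorem pairPoly_comm (A : K → ι → ℝ) (a b : ℕ) :
    pairPoly A (cov A) a b = pairPoly A (cov A) b a := by
  unfold pairPoly
  rw [Finset.sum_comm]
  refine Finset.sum_congr rfl fun k _ => Finset.sum_congr rfl fun l _ => ?_
  rw [cov_comm, mul_comm (hermLin A a l)]

/-- Inner products of gradients of Hermite sums are double sums weighted by the covariance; this is
why `pairPoly` enters. -/
theorem sum_singlePoly_mul_singlePoly (A : K → ι → ℝ) (δ : ℝ) (a b : ℕ) :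
    ∑ i, singlePoly A (fun k => δ * A k i) a * singlePoly A (fun k => δ * A k i) b =
      C (δ ^ 2) * pairPoly A (cov A) a b := by
  simp only [singlePoly, Finset.sum_mul_sum]
  simp only [pairPoly, Finset.mul_sum]
  rw [Finset.sum_comm]
  refine Finset.sum_congr rfl fun k _ => ?_
  rw [Finset.sum_comm]
  refine Finset.sum_congr rfl fun l _ => ?_
  have : ∀ i, C (δ * A k i) * hermLin A a k * (C (δ * A l i) * hermLin A b l) =
      C (A k i * A l i) * (C (δ ^ 2) * (hermLin A a k * hermLin A b l)) := fun i => by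
    simp only [C_mul, C_pow]; ring
  simp only [this, ← Finset.sum_mul, ← map_sum]
  rw [show ∑ i, A k i * A l i = cov A k l from rfl]
  ring

theorem gaussE_singlePoly_succ_mul (A : K → ι → ℝ) (hA : ∀ k, cov A k k = 1) (δ : ℝ) (q : ℕ)
    (G : MvPolynomial ι ℝ) : gaussE (singlePoly A (fun _ => δ) (q + 1) * G) =
      ∑ i, gaussE (singlePoly A (fun k => δ * A k i) q * pderiv i G) := by
  simp only [singlePoly, Finset.sum_mul, map_sum, mul_assoc, gaussE_C_mul]
  rw [Finset.sum_comm]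
  refine Finset.sum_congr rfl fun k _ => ?_
  rw [gaussE_hermLin_succ_mul A k (hA k), Finset.mul_sum]

theorem abs_gaussE_mul_sub_le (P G : MvPolynomial ι ℝ) {x y : ℝ} (hx : 0 ≤ x) (hy : 0 ≤ y)
    (hP : gaussE ((P - C (gaussE P)) ^ 2) ≤ x ^ 2) (hG : gaussE (G ^ 2) ≤ y ^ 2) :
    |gaussE (P * G) - gaussE P * gaussE G| ≤ x * y := by
  have e : gaussE (P * G) - gaussE P * gaussE G = gaussE ((P - C (gaussE P)) * G) := by
    rw [sub_mul, map_sub, gaussE_C_mul]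
  rw [e]
  refine abs_le_of_sq_le_sq ?_ (by positivity)
  calc _ ≤ gaussE ((P - C (gaussE P)) ^ 2) * gaussE (G ^ 2) := gaussE_mul_sq_le _ _
    _ ≤ x ^ 2 * y ^ 2 := mul_le_mul hP hG (gaussE_sq_nonneg _) (by positivity)
    _ = (x * y) ^ 2 := by ring

/-- Covariances whose powers have four-cycle sums and double sums of the order of the
number of variables. -/
structure IsRegularCov (A : K → ι → ℝ) (c : ℝ) : Prop where
  card_pos : 0 < Fintype.card K
  nonneg : 0 ≤ c
  cov_self : ∀ k, cov A k k = 1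
  cycle : CycleBound A (Fintype.card K * c)
  sum_pow_le : ∀ b : ℕ, 2 ≤ b → 1 / (Fintype.card K : ℝ) * ∑ k, ∑ l, cov A k l ^ b ≤ c

/-- The normalized sum of the `q`-th Hermite polynomials. -/
def hermSum (A : K → ι → ℝ) (q : ℕ) : MvPolynomial ι ℝ :=
  singlePoly A (fun _ => 1 / Real.sqrt (Fintype.card K)) q

/-- The skewness as a polynomial. -/
def skewPoly (A : K → ι → ℝ) : MvPolynomial ι ℝ := hermSum A 3

/-- The kurtosis as a polynomial. -/
def kurtPoly (A : K → ι → ℝ) : MvPolynomial ι ℝ := hermSum A 4 + C 6 * hermSum A 2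

/-- The variance of the skewness. -/
def skewVar (A : K → ι → ℝ) : ℝ := 6 / Fintype.card K * ∑ k, ∑ l, cov A k l ^ 3

/-- The variance of the kurtosis. -/
def kurtVar (A : K → ι → ℝ) : ℝ :=
  72 / Fintype.card K * ∑ k, ∑ l, cov A k l ^ 2 + 24 / Fintype.card K * ∑ k, ∑ l, cov A k l ^ 4

/-- The vector bound with a single component and Gram exponent `m = 0`, which is where `2 ≤ q` is
needed. -/
theorem exists_gaussE_hermSum_pow_le (c : ℝ) (q s : ℕ) (hq : 2 ≤ q) : ∃ B : ℝ, 0 ≤ B ∧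
    ∀ (K ι : Type) [Fintype K] [Fintype ι] [DecidableEq ι] (A : K → ι → ℝ) (_ : IsRegularCov A c),
      gaussE (hermSum A q ^ 2 ^ (s + 1)) ≤ B := by
  obtain ⟨B, hB, h⟩ := exists_gaussE_sum_singlePoly_sq_pow_le c s q
  refine ⟨B, hB, fun K ι _ _ _ A hA => ?_⟩
  have := h K ι Unit A hA.cov_self (1 / Fintype.card K) hA.sum_pow_le
    (fun _ _ => 1 / Real.sqrt (Fintype.card K)) 0 (by omega) (fun k l => by
      have : (0 : ℝ) ≤ Fintype.card K := by positivity
      simp [← mul_inv, Real.mul_self_sqrt this])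
  rw [pow_succ', pow_mul]
  simpa [hermSum] using this

theorem abs_pow_le_one_add_pow (x : ℝ) {m n : ℕ} (h : m ≤ n) : |x| ^ m ≤ 1 + |x| ^ n := by
  rcases le_total |x| 1 with hx | hx
  · have := pow_le_one₀ (n := m) (abs_nonneg x) hx
    have h2 : 0 ≤ |x| ^ n := by positivity
    linarith
  · have := pow_le_pow_right₀ hx h
    linarith

theorem exists_gaussE_skewPoly_mul_kurtPoly_sq_le (c : ℝ) (a b : ℕ) : ∃ B : ℝ, 0 ≤ B ∧
    ∀ (K ι : Type) [Fintype K] [Fintype ι] [DecidableEq ι] (A : K → ι → ℝ) (_ : IsRegularCov A c),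
      gaussE ((skewPoly A ^ a * kurtPoly A ^ b) ^ 2) ≤ B ^ 2 := by
  set s := 4 * a + 4 * b with hs
  obtain ⟨B₂, hB₂, h₂⟩ := exists_gaussE_hermSum_pow_le c 2 s le_rfl
  obtain ⟨B₃, hB₃, h₃⟩ := exists_gaussE_hermSum_pow_le c 3 s (by norm_num)
  obtain ⟨B₄, hB₄, h₄⟩ := exists_gaussE_hermSum_pow_le c 4 s (by norm_num)
  -- An even power above both `4a` and `4b`, of the form for which uniform bounds are available.
  set r := 2 ^ (s + 1) with hr
  have hsr : s < r := (Nat.lt_two_pow_self).trans (Nat.pow_lt_pow_right (by norm_num) (by omega))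
  have hev : Even r := by rw [hr, pow_succ]; simp
  refine ⟨Real.sqrt (2 + B₃ + 2 ^ (r - 1) * (B₄ + 6 ^ r * B₂)), by positivity,
    fun K ι _ _ _ A hA => ?_⟩
  rw [Real.sq_sqrt (by positivity)]
  have key : gaussE ((skewPoly A ^ a * kurtPoly A ^ b) ^ 2) ≤
      gaussE (C 2 + hermSum A 3 ^ r + C (2 ^ (r - 1)) * (hermSum A 4 ^ r + C (6 ^ r) * hermSum A 2 ^ r)) := by
    refine gaussE_mono fun x => ?_
    simp only [map_add, map_mul, map_pow, eval_C, skewPoly, kurtPoly]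
    generalize eval x (hermSum A 3) = u
    generalize eval x (hermSum A 4) = v
    generalize eval x (hermSum A 2) = w
    have h1 := abs_pow_le_one_add_pow u (m := 4 * a) (n := r) (by omega)
    have h2 := abs_pow_le_one_add_pow (v + 6 * w) (m := 4 * b) (n := r) (by omega)
    rw [hev.pow_abs] at h1 h2
    rw [Even.pow_abs ⟨2 * a, by ring⟩] at h1
    rw [Even.pow_abs ⟨2 * b, by ring⟩] at h2
    have h3 := hev.add_pow_le (a := v) (b := 6 * w)
    rw [mul_pow] at h3
    have h4 : (u ^ a * (v + 6 * w) ^ b) ^ 2 ≤ u ^ (4 * a) + (v + 6 * w) ^ (4 * b) := by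
      have e1 : u ^ (4 * a) = ((u ^ a) ^ 2) ^ 2 := by rw [← pow_mul, ← pow_mul]; congr 1; ring
      have e2 : (v + 6 * w) ^ (4 * b) = (((v + 6 * w) ^ b) ^ 2) ^ 2 := by
        rw [← pow_mul, ← pow_mul]; congr 1; ring
      rw [e1, e2, mul_pow]
      nlinarith [sq_nonneg ((u ^ a) ^ 2 - ((v + 6 * w) ^ b) ^ 2), sq_nonneg ((u ^ a) ^ 2),
        sq_nonneg (((v + 6 * w) ^ b) ^ 2)]
    linarith
  refine key.trans ?_
  simp only [map_add, gaussE_C_mul, gaussE_C]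
  have := h₂ K ι A hA
  have := h₃ K ι A hA
  have := h₄ K ι A hA
  gcongr

/-- The double sum has standard deviation `O(√n)` and the other factor is bounded in mean square, so
after division by `n` the covariance is `O(1/√n)`. -/
theorem exists_abs_gaussE_pairPoly_mul_le (c : ℝ) (hc : 0 ≤ c) (p q a b : ℕ) : ∃ B : ℝ, 0 ≤ B ∧
    ∀ (K ι : Type) [Fintype K] [Fintype ι] [DecidableEq ι] (A : K → ι → ℝ) (_ : IsRegularCov A c),
      |1 / (Fintype.card K : ℝ) * (gaussE (pairPoly A (cov A) p q * (skewPoly A ^ a * kurtPoly A ^ b)) -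
        gaussE (pairPoly A (cov A) p q) * gaussE (skewPoly A ^ a * kurtPoly A ^ b))| ≤
        B / Real.sqrt (Fintype.card K) := by
  obtain ⟨B, hB, h⟩ := exists_gaussE_skewPoly_mul_kurtPoly_sq_le c a b
  set D : ℝ := 4 * (p ^ 2 * pairConst (p - 1) q + q ^ 2 * pairConst p (q - 1)) with hD
  have hD0 : 0 ≤ D := by rw [hD]; unfold pairConst; positivity
  refine ⟨Real.sqrt (D * c) * B, by positivity, fun K ι _ _ _ A hA => ?_⟩
  have hn : (0 : ℝ) < Fintype.card K := by exact_mod_cast hA.card_pos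
  set n : ℝ := ((Fintype.card K : ℕ) : ℝ) with hndef
  have hv := variance_pairPoly_cov_le A hA.cov_self (by have := hA.nonneg; positivity) hA.cycle p q
  have := abs_gaussE_mul_sub_le (pairPoly A (cov A) p q) (skewPoly A ^ a * kurtPoly A ^ b)
    (x := Real.sqrt n * Real.sqrt (D * c)) (y := B) (by positivity) hB
    (by rw [mul_pow, Real.sq_sqrt hn.le, Real.sq_sqrt (by positivity)]
        exact hv.trans (le_of_eq (by rw [← hD]; ring))) (h K ι A hA)
  rw [abs_mul, abs_of_pos (by positivity)]
  calc 1 / n * _ ≤ 1 / n * (Real.sqrt n * Real.sqrt (D * c) * B) := by gcongr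
    _ = (Real.sqrt n / n) * (Real.sqrt (D * c) * B) := by ring
    _ = _ := by rw [Real.sqrt_div_self']; ring

theorem one_div_sqrt_card_sq : (1 / Real.sqrt (Fintype.card K)) ^ 2 = 1 / (Fintype.card K : ℝ) := by
  rw [div_pow, Real.sq_sqrt (by positivity), one_pow]

/-- Integration by parts in the first factor. The gradient of the skewness is `3 H_2`; that of `H_4
+ 6 H_2` is `4 H_3 + 12 H_1`. This identity is exact, and the approximation enters only when
`pairPoly` is replaced by its mean. -/
theorem gaussE_hermSum_succ_mul (A : K → ι → ℝ) (hA : ∀ k, cov A k k = 1) (q a b : ℕ) :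
    gaussE (hermSum A (q + 1) * (skewPoly A ^ a * kurtPoly A ^ b)) =
      a * (1 / Fintype.card K * (3 *
        gaussE (pairPoly A (cov A) q 2 * (skewPoly A ^ (a - 1) * kurtPoly A ^ b)))) +
      b * (1 / Fintype.card K * (4 *
        gaussE (pairPoly A (cov A) q 3 * (skewPoly A ^ a * kurtPoly A ^ (b - 1))) + 12 *
        gaussE (pairPoly A (cov A) q 1 * (skewPoly A ^ a * kurtPoly A ^ (b - 1))))) := by
  set δ : ℝ := 1 / Real.sqrt (Fintype.card K) with hδ
  set Φ : ℕ → ι → MvPolynomial ι ℝ := fun q i => singlePoly A (fun k => δ * A k i) q with hΦ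
  have hS : ∀ i, pderiv i (skewPoly A) = C 3 * Φ 2 i := fun i => by
    simp only [skewPoly, hermSum, pderiv_singlePoly, hΦ, hδ]; norm_num
  have hU : ∀ i, pderiv i (kurtPoly A) = C 4 * Φ 3 i + C 12 * Φ 1 i := fun i => by
    simp only [kurtPoly, hermSum, pderiv_singlePoly, hΦ, hδ, map_add, pderiv_C_mul]
    rw [← mul_assoc, ← C_mul]; norm_num
  have hΓ : ∀ r, ∑ i, Φ q i * Φ r i = C (1 / (Fintype.card K : ℝ)) * pairPoly A (cov A) q r :=
    fun r => by rw [← one_div_sqrt_card_sq]; exact sum_singlePoly_mul_singlePoly A δ q r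
  have e : ∑ i, Φ q i * pderiv i (skewPoly A ^ a * kurtPoly A ^ b) =
      C (a * 3 : ℝ) * (∑ i, Φ q i * Φ 2 i) * (skewPoly A ^ (a - 1) * kurtPoly A ^ b) +
      C (b * 4 : ℝ) * (∑ i, Φ q i * Φ 3 i) * (skewPoly A ^ a * kurtPoly A ^ (b - 1)) +
      C (b * 12 : ℝ) * (∑ i, Φ q i * Φ 1 i) * (skewPoly A ^ a * kurtPoly A ^ (b - 1)) := by
    simp only [Finset.mul_sum, Finset.sum_mul, ← Finset.sum_add_distrib]
    refine Finset.sum_congr rfl fun i _ => ?_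
    rw [Derivation.leibniz, Derivation.leibniz_pow, Derivation.leibniz_pow, hS, hU]
    simp only [smul_eq_mul, nsmul_eq_mul, C_mul, map_natCast]
    ring
  rw [hermSum, gaussE_singlePoly_succ_mul A hA, ← map_sum, e, hΓ, hΓ, hΓ]
  simp only [map_add, mul_assoc, gaussE_C_mul]
  ring

theorem abs_combination_le {α β γ x y z B₁ B₂ B₃ s : ℝ} (hα : 0 ≤ α) (hβ : 0 ≤ β) (hγ : 0 ≤ γ)
    (h1 : |x| ≤ B₁ / s) (h2 : |y| ≤ B₂ / s) (h3 : |z| ≤ B₃ / s) :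
    |α * x + β * y + γ * z| ≤ (α * B₁ + β * B₂ + γ * B₃) / s := by
  refine (abs_add_three _ _ _).trans ?_
  rw [abs_mul, abs_mul, abs_mul, abs_of_nonneg hα, abs_of_nonneg hβ, abs_of_nonneg hγ]
  have := mul_le_mul_of_nonneg_left h1 hα
  have := mul_le_mul_of_nonneg_left h2 hβ
  have := mul_le_mul_of_nonneg_left h3 hγ
  calc _ ≤ α * (B₁ / s) + β * (B₂ / s) + γ * (B₃ / s) := by linarith
    _ = _ := by ring

/-- The first moment recursion. -/
theorem exists_abs_gaussE_skewPoly_pow_succ_le (c : ℝ) (hc : 0 ≤ c) (a b : ℕ) : ∃ B : ℝ,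
    ∀ (K ι : Type) [Fintype K] [Fintype ι] [DecidableEq ι] (A : K → ι → ℝ) (_ : IsRegularCov A c),
      |gaussE (skewPoly A ^ (a + 1) * kurtPoly A ^ b) -
        a * (skewVar A * gaussE (skewPoly A ^ (a - 1) * kurtPoly A ^ b))| ≤
        B / Real.sqrt (Fintype.card K) := by
  obtain ⟨B₁, -, h₁⟩ := exists_abs_gaussE_pairPoly_mul_le c hc 2 2 (a - 1) b
  obtain ⟨B₂, -, h₂⟩ := exists_abs_gaussE_pairPoly_mul_le c hc 2 3 a (b - 1)
  obtain ⟨B₃, -, h₃⟩ := exists_abs_gaussE_pairPoly_mul_le c hc 2 1 a (b - 1)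
  refine ⟨a * 3 * B₁ + b * 4 * B₂ + b * 12 * B₃, fun K ι _ _ _ A hA => ?_⟩
  have h1 := h₁ K ι A hA
  have h2 := h₂ K ι A hA
  have h3 := h₃ K ι A hA
  rw [gaussE_pairPoly A hA.cov_self] at h1 h2 h3
  -- The pairs of degrees `(2,3)` and `(2,1)` have mean zero, so the kurtosis does not contribute to
  -- the limiting recursion.
  norm_num at h2 h3
  simp only [if_true] at h1
  have e := gaussE_hermSum_succ_mul A hA.cov_self 2 a b
  rw [show hermSum A (2 + 1) = skewPoly A from rfl] at e
  rw [pow_succ', mul_assoc, e]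
  set n : ℝ := ((Fintype.card K : ℕ) : ℝ)
  set X := gaussE (pairPoly A (cov A) 2 2 * (skewPoly A ^ (a - 1) * kurtPoly A ^ b))
  set Y := gaussE (pairPoly A (cov A) 2 3 * (skewPoly A ^ a * kurtPoly A ^ (b - 1)))
  set Z := gaussE (pairPoly A (cov A) 2 1 * (skewPoly A ^ a * kurtPoly A ^ (b - 1)))
  set W := gaussE (skewPoly A ^ (a - 1) * kurtPoly A ^ b)
  -- Here `6 = 3 · 2!`.
  have hv : skewVar A = 3 * (1 / n * ((Nat.factorial 2 : ℕ) * ∑ k, ∑ l, cov A k l * cov A k l ^ 2)) := by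
    simp only [skewVar, ← pow_succ', Nat.factorial]
    push_cast
    ring
  rw [hv]
  set Q := ((Nat.factorial 2 : ℕ) : ℝ) * ∑ k, ∑ l, cov A k l * cov A k l ^ 2
  have e2 : a * (1 / n * (3 * X)) + b * (1 / n * (4 * Y + 12 * Z)) - a * (3 * (1 / n * Q) * W) =
      a * 3 * (1 / n * (X - Q * W)) + b * 4 * (n⁻¹ * Y) + b * 12 * (n⁻¹ * Z) := by ring
  have hn : (0 : ℝ) ≤ n⁻¹ := by positivity
  clear_value n X Y Z W Q
  replace h2 : |n⁻¹ * Y| ≤ B₂ / √n := by rwa [abs_mul, abs_of_nonneg hn]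
  replace h3 : |n⁻¹ * Z| ≤ B₃ / √n := by rwa [abs_mul, abs_of_nonneg hn]
  rw [e2]
  exact abs_combination_le (by positivity) (by positivity) (by positivity) h1 h2 h3

/-- The second moment recursion. -/
theorem exists_abs_gaussE_kurtPoly_pow_succ_le (c : ℝ) (hc : 0 ≤ c) (b : ℕ) : ∃ B : ℝ,
    ∀ (K ι : Type) [Fintype K] [Fintype ι] [DecidableEq ι] (A : K → ι → ℝ) (_ : IsRegularCov A c),
      |gaussE (kurtPoly A ^ (b + 1)) - b * (kurtVar A * gaussE (kurtPoly A ^ (b - 1)))| ≤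
        B / Real.sqrt (Fintype.card K) := by
  obtain ⟨B₁, -, h₁⟩ := exists_abs_gaussE_pairPoly_mul_le c hc 3 3 0 (b - 1)
  obtain ⟨B₂, -, h₂⟩ := exists_abs_gaussE_pairPoly_mul_le c hc 3 1 0 (b - 1)
  obtain ⟨B₃, -, h₃⟩ := exists_abs_gaussE_pairPoly_mul_le c hc 1 1 0 (b - 1)
  refine ⟨b * 4 * B₁ + b * 36 * B₂ + b * 72 * B₃, fun K ι _ _ _ A hA => ?_⟩
  have h1 := h₁ K ι A hA
  have h2 := h₂ K ι A hA
  have h3 := h₃ K ι A hA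
  rw [gaussE_pairPoly A hA.cov_self] at h1 h2 h3
  -- Only the mixed pair `(3,1)` has mean zero. The pairs `(3,3)` and `(1,1)` give the two halves of
  -- the variance, with `24 = 4 · 3!` and `72 = 6 · 12 · 1!`.
  norm_num at h2
  simp only [if_true, pow_zero, one_mul] at h1 h2 h3
  have e3 := gaussE_hermSum_succ_mul A hA.cov_self 3 0 b
  have e1 := gaussE_hermSum_succ_mul A hA.cov_self 1 0 b
  simp only [pow_zero, one_mul, Nat.cast_zero, zero_mul, zero_add] at e3 e1
  rw [pairPoly_comm A 1 3] at e1
  have e : gaussE (kurtPoly A ^ (b + 1)) = gaussE (hermSum A (3 + 1) * kurtPoly A ^ b) +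
      6 * gaussE (hermSum A (1 + 1) * kurtPoly A ^ b) := by
    rw [pow_succ']
    nth_rewrite 1 [kurtPoly]
    rw [add_mul, map_add, mul_assoc, gaussE_C_mul]
  rw [e, e3, e1]
  set n : ℝ := ((Fintype.card K : ℕ) : ℝ)
  set X := gaussE (pairPoly A (cov A) 3 3 * kurtPoly A ^ (b - 1))
  set Y := gaussE (pairPoly A (cov A) 3 1 * kurtPoly A ^ (b - 1))
  set Z := gaussE (pairPoly A (cov A) 1 1 * kurtPoly A ^ (b - 1))
  set W := gaussE (kurtPoly A ^ (b - 1))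
  have hv : kurtVar A = 4 * (1 / n * ((Nat.factorial 3 : ℕ) * ∑ k, ∑ l, cov A k l * cov A k l ^ 3)) +
      72 * (1 / n * ((Nat.factorial 1 : ℕ) * ∑ k, ∑ l, cov A k l * cov A k l ^ 1)) := by
    simp only [kurtVar, ← pow_succ', Nat.factorial]
    push_cast
    ring
  rw [hv]
  set Q := ((Nat.factorial 3 : ℕ) : ℝ) * ∑ k, ∑ l, cov A k l * cov A k l ^ 3
  set R := ((Nat.factorial 1 : ℕ) : ℝ) * ∑ k, ∑ l, cov A k l * cov A k l ^ 1
  have e2 : b * (1 / n * (4 * X + 12 * Y)) + 6 * (b * (1 / n * (4 * Y + 12 * Z))) -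
      b * ((4 * (1 / n * Q) + 72 * (1 / n * R)) * W) =
      b * 4 * (1 / n * (X - Q * W)) + b * 36 * (n⁻¹ * Y) + b * 72 * (1 / n * (Z - R * W)) := by ring
  have hn : (0 : ℝ) ≤ n⁻¹ := by positivity
  clear_value n X Y Z W Q R
  replace h2 : |n⁻¹ * Y| ≤ B₂ / √n := by rwa [abs_mul, abs_of_nonneg hn]
  rw [e2]
  exact abs_combination_le (by positivity) (by positivity) (by positivity) h1 h2 h3

/-! ### Limits of the moments -/

/-- The moments of the standard normal law. -/
def normalMoment (a : ℕ) : ℝ := if Even a then ((a - 1).doubleFactorial : ℝ) else 0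

theorem normalMoment_succ (a : ℕ) : normalMoment (a + 1) = a * normalMoment (a - 1) := by
  rcases a with _ | _ | a
  · simp [normalMoment]
  · simp [normalMoment]
  · have h : Even (a + 2 + 1) ↔ Even (a + 1) := by simp [Nat.even_add_one, parity_simps]
    simp only [normalMoment, h, Nat.add_sub_cancel, show a + 1 + 1 - 1 = a + 1 from rfl]
    split_ifs
    · rw [Nat.doubleFactorial_add_two]; push_cast; ring
    · simp

/-- The first recursion lowers the exponent of the skewness for any `b`, so the second is needed
only when that exponent is zero. -/
theorem tendsto_moments_of_recursion {e : ℕ → ℕ → ℕ → ℝ} (h0 : ∀ j, e j 0 0 = 1)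
    (h1 : ∀ a b, Tendsto (fun j => e j (a + 1) b - a * e j (a - 1) b) atTop (𝓝 0))
    (h2 : ∀ b, Tendsto (fun j => e j 0 (b + 1) - b * e j 0 (b - 1)) atTop (𝓝 0)) (a b : ℕ) :
    Tendsto (fun j => e j a b) atTop (𝓝 (normalMoment a * normalMoment b)) := by
  have hn0 : normalMoment 0 = 1 := by simp [normalMoment]
  have hb : ∀ b, Tendsto (fun j => e j 0 b) atTop (𝓝 (normalMoment b)) := by
    intro b
    induction b using Nat.strong_induction_on with
    | _ b ih =>
      rcases b with _ | b
      · simp [h0, hn0]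
      · have := (h2 b).add (((ih (b - 1) (by omega)).const_mul (b : ℝ)))
        rw [normalMoment_succ]
        simpa using this
  induction a using Nat.strong_induction_on with
  | _ a ih =>
    rcases a with _ | a
    · simpa [hn0] using hb b
    · have := (h1 a b).add (((ih (a - 1) (by omega)).const_mul (a : ℝ)))
      rw [normalMoment_succ]
      simpa [mul_assoc] using this

end

/-! ### The field and its spectral series in mean square; discrete and continuous orthogonality -/

section

/-! ### The random field: spectral approximation in mean square -/

variable {Ω : Type*} [MeasurableSpace Ω] {μ : Measure Ω} [IsProbabilityMeasure μ]
  {X : ℝ → Ω → ℝ} {w : ℤ → Ω → ℂ} {C : ℤ → ℝ}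

/-- The partial sums of the spectral representation. -/
def partialField (w : ℤ → Ω → ℂ) (L : ℕ) (θ : ℝ) (ω : Ω) : ℂ :=
  ∑ l ∈ Finset.Icc (-(L : ℤ)) L, w l ω * Complex.exp (Complex.I * l * θ)

/-- The mean square error of the partial sums. -/
def tailSq (C : ℤ → ℝ) (L : ℕ) : ℝ := ∑' l, C l - ∑ l ∈ Finset.Icc (-(L : ℤ)) L, C l

theorem IsField.spectrum_nonneg (hX : IsField μ X w C) (l : ℤ) : 0 ≤ C l := by
  rw [← hX.variance l]; positivity

theorem IsField.spectrum_neg (hX : IsField μ X w C) (l : ℤ) : C (-l) = C l := by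
  rw [← hX.variance l, ← hX.variance (-l)]
  refine integral_congr_ae ?_
  filter_upwards [hX.hermitian l] with ω h
  rw [h, RCLike.norm_conj]

theorem tendsto_tailSq (hC : Summable C) : Tendsto (tailSq C) atTop (𝓝 0) := by
  have h : Tendsto (fun L : ℕ => Finset.Icc (-(L : ℤ)) L) atTop atTop := by
    refine tendsto_atTop_finset_of_monotone (fun a b hab => ?_) fun l => ⟨l.natAbs, ?_⟩
    · exact Finset.Icc_subset_Icc (by omega) (by omega)
    · rw [Finset.mem_Icc]; omega
  have := (hC.hasSum.comp h).const_sub (∑' l, C l)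
  rw [sub_self] at this
  exact this

theorem IsField.memLp_sum (hX : IsField μ X w C) (F : Finset ℤ) (c : ℤ → ℂ) :
    MemLp (fun ω => ∑ l ∈ F, c l * w l ω) 2 μ :=
  memLp_finsetSum F fun l _ => (hX.memLp l).const_mul (c l)

theorem IsField.integral_mul_conj (hX : IsField μ X w C) (l l' : ℤ) :
    ∫ ω, w l ω * conj (w l' ω) ∂μ = if l = l' then (C l : ℂ) else 0 := by
  split_ifs with h
  · subst h
    rw [← hX.variance l, ← integral_complex_ofReal]
    refine integral_congr_ae (Eventually.of_forall fun ω => ?_)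
    simp only [RCLike.mul_conj]
    push_cast
    rfl
  · exact hX.uncorrelated l l' h

theorem IsField.integral_norm_sum_sq (hX : IsField μ X w C) (F : Finset ℤ) (c : ℤ → ℂ) :
    ∫ ω, ‖∑ l ∈ F, c l * w l ω‖ ^ 2 ∂μ = ∑ l ∈ F, ‖c l‖ ^ 2 * C l := by
  have hint : ∀ l l', Integrable (fun ω => c l * conj (c l') * (w l ω * conj (w l' ω))) μ :=
    fun l l' => ((hX.memLp l).integrable_mul (q := 2) (hX.memLp l').star).const_mul _
  have h : ((∫ ω, ‖∑ l ∈ F, c l * w l ω‖ ^ 2 ∂μ : ℝ) : ℂ) =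
      ((∑ l ∈ F, ‖c l‖ ^ 2 * C l : ℝ) : ℂ) := by
    rw [← integral_complex_ofReal]
    have e : ∀ ω, ((‖∑ l ∈ F, c l * w l ω‖ ^ 2 : ℝ) : ℂ) =
        ∑ l ∈ F, ∑ l' ∈ F, c l * conj (c l') * (w l ω * conj (w l' ω)) := by
      intro ω
      push_cast
      rw [← Complex.mul_conj', map_sum, Finset.sum_mul_sum]
      refine Finset.sum_congr rfl fun l _ => Finset.sum_congr rfl fun l' _ => ?_
      rw [map_mul]; ring
    simp only [e]
    rw [integral_finsetSum _ fun l _ => integrable_finsetSum _ fun l' _ => hint l l']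
    push_cast
    refine Finset.sum_congr rfl fun l hl => ?_
    rw [integral_finsetSum _ fun l' _ => hint l l']
    simp only [integral_const_mul, hX.integral_mul_conj, mul_ite, mul_zero]
    rw [Finset.sum_ite_eq, if_pos hl, RCLike.mul_conj]
    rfl
  exact_mod_cast h

theorem eLpNorm_two_eq {f : Ω → ℂ} (hf : MemLp f 2 μ) :
    eLpNorm f 2 μ = ENNReal.ofReal (Real.sqrt (∫ ω, ‖f ω‖ ^ 2 ∂μ)) := by
  rw [hf.eLpNorm_eq_integral_rpow_norm (by norm_num) (by norm_num)]
  simp only [ENNReal.toReal_ofNat, Real.rpow_ofNat]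
  rw [Real.sqrt_eq_rpow, one_div]

theorem IsField.eLpNorm_sum (hX : IsField μ X w C) (F : Finset ℤ) (c : ℤ → ℂ) :
    eLpNorm (fun ω => ∑ l ∈ F, c l * w l ω) 2 μ =
      ENNReal.ofReal (Real.sqrt (∑ l ∈ F, ‖c l‖ ^ 2 * C l)) := by
  rw [eLpNorm_two_eq (hX.memLp_sum F c), hX.integral_norm_sum_sq]

theorem norm_exp_I_mul_int_mul (l : ℤ) (θ : ℝ) : ‖Complex.exp (Complex.I * l * θ)‖ = 1 := by
  rw [mul_assoc, mul_comm, show (l : ℂ) * θ = ((l * θ : ℝ) : ℂ) by push_cast; ring]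
  exact Complex.norm_exp_ofReal_mul_I _

theorem IsField.aestronglyMeasurable_partialField (hX : IsField μ X w C) (L : ℕ) (θ : ℝ) :
    AEStronglyMeasurable (partialField w L θ) μ :=
  (memLp_finsetSum _ fun l _ => (hX.memLp l).mul_const _).aestronglyMeasurable

theorem IsField.measurable_apply (hX : IsField μ X w C) (θ : ℝ) : Measurable (X θ) :=
  hX.measurable.comp (measurable_const.prodMk measurable_id)

/-- The block between the `L`-th and `M`-th partial sums has an exact norm by orthogonality; then `M
→ ∞`. The bound is uniform in `θ`, which makes it usable inside integrals and Riemann sums. -/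
theorem IsField.eLpNorm_sub_partialField_le (hX : IsField μ X w C) (L : ℕ) (θ : ℝ) :
    eLpNorm (fun ω => (X θ ω : ℂ) - partialField w L θ ω) 2 μ ≤
      ENNReal.ofReal (Real.sqrt (tailSq C L)) := by
  have hm : AEStronglyMeasurable (fun ω => (X θ ω : ℂ)) μ :=
    (Complex.measurable_ofReal.comp (hX.measurable_apply θ)).aestronglyMeasurable
  have h1 : ∀ᶠ M : ℕ in atTop, eLpNorm (fun ω => (X θ ω : ℂ) - partialField w L θ ω) 2 μ ≤
      eLpNorm (fun ω => (X θ ω : ℂ) - partialField w M θ ω) 2 μ +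
        ENNReal.ofReal (Real.sqrt (tailSq C L)) := by
    filter_upwards [eventually_ge_atTop L] with M hM
    have hsub : Finset.Icc (-(L : ℤ)) L ⊆ Finset.Icc (-(M : ℤ)) M :=
      Finset.Icc_subset_Icc (by omega) (by omega)
    have hdiff : ∀ ω, partialField w M θ ω - partialField w L θ ω =
        ∑ l ∈ Finset.Icc (-(M : ℤ)) M \ Finset.Icc (-(L : ℤ)) L,
          Complex.exp (Complex.I * l * θ) * w l ω := by
      intro ω
      rw [partialField, partialField, ← Finset.sum_sdiff hsub, add_sub_cancel_right]
      exact Finset.sum_congr rfl fun l _ => mul_comm _ _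
    have e : (fun ω => (X θ ω : ℂ) - partialField w L θ ω) =
        (fun ω => (X θ ω : ℂ) - partialField w M θ ω) +
        (fun ω => ∑ l ∈ Finset.Icc (-(M : ℤ)) M \ Finset.Icc (-(L : ℤ)) L,
          Complex.exp (Complex.I * l * θ) * w l ω) := by
      ext ω
      rw [Pi.add_apply, ← hdiff]; ring
    rw [e]
    refine (eLpNorm_add_le (hm.sub (hX.aestronglyMeasurable_partialField M θ))
      (hX.memLp_sum _ _).aestronglyMeasurable (by norm_num)).trans ?_
    refine add_le_add le_rfl ?_
    rw [hX.eLpNorm_sum]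
    refine ENNReal.ofReal_le_ofReal (Real.sqrt_le_sqrt ?_)
    simp only [norm_exp_I_mul_int_mul, one_pow, one_mul]
    rw [tailSq, ← add_sub_cancel_right (∑ l ∈ Finset.Icc (-(M : ℤ)) M \ _, C l)
      (∑ l ∈ Finset.Icc (-(L : ℤ)) L, C l), Finset.sum_sdiff hsub]
    gcongr
    exact hX.summable.sum_le_tsum _ fun l _ => hX.spectrum_nonneg l
  have h2 : Tendsto (fun M : ℕ => eLpNorm (fun ω => (X θ ω : ℂ) - partialField w M θ ω) 2 μ +
        ENNReal.ofReal (Real.sqrt (tailSq C L))) atTop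
        (𝓝 (0 + ENNReal.ofReal (Real.sqrt (tailSq C L)))) := (hX.series θ).add_const _
  rw [zero_add] at h2
  exact ge_of_tendsto h2 h1

theorem IsField.tendsto_tail (hX : IsField μ X w C) :
    Tendsto (fun L => ENNReal.ofReal (Real.sqrt (tailSq C L))) atTop (𝓝 0) := by
  have := ENNReal.tendsto_ofReal ((Real.continuous_sqrt.tendsto 0).comp (tendsto_tailSq hX.summable))
  simpa using this

theorem IsField.memLp_apply (hX : IsField μ X w C) (θ : ℝ) : MemLp (X θ) 2 μ := by
  have h1 : MemLp (fun ω => (X θ ω : ℂ) - partialField w 0 θ ω) 2 μ :=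
    ⟨((Complex.measurable_ofReal.comp (hX.measurable_apply θ)).aestronglyMeasurable).sub
      (hX.aestronglyMeasurable_partialField 0 θ),
      (hX.eLpNorm_sub_partialField_le 0 θ).trans_lt ENNReal.ofReal_lt_top⟩
  have h2 : MemLp (partialField w 0 θ) 2 μ :=
    memLp_finsetSum _ fun l _ => (hX.memLp l).mul_const _
  have h3 := h1.add h2
  refine h3.re.congr_norm (hX.measurable_apply θ).aestronglyMeasurable
    (Eventually.of_forall fun ω => ?_)
  simp

theorem IsField.integral_apply (hX : IsField μ X w C) (θ : ℝ) : ∫ ω, X θ ω ∂μ = 0 := by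
  have hXc : MemLp (fun ω => (X θ ω : ℂ)) 2 μ := (hX.memLp_apply θ).ofReal
  have hp : ∀ L, MemLp (partialField w L θ) 2 μ := fun L =>
    memLp_finsetSum _ fun l _ => (hX.memLp l).mul_const _
  have hz : ∀ L, ∫ ω, partialField w L θ ω ∂μ = 0 := by
    intro L
    unfold partialField
    rw [integral_finsetSum _ fun l _ => ((hX.memLp l).mul_const _).integrable (by norm_num)]
    simp [integral_mul_const, hX.mean]
  have hle : ∀ L, ‖∫ ω, (X θ ω : ℂ) ∂μ‖ₑ ≤ ENNReal.ofReal (Real.sqrt (tailSq C L)) := by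
    intro L
    have : ∫ ω, (X θ ω : ℂ) ∂μ = ∫ ω, ((X θ ω : ℂ) - partialField w L θ ω) ∂μ := by
      rw [integral_sub (hXc.integrable (by norm_num)) ((hp L).integrable (by norm_num)), hz, sub_zero]
    rw [this]
    refine (enorm_integral_le_lintegral_enorm _).trans ?_
    rw [← eLpNorm_one_eq_lintegral_enorm]
    refine (eLpNorm_le_eLpNorm_of_exponent_le (q := 2) (by norm_num)
      (hXc.sub (hp L)).aestronglyMeasurable).trans (hX.eLpNorm_sub_partialField_le L θ)
  have h0 : ‖∫ ω, (X θ ω : ℂ) ∂μ‖ₑ ≤ 0 := ge_of_tendsto' hX.tendsto_tail hle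
  have h1 : ∫ ω, (X θ ω : ℂ) ∂μ = 0 := by simpa using h0
  have h2 : ((∫ ω, X θ ω ∂μ : ℝ) : ℂ) = 0 := by rw [← h1]; exact integral_ofReal.symm
  exact_mod_cast h2

/-! ### Quadrature of trigonometric polynomials -/

theorem sum_range_exp (M : ℕ) (hM : 0 < M) (j : ℤ) :
    ∑ m ∈ Finset.range M, Complex.exp (Complex.I * j * ((m * (2 * Real.pi / M) : ℝ) : ℂ)) =
      if (M : ℤ) ∣ j then (M : ℂ) else 0 := by
  have : NeZero M := ⟨hM.ne'⟩
  have h := sum_stdAddChar_mul (j : ZMod M)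
  have e : ∑ m ∈ Finset.range M, Complex.exp (Complex.I * j * ((m * (2 * Real.pi / M) : ℝ) : ℂ)) =
      ∑ m ∈ Finset.range M, ZMod.stdAddChar ((j : ZMod M) * (m : ZMod M)) := by
    refine Finset.sum_congr rfl fun m _ => ?_
    have : ((j : ZMod M) * (m : ZMod M)) = ((j * m : ℤ) : ZMod M) := by push_cast; rfl
    rw [this, ZMod.stdAddChar_coe]
    congr 1; push_cast; ring
  rw [e]
  have e2 : ∑ m ∈ Finset.range M, (ZMod.stdAddChar ((j : ZMod M) * (m : ZMod M)) : ℂ) =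
      ∑ m : ZMod M, (ZMod.stdAddChar ((j : ZMod M) * m) : ℂ) := by
    refine Finset.sum_bij' (fun m _ => (m : ZMod M)) (fun x _ => x.val) (by simp)
      (fun x _ => by simpa using ZMod.val_lt x) (fun m hm => ?_) (fun x _ => by simp) (by simp)
    exact ZMod.val_cast_of_lt (Finset.mem_range.1 hm)
  rw [e2, h]
  simp only [ZMod.intCast_zmod_eq_zero_iff_dvd]

theorem intervalIntegral_exp (j : ℤ) :
    ∫ θ in (-Real.pi)..Real.pi, Complex.exp (Complex.I * j * (θ : ℂ)) =
      if j = 0 then 2 * (Real.pi : ℂ) else 0 := by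
  split_ifs with h
  · subst h; simp; ring
  · have hc : Complex.I * j ≠ 0 := mul_ne_zero Complex.I_ne_zero (by exact_mod_cast h)
    rw [integral_exp_mul_complex hc]
    have : Complex.exp (Complex.I * j * (Real.pi : ℂ)) =
        Complex.exp (Complex.I * j * ((-Real.pi : ℝ) : ℂ)) := by
      rw [Complex.exp_eq_exp_iff_exists_int]
      exact ⟨j, by push_cast; ring⟩
    rw [this, sub_self, zero_div]

end

/-! ### Integrals of the field against trigonometric polynomials -/

section

variable {Ω : Type*} [MeasurableSpace Ω] {μ : Measure Ω} [IsProbabilityMeasure μ]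
  {X : ℝ → Ω → ℝ} {w : ℤ → Ω → ℂ} {C : ℤ → ℝ}

/-! ### Integrals of the field against trigonometric polynomials -/

/-- `h` is the trigonometric polynomial with coefficients `c` supported on `F`. -/
def IsTrigPoly (h : ℝ → ℝ) (F : Finset ℤ) (c : ℤ → ℂ) : Prop :=
  ∀ θ, (h θ : ℂ) = ∑ n ∈ F, c n * Complex.exp (Complex.I * n * θ)

variable {h : ℝ → ℝ} {F : Finset ℤ} {c : ℤ → ℂ}

theorem IsTrigPoly.abs_le (hh : IsTrigPoly h F c) (θ : ℝ) : |h θ| ≤ ∑ n ∈ F, ‖c n‖ := by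
  rw [← Real.norm_eq_abs, ← Complex.norm_real, hh θ]
  refine (norm_sum_le _ _).trans (Finset.sum_le_sum fun n _ => ?_)
  rw [norm_mul, norm_exp_I_mul_int_mul, mul_one]

theorem IsTrigPoly.continuous (hh : IsTrigPoly h F c) : Continuous h := by
  have : h = fun θ : ℝ => (∑ n ∈ F, c n * Complex.exp (Complex.I * n * (θ : ℂ))).re := by
    ext θ; rw [← hh θ, Complex.ofReal_re]
  rw [this]
  fun_prop

theorem exp_I_mul_add (l n : ℤ) (θ : ℝ) : Complex.exp (Complex.I * l * θ) *
    Complex.exp (Complex.I * n * θ) = Complex.exp (Complex.I * (l + n : ℤ) * θ) := by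
  rw [← Complex.exp_add]; congr 1; push_cast; ring

theorem IsTrigPoly.partialField_mul (hh : IsTrigPoly h F c) (L : ℕ) (θ : ℝ) (ω : Ω) :
    partialField w L θ ω * h θ = ∑ l ∈ Finset.Icc (-(L : ℤ)) L, ∑ n ∈ F,
      w l ω * c n * Complex.exp (Complex.I * (l + n : ℤ) * θ) := by
  rw [hh, partialField, Finset.sum_mul_sum]
  refine Finset.sum_congr rfl fun l _ => Finset.sum_congr rfl fun n _ => ?_
  rw [← exp_I_mul_add]; ring

/-- Common to quadrature, with `κ = 2L + 1`, and to integration, with `κ = 2π`: either functional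
need only isolate frequency zero among `|j| ≤ 2L`. -/
theorem sum_sum_mul_delta {L : ℕ} (hF : F ⊆ Finset.Icc (-(L : ℤ)) L) (δ : ℤ → ℂ) (κ : ℂ)
    (hδ : ∀ j : ℤ, |j| ≤ 2 * L → δ j = if j = 0 then κ else 0) (ω : Ω) :
    ∑ l ∈ Finset.Icc (-(L : ℤ)) L, ∑ n ∈ F, w l ω * c n * δ (l + n) =
      κ * ∑ n ∈ F, c n * w (-n) ω := by
  rw [Finset.sum_comm, Finset.mul_sum]
  refine Finset.sum_congr rfl fun n hn => ?_
  have hn' := Finset.mem_Icc.1 (hF hn)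
  rw [Finset.sum_eq_single (-n)]
  · rw [hδ _ (by simp), if_pos (by ring)]; ring
  · intro l hl hne
    have hl' := Finset.mem_Icc.1 hl
    rw [hδ _ (abs_le.2 ⟨by omega, by omega⟩), if_neg (by omega), mul_zero]
  · intro hni
    exact absurd (Finset.mem_Icc.2 ⟨by omega, by omega⟩) hni

/-- The product has frequencies at most `2L` in absolute value, so equally spaced quadrature with
`2L + 1` nodes is free of aliasing. -/
theorem IsTrigPoly.sum_partialField (hh : IsTrigPoly h F c) {L : ℕ}
    (hF : F ⊆ Finset.Icc (-(L : ℤ)) L) (ω : Ω) :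
    ∑ m ∈ Finset.range (2 * L + 1),
      partialField w L (m * (2 * Real.pi / (2 * L + 1 : ℕ))) ω *
        h (m * (2 * Real.pi / (2 * L + 1 : ℕ))) =
      (2 * L + 1 : ℕ) * ∑ n ∈ F, c n * w (-n) ω := by
  simp only [hh.partialField_mul]
  rw [Finset.sum_comm]
  rw [← sum_sum_mul_delta hF (fun j => ∑ m ∈ Finset.range (2 * L + 1),
    Complex.exp (Complex.I * j * ((m * (2 * Real.pi / (2 * L + 1 : ℕ)) : ℝ) : ℂ)))
    ((2 * L + 1 : ℕ) : ℂ) (fun j hj => ?_) ω]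
  · refine Finset.sum_congr rfl fun l _ => ?_
    rw [Finset.sum_comm]
    exact Finset.sum_congr rfl fun n _ => by rw [Finset.mul_sum]
  · simp only [sum_range_exp (2 * L + 1) (by omega)]
    congr 1
    refine propext ⟨fun hd => ?_, fun h0 => by simp [h0]⟩
    exact Int.eq_zero_of_abs_lt_dvd hd (by push_cast; omega)

theorem IsTrigPoly.integral_partialField (hh : IsTrigPoly h F c) {L : ℕ}
    (hF : F ⊆ Finset.Icc (-(L : ℤ)) L) (ω : Ω) :
    ∫ θ in (-Real.pi)..Real.pi, partialField w L θ ω * h θ =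
      2 * Real.pi * ∑ n ∈ F, c n * w (-n) ω := by
  simp only [hh.partialField_mul]
  have hint : ∀ l n : ℤ, IntervalIntegrable (fun θ : ℝ => w l ω * c n *
      Complex.exp (Complex.I * (l + n : ℤ) * (θ : ℂ))) volume (-Real.pi) Real.pi := fun l n =>
    Continuous.intervalIntegrable (by fun_prop) _ _
  have hint2 : ∀ l : ℤ, IntervalIntegrable (fun θ : ℝ => ∑ n ∈ F, w l ω * c n *
      Complex.exp (Complex.I * (l + n : ℤ) * (θ : ℂ))) volume (-Real.pi) Real.pi := fun l =>
    Continuous.intervalIntegrable (by fun_prop) _ _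
  rw [intervalIntegral.integral_finsetSum fun l _ => hint2 l]
  rw [← sum_sum_mul_delta hF (fun j => ∫ θ in (-Real.pi)..Real.pi,
    Complex.exp (Complex.I * j * (θ : ℂ))) (2 * (Real.pi : ℂ)) (fun j _ => intervalIntegral_exp j) ω]
  refine Finset.sum_congr rfl fun l _ => ?_
  rw [intervalIntegral.integral_finsetSum fun n _ => hint l n]
  exact Finset.sum_congr rfl fun n _ => intervalIntegral.integral_const_mul _ _

theorem exists_subset_Icc (F : Finset ℤ) : ∃ L₀ : ℕ, ∀ L : ℕ, L₀ ≤ L →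
    F ⊆ Finset.Icc (-(L : ℤ)) L := by
  refine ⟨F.sup Int.natAbs, fun L hL l hl => ?_⟩
  have := Finset.le_sup (f := Int.natAbs) hl
  rw [Finset.mem_Icc]; omega

theorem IsField.lintegral_enorm_le (hX : IsField μ X w C) (L : ℕ) (θ : ℝ) :
    ∫⁻ ω, ‖(X θ ω : ℂ) - partialField w L θ ω‖ₑ ∂μ ≤ ENNReal.ofReal (Real.sqrt (tailSq C L)) := by
  rw [← eLpNorm_one_eq_lintegral_enorm]
  refine (eLpNorm_le_eLpNorm_of_exponent_le (q := 2) (by norm_num) ?_).trans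
    (hX.eLpNorm_sub_partialField_le L θ)
  exact ((Complex.measurable_ofReal.comp (hX.measurable_apply θ)).aestronglyMeasurable).sub
      (hX.aestronglyMeasurable_partialField L θ)

theorem IsField.measurable_integral (hX : IsField μ X w C) {h : ℝ → ℝ} (hh : Continuous h) :
    Measurable fun ω => 1 / (2 * Real.pi) * ∫ θ in (-Real.pi)..Real.pi, X θ ω * h θ := by
  have h1 : StronglyMeasurable (fun p : Ω × ℝ => X p.2 p.1 * h p.2) :=
    ((hX.measurable.comp measurable_swap).mul
      (hh.measurable.comp measurable_snd)).stronglyMeasurable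
  have h2 : StronglyMeasurable fun ω => ∫ θ in (-Real.pi)..Real.pi, X θ ω * h θ := by
    simp only [intervalIntegral]
    exact (h1.integral_prod_right').sub (h1.integral_prod_right')
  exact h2.measurable.const_mul _

/-- The integral of the field against a trigonometric polynomial is a linear combination of
the spectral coefficients. -/
theorem IsField.integral_mul_trigPoly (hX : IsField μ X w C) (hh : IsTrigPoly h F c) :
    ∀ᵐ ω ∂μ, ((1 / (2 * Real.pi) * ∫ θ in (-Real.pi)..Real.pi, X θ ω * h θ : ℝ) : ℂ) =
      ∑ n ∈ F, c n * w (-n) ω := by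
  set ν : Measure ℝ := volume.restrict (Set.uIoc (-Real.pi) Real.pi) with hν
  have hνfin : IsFiniteMeasure ν := by
    rw [hν, Set.uIoc]; infer_instance
  set H : ℝ := ∑ n ∈ F, ‖c n‖ with hH
  obtain ⟨L₀, hL₀⟩ := exists_subset_Icc F
  set D : ℕ → ℝ → Ω → ℂ := fun L θ ω => ((X θ ω : ℂ) - partialField w L θ ω) * h θ with hD
  have hXm : AEStronglyMeasurable (fun p : ℝ × Ω => ((X p.1 p.2 : ℝ) : ℂ)) (ν.prod μ) :=
    (Complex.measurable_ofReal.comp hX.measurable).aestronglyMeasurable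
  have hPm : ∀ L, AEStronglyMeasurable (fun p : ℝ × Ω => partialField w L p.1 p.2) (ν.prod μ) := by
    intro L
    refine Finset.aestronglyMeasurable_fun_sum _ fun l _ => ?_
    refine ((hX.memLp l).aestronglyMeasurable.comp_snd).mul ?_
    have : Continuous fun θ : ℝ => Complex.exp (Complex.I * l * θ) := by fun_prop
    exact (this.measurable.comp measurable_fst).aestronglyMeasurable
  have hhm : AEStronglyMeasurable (fun p : ℝ × Ω => ((h p.1 : ℝ) : ℂ)) (ν.prod μ) :=
    ((Complex.continuous_ofReal.comp hh.continuous).measurable.comp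
      measurable_fst).aestronglyMeasurable
  have hDm : ∀ L, AEStronglyMeasurable (Function.uncurry (D L)) (ν.prod μ) := fun L =>
    (hXm.sub (hPm L)).mul hhm
  -- Tonelli moves the expectation inside, where the bound on the tail is uniform in `θ`.
  have hDint : ∀ L, ∫⁻ ω, ∫⁻ θ, ‖D L θ ω‖ₑ ∂ν ∂μ ≤
      ENNReal.ofReal H * ν Set.univ * ENNReal.ofReal (Real.sqrt (tailSq C L)) := by
    intro L
    rw [← lintegral_lintegral_swap (hDm L).enorm]
    calc ∫⁻ θ, ∫⁻ ω, ‖D L θ ω‖ₑ ∂μ ∂ν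
        ≤ ∫⁻ _, ENNReal.ofReal (Real.sqrt (tailSq C L)) * ENNReal.ofReal H ∂ν := by
          refine lintegral_mono fun θ => ?_
          have e : ∀ ω, ‖D L θ ω‖ₑ = ‖(X θ ω : ℂ) - partialField w L θ ω‖ₑ * ‖(h θ : ℂ)‖ₑ :=
            fun ω => enorm_mul _ _
          simp only [e]
          rw [lintegral_mul_const' _ _ (by simp)]
          gcongr
          · exact hX.lintegral_enorm_le L θ
          · rw [← ofReal_norm, Complex.norm_real, Real.norm_eq_abs]
            exact ENNReal.ofReal_le_ofReal (hh.abs_le θ)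
      _ = _ := by rw [lintegral_const]; ring
  have hfin : ∀ᵐ ω ∂μ, ∀ L, Integrable (fun θ => D L θ ω) ν := by
    rw [ae_all_iff]
    intro L
    have h1 : ∀ᵐ ω ∂μ, ∫⁻ θ, ‖D L θ ω‖ₑ ∂ν < ⊤ := by
      refine ae_lt_top' ((hDm L).enorm.lintegral_prod_left') ?_
      refine ((hDint L).trans_lt ?_).ne
      exact ENNReal.mul_lt_top (ENNReal.mul_lt_top (by simp) (measure_lt_top _ _)) (by simp)
    have h2 : ∀ᵐ ω ∂μ, AEStronglyMeasurable (fun θ => D L θ ω) ν :=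
      ((hDm L).prod_swap.prodMk_left)
    filter_upwards [h1, h2] with ω h1 h2
    exact ⟨h2, h1⟩
  -- Once the partial sum covers `F`, its integral gives the right-hand combination exactly, and
  -- only the remainder `D L` is left. The left side does not involve `L`, so its expectation
  -- vanishes in the limit.
  have hkey : ∀ᵐ ω ∂μ, ∀ L, L₀ ≤ L →
      ‖((1 / (2 * Real.pi) * ∫ θ in (-Real.pi)..Real.pi, X θ ω * h θ : ℝ) : ℂ) -
        ∑ n ∈ F, c n * w (-n) ω‖ₑ ≤ ENNReal.ofReal (1 / (2 * Real.pi)) * ∫⁻ θ, ‖D L θ ω‖ₑ ∂ν := by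
    filter_upwards [hfin] with ω hω L hL
    have hDi : IntervalIntegrable (fun θ => D L θ ω) volume (-Real.pi) Real.pi :=
      intervalIntegrable_iff.2 (hω L)
    have hPi : IntervalIntegrable (fun θ => partialField w L θ ω * h θ) volume
        (-Real.pi) Real.pi := by
      refine Continuous.intervalIntegrable ?_ _ _
      have := hh.continuous
      unfold partialField
      fun_prop
    have e1 : ∫ θ in (-Real.pi)..Real.pi, ((X θ ω * h θ : ℝ) : ℂ) =
        (∫ θ in (-Real.pi)..Real.pi, D L θ ω) + 2 * Real.pi * ∑ n ∈ F, c n * w (-n) ω := by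
      rw [← hh.integral_partialField (hL₀ L hL), ← intervalIntegral.integral_add hDi hPi]
      refine intervalIntegral.integral_congr fun θ _ => ?_
      simp only [hD]; push_cast; ring
    have e2 : ((1 / (2 * Real.pi) * ∫ θ in (-Real.pi)..Real.pi, X θ ω * h θ : ℝ) : ℂ) -
        ∑ n ∈ F, c n * w (-n) ω = ((1 / (2 * Real.pi) : ℝ) : ℂ) *
          ∫ θ in (-Real.pi)..Real.pi, D L θ ω := by
      rw [Complex.ofReal_mul, ← intervalIntegral.integral_ofReal, e1]
      have : (Real.pi : ℂ) ≠ 0 := by exact_mod_cast Real.pi_ne_zero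
      push_cast
      field_simp
      ring
    rw [e2, enorm_mul]
    gcongr
    · rw [← ofReal_norm, Complex.norm_real, Real.norm_of_nonneg (by positivity)]
    · rw [← ofReal_norm, intervalIntegral.norm_intervalIntegral_eq, ofReal_norm]
      exact enorm_integral_le_lintegral_enorm _
  have hzero : ∫⁻ ω, ‖((1 / (2 * Real.pi) * ∫ θ in (-Real.pi)..Real.pi, X θ ω * h θ : ℝ) : ℂ) -
        ∑ n ∈ F, c n * w (-n) ω‖ₑ ∂μ ≤ 0 := by
    have hlim : Tendsto (fun L => ENNReal.ofReal (1 / (2 * Real.pi)) * (ENNReal.ofReal H *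
        ν Set.univ * ENNReal.ofReal (Real.sqrt (tailSq C L)))) atTop (𝓝 0) := by
      have := ENNReal.Tendsto.const_mul (a := ENNReal.ofReal (1 / (2 * Real.pi)) *
        (ENNReal.ofReal H * ν Set.univ)) hX.tendsto_tail
        (Or.inr (ENNReal.mul_ne_top (by simp) (ENNReal.mul_ne_top (by simp) (measure_ne_top _ _))))
      simpa [mul_assoc] using this
    refine ge_of_tendsto hlim ?_
    filter_upwards [eventually_ge_atTop L₀] with L hL
    calc _ ≤ ∫⁻ ω, ENNReal.ofReal (1 / (2 * Real.pi)) * ∫⁻ θ, ‖D L θ ω‖ₑ ∂ν ∂μ := by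
          refine lintegral_mono_ae ?_
          filter_upwards [hkey] with ω hω using hω L hL
      _ = ENNReal.ofReal (1 / (2 * Real.pi)) * ∫⁻ ω, ∫⁻ θ, ‖D L θ ω‖ₑ ∂ν ∂μ :=
          lintegral_const_mul' _ _ (by simp)
      _ ≤ _ := by gcongr; exact hDint L
  have hae : ∀ᵐ ω ∂μ, ‖((1 / (2 * Real.pi) * ∫ θ in (-Real.pi)..Real.pi, X θ ω * h θ : ℝ) : ℂ) -
        ∑ n ∈ F, c n * w (-n) ω‖ₑ = 0 := by
    refine (lintegral_eq_zero_iff' ?_).1 (le_antisymm hzero bot_le)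
    refine (AEStronglyMeasurable.sub ?_ ?_).enorm
    · exact (Complex.measurable_ofReal.comp
        (hX.measurable_integral hh.continuous)).aestronglyMeasurable
    · exact (memLp_finsetSum F fun n _ => (hX.memLp (-n)).const_mul (c n)).aestronglyMeasurable
  filter_upwards [hae] with ω hω
  exact sub_eq_zero.1 (by simpa using hω)

end

/-! ### Linear functionals as mean-square limits of Gaussian Riemann sums -/

section

variable {Ω : Type*} [MeasurableSpace Ω] {μ : Measure Ω} [IsProbabilityMeasure μ]
  {X : ℝ → Ω → ℝ} {w : ℤ → Ω → ℂ} {C : ℤ → ℝ} {h : ℝ → ℝ} {F : Finset ℤ} {c : ℤ → ℂ}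

/-! ### Gaussianity of linear functionals of the field -/

/-- A Riemann sum for the integral of the field against `h`. -/
def riemannSum (X : ℝ → Ω → ℝ) (h : ℝ → ℝ) (M : ℕ) (ω : Ω) : ℝ :=
  ∑ m ∈ Finset.range M, h (m * (2 * Real.pi / M)) / M * X (m * (2 * Real.pi / M)) ω

theorem IsField.memLp_riemannSum (hX : IsField μ X w C) (h : ℝ → ℝ) (M : ℕ) :
    MemLp (riemannSum X h M) 2 μ :=
  memLp_finsetSum _ fun _ _ => (hX.memLp_apply _).const_mul _

theorem IsField.integral_riemannSum (hX : IsField μ X w C) (h : ℝ → ℝ) (M : ℕ) :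
    ∫ ω, riemannSum X h M ω ∂μ = 0 := by
  unfold riemannSum
  rw [integral_finsetSum _ fun m _ => ((hX.memLp_apply _).const_mul _).integrable (by norm_num)]
  simp [integral_const_mul, hX.integral_apply]

/-- Quadrature is exact on the partial sum of order `L`, so the whole error is the average over the
nodes of the tail of the field. -/
theorem IsField.eLpNorm_riemannSum_sub_le (hX : IsField μ X w C) (hh : IsTrigPoly h F c) {L : ℕ}
    (hF : F ⊆ Finset.Icc (-(L : ℤ)) L) :
    eLpNorm (fun ω => (riemannSum X h (2 * L + 1) ω : ℂ) - ∑ n ∈ F, c n * w (-n) ω) 2 μ ≤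
      ENNReal.ofReal ((∑ n ∈ F, ‖c n‖) * Real.sqrt (tailSq C L)) := by
  set M : ℕ := 2 * L + 1 with hM
  have hM0 : (0 : ℝ) < M := by positivity
  have hMc : (M : ℂ) ≠ 0 := by exact_mod_cast hM0.ne'
  have e : (fun ω => (riemannSum X h M ω : ℂ) - ∑ n ∈ F, c n * w (-n) ω) =
      ∑ m ∈ Finset.range M, (fun ω => ((h (m * (2 * Real.pi / M)) / M : ℝ) : ℂ) *
        ((X (m * (2 * Real.pi / M)) ω : ℂ) - partialField w L (m * (2 * Real.pi / M)) ω)) := by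
    ext ω
    have h1 := hh.sum_partialField (w := w) hF ω
    rw [← hM] at h1
    have h2 : ∑ n ∈ F, c n * w (-n) ω = ∑ m ∈ Finset.range M,
        ((h (m * (2 * Real.pi / M)) / M : ℝ) : ℂ) * partialField w L (m * (2 * Real.pi / M)) ω := by
      rw [← mul_right_inj' hMc, ← h1, Finset.mul_sum]
      refine Finset.sum_congr rfl fun m _ => ?_
      push_cast
      field_simp
    rw [h2, riemannSum, Finset.sum_apply]
    push_cast
    rw [← Finset.sum_sub_distrib]
    refine Finset.sum_congr rfl fun m _ => by ring
  rw [e]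
  refine (eLpNorm_sum_le (fun m _ => ?_) (by norm_num)).trans ?_
  · exact (((Complex.measurable_ofReal.comp (hX.measurable_apply _)).aestronglyMeasurable).sub
      (hX.aestronglyMeasurable_partialField L _)).const_mul _
  · calc _ ≤ ∑ m ∈ Finset.range M, ENNReal.ofReal ((∑ n ∈ F, ‖c n‖) / M * Real.sqrt (tailSq C L)) := by
          refine Finset.sum_le_sum fun m _ => ?_
          have := eLpNorm_const_smul (μ := μ) (p := 2) ((h (m * (2 * Real.pi / M)) / M : ℝ) : ℂ)
            (fun ω => (X (m * (2 * Real.pi / M)) ω : ℂ) - partialField w L (m * (2 * Real.pi / M)) ω)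
          refine (le_of_eq this).trans ?_
          rw [ENNReal.ofReal_mul (by positivity)]
          gcongr
          · rw [← ofReal_norm, Complex.norm_real, Real.norm_eq_abs, abs_div, abs_of_pos hM0]
            gcongr
            exact hh.abs_le _
          · exact hX.eLpNorm_sub_partialField_le L _
      _ = _ := by
          rw [Finset.sum_const, Finset.card_range, nsmul_eq_mul, ← ENNReal.ofReal_natCast,
            ← ENNReal.ofReal_mul hM0.le]
          congr 1
          field_simp

theorem hasGaussianLaw_riemannSum (hB : IsGaussianProcess X μ) (h : ℝ → ℝ) (M : ℕ) :
    HasGaussianLaw (riemannSum X h M) μ := by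
  have h1 : IsGaussianProcess (fun (m : ℕ) ω =>
      (h (m * (2 * Real.pi / M)) / M) • X (m * (2 * Real.pi / M)) ω) μ :=
    (hB.comp_right fun m : ℕ => (m * (2 * Real.pi / M) : ℝ)).smul
      fun m : ℕ => h (m * (2 * Real.pi / M)) / M
  exact h1.hasGaussianLaw_fun_sum (I := Finset.range M)

theorem integral_cexp_of_hasGaussianLaw {Z : Ω → ℝ} (hZ : HasGaussianLaw Z μ)
    (h0 : ∫ ω, Z ω ∂μ = 0) :
    ∫ ω, Complex.exp (Complex.I * Z ω) ∂μ = Complex.exp (-((∫ ω, Z ω ^ 2 ∂μ : ℝ) : ℂ) / 2) := by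
  have h1 := congrArg (fun ν => charFun ν 1) hZ.map_eq_gaussianReal
  simp only [charFun_gaussianReal, h0] at h1
  rw [charFun_apply_real, integral_map hZ.aemeasurable (by fun_prop)] at h1
  rw [variance_of_integral_eq_zero hZ.aemeasurable h0] at h1
  have hn : 0 ≤ ∫ ω, Z ω ^ 2 ∂μ := by positivity
  simp only [Complex.ofReal_one, one_mul, Complex.ofReal_zero, zero_mul, mul_zero, zero_sub,
    one_pow, mul_one] at h1
  have e : ((((∫ ω, Z ω ^ 2 ∂μ).toNNReal : NNReal) : ℝ) : ℂ) = ((∫ ω, Z ω ^ 2 ∂μ : ℝ) : ℂ) := by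
    rw [Real.coe_toNNReal _ hn]
  rw [neg_div, ← e, ← h1]
  simp only [mul_comm Complex.I]

theorem norm_cexp_sub_le (x y : ℝ) :
    ‖Complex.exp (Complex.I * x) - Complex.exp (Complex.I * y)‖ ≤ |x - y| := by
  have e : Complex.exp (Complex.I * x) - Complex.exp (Complex.I * y) =
      Complex.exp (Complex.I * y) * (Complex.exp (Complex.I * ((x - y : ℝ) : ℂ)) - 1) := by
    rw [mul_sub, ← Complex.exp_add, mul_one]; congr 2; push_cast; ring
  rw [e, norm_mul, mul_comm Complex.I (y : ℂ), Complex.norm_exp_ofReal_mul_I, one_mul]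
  exact Real.norm_exp_I_mul_ofReal_sub_one_le

theorem abs_sqrt_integral_sub_le {f g : Ω → ℂ} (hf : MemLp f 2 μ) (hg : MemLp g 2 μ) {ε : ℝ}
    (hε : 0 ≤ ε) (h : eLpNorm (fun ω => f ω - g ω) 2 μ ≤ ENNReal.ofReal ε) :
    |Real.sqrt (∫ ω, ‖f ω‖ ^ 2 ∂μ) - Real.sqrt (∫ ω, ‖g ω‖ ^ 2 ∂μ)| ≤ ε := by
  have h1 : ∀ {f g : Ω → ℂ}, MemLp f 2 μ → MemLp g 2 μ →
      eLpNorm (fun ω => f ω - g ω) 2 μ ≤ ENNReal.ofReal ε →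
      Real.sqrt (∫ ω, ‖f ω‖ ^ 2 ∂μ) ≤ ε + Real.sqrt (∫ ω, ‖g ω‖ ^ 2 ∂μ) := by
    intro f g hf hg h
    rw [← ENNReal.ofReal_le_ofReal_iff (by positivity), ENNReal.ofReal_add hε (by positivity),
      ← eLpNorm_two_eq hf, ← eLpNorm_two_eq hg]
    have e : f = (fun ω => f ω - g ω) + g := by ext ω; simp
    nth_rewrite 1 [e]
    exact (eLpNorm_add_le (hf.sub hg).aestronglyMeasurable hg.aestronglyMeasurable
      (by norm_num)).trans (add_le_add h le_rfl)
  have h' : eLpNorm (fun ω => g ω - f ω) 2 μ ≤ ENNReal.ofReal ε := by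
    have := eLpNorm_sub_comm g f 2 μ
    exact (le_of_eq this).trans h
  rw [abs_le]
  constructor
  · linarith [h1 hg hf h']
  · linarith [h1 hf hg h]

/-- Linear functionals of the field are centred Gaussian. -/
theorem IsField.integral_cexp (hX : IsField μ X w C) (hB : IsGaussianProcess X μ)
    (hh : IsTrigPoly h F c) {Z : Ω → ℝ} (hZm : AEMeasurable Z μ)
    (hZ : ∀ᵐ ω ∂μ, (Z ω : ℂ) = ∑ n ∈ F, c n * w (-n) ω) :
    ∫ ω, Complex.exp (Complex.I * Z ω) ∂μ =
      Complex.exp (-((∑ n ∈ F, ‖c n‖ ^ 2 * C n : ℝ) : ℂ) / 2) := by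
  obtain ⟨L₀, hL₀⟩ := exists_subset_Icc F
  set R : ℕ → Ω → ℝ := fun L => riemannSum X h (2 * L + 1) with hR
  set ε : ℕ → ℝ := fun L => (∑ n ∈ F, ‖c n‖) * Real.sqrt (tailSq C L) with hε
  have hε0 : ∀ L, 0 ≤ ε L := fun L => by positivity
  have hεlim : Tendsto ε atTop (𝓝 0) := by
    have := ((Real.continuous_sqrt.tendsto 0).comp (tendsto_tailSq hX.summable)).const_mul
      (∑ n ∈ F, ‖c n‖)
    simpa using this
  have hW : MemLp (fun ω => ∑ n ∈ F, c n * w (-n) ω) 2 μ :=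
    memLp_finsetSum F fun n _ => (hX.memLp (-n)).const_mul (c n)
  have hZc : MemLp (fun ω => (Z ω : ℂ)) 2 μ := hW.ae_eq (hZ.mono fun ω hω => hω.symm)
  have hRc : ∀ L, MemLp (fun ω => (R L ω : ℂ)) 2 μ := fun L =>
    (hX.memLp_riemannSum h (2 * L + 1)).ofReal
  have hdist : ∀ L, L₀ ≤ L → eLpNorm (fun ω => (R L ω : ℂ) - Z ω) 2 μ ≤ ENNReal.ofReal (ε L) := by
    intro L hL
    refine le_trans (le_of_eq (eLpNorm_congr_ae ?_)) (hX.eLpNorm_riemannSum_sub_le hh (hL₀ L hL))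
    filter_upwards [hZ] with ω hω
    rw [hω]
  have hV : ∫ ω, ‖(Z ω : ℂ)‖ ^ 2 ∂μ = ∑ n ∈ F, ‖c n‖ ^ 2 * C n := by
    have h1 : ∫ ω, ‖(Z ω : ℂ)‖ ^ 2 ∂μ = ∫ ω, ‖∑ n ∈ F, c n * w (-n) ω‖ ^ 2 ∂μ := by
      refine integral_congr_ae ?_
      filter_upwards [hZ] with ω hω
      rw [hω]
    -- The combination pairs `c n` with `w (-n)`; reindexing by negation is undone by the symmetry
    -- of the spectrum.
    have h2 := hX.integral_norm_sum_sq (F.map (Equiv.neg ℤ).toEmbedding) (fun l => c (-l))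
    simp only [Finset.sum_map, Equiv.coe_toEmbedding, Equiv.neg_apply, neg_neg] at h2
    rw [h1, h2]
    exact Finset.sum_congr rfl fun n _ => by rw [hX.spectrum_neg]
  have hVlim : Tendsto (fun L => ∫ ω, R L ω ^ 2 ∂μ) atTop (𝓝 (∑ n ∈ F, ‖c n‖ ^ 2 * C n)) := by
    have h1 : Tendsto (fun L => Real.sqrt (∫ ω, ‖(R L ω : ℂ)‖ ^ 2 ∂μ)) atTop
        (𝓝 (Real.sqrt (∫ ω, ‖(Z ω : ℂ)‖ ^ 2 ∂μ))) := by
      rw [tendsto_iff_dist_tendsto_zero]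
      refine squeeze_zero' (Eventually.of_forall fun _ => dist_nonneg) ?_ hεlim
      filter_upwards [eventually_ge_atTop L₀] with L hL
      exact abs_sqrt_integral_sub_le (hRc L) hZc (hε0 L) (hdist L hL)
    have h2 := h1.pow 2
    rw [Real.sq_sqrt (by positivity), hV] at h2
    refine h2.congr fun L => ?_
    rw [Real.sq_sqrt (by positivity)]
    simp [Complex.norm_real]
  -- The characteristic values of the Riemann sums are computed in two ways: from their Gaussian law
  -- with converging variances, and from their mean-square convergence to `Z`.
  have hlim1 : Tendsto (fun L => ∫ ω, Complex.exp (Complex.I * R L ω) ∂μ) atTop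
      (𝓝 (Complex.exp (-((∑ n ∈ F, ‖c n‖ ^ 2 * C n : ℝ) : ℂ) / 2))) := by
    have e : ∀ L, ∫ ω, Complex.exp (Complex.I * R L ω) ∂μ =
        Complex.exp (-((∫ ω, R L ω ^ 2 ∂μ : ℝ) : ℂ) / 2) := fun L =>
      integral_cexp_of_hasGaussianLaw (hasGaussianLaw_riemannSum hB h _)
        (hX.integral_riemannSum h _)
    simp only [e]
    have hc : Continuous fun v : ℝ => Complex.exp (-(v : ℂ) / 2) := by fun_prop
    exact (hc.tendsto _).comp hVlim
  have hexp : ∀ {Y : Ω → ℝ}, AEMeasurable Y μ →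
      Integrable (fun ω => Complex.exp (Complex.I * Y ω)) μ := by
    intro Y hY
    refine Integrable.of_bound (C := 1) ?_ (Eventually.of_forall fun ω => ?_)
    · have hc : Measurable fun x : ℝ => Complex.exp (Complex.I * x) := by fun_prop
      exact (hc.comp_aemeasurable hY).aestronglyMeasurable
    · rw [mul_comm, Complex.norm_exp_ofReal_mul_I]
  have hlim2 : Tendsto (fun L => ∫ ω, Complex.exp (Complex.I * R L ω) ∂μ) atTop
      (𝓝 (∫ ω, Complex.exp (Complex.I * Z ω) ∂μ)) := by
    rw [tendsto_iff_norm_sub_tendsto_zero]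
    refine squeeze_zero' (Eventually.of_forall fun _ => norm_nonneg _) ?_ hεlim
    filter_upwards [eventually_ge_atTop L₀] with L hL
    have hRm := (hX.memLp_riemannSum h (2 * L + 1)).aestronglyMeasurable.aemeasurable
    rw [← integral_sub (hexp hRm) (hexp hZm)]
    refine (ENNReal.ofReal_le_ofReal_iff (hε0 L)).1 ?_
    rw [ofReal_norm]
    refine (enorm_integral_le_lintegral_enorm _).trans ?_
    calc _ ≤ ∫⁻ ω, ‖(R L ω : ℂ) - Z ω‖ₑ ∂μ := by
          refine lintegral_mono fun ω => ?_
          rw [← ofReal_norm, ← ofReal_norm]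
          refine ENNReal.ofReal_le_ofReal ((norm_cexp_sub_le _ _).trans (le_of_eq ?_))
          rw [← Complex.ofReal_sub, Complex.norm_real, Real.norm_eq_abs]
      _ = eLpNorm (fun ω => (R L ω : ℂ) - Z ω) 1 μ := eLpNorm_one_eq_lintegral_enorm.symm
      _ ≤ eLpNorm (fun ω => (R L ω : ℂ) - Z ω) 2 μ :=
          eLpNorm_le_eLpNorm_of_exponent_le (by norm_num) ((hRc L).sub hZc).aestronglyMeasurable
      _ ≤ _ := hdist L hL
  exact tendsto_nhds_unique hlim2 hlim1

end

/-! ### Gaussian representation of the coefficient vector -/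

section

/-! ### The law of the wavelet coefficients -/

section Law

variable {Ω : Type*} [MeasurableSpace Ω] {μ : Measure Ω} [IsProbabilityMeasure μ]
  {X : ℝ → Ω → ℝ} {w : ℤ → Ω → ℂ} {C : ℤ → ℝ} {a : ℝ → ℝ} {N : ℕ}

/-- The Fourier coefficients of the shifted needlet `θ ↦ ψ_N(θ - s)`. -/
def psiCoeff (a : ℝ → ℝ) (N : ℕ) (s : ℝ) (n : ℤ) : ℂ :=
  ((1 / Real.sqrt N * a (4 * n / N) : ℝ) : ℂ) * Complex.exp (Complex.I * n * ((-s : ℝ) : ℂ))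

theorem IsWindow.isTrigPoly_psi (ha : IsWindow a) (N : ℕ) (s : ℝ) :
    IsTrigPoly (fun θ => psi a N (θ - s)) (band N) (psiCoeff a N s) := by
  intro θ
  have h : ((psi a N (θ - s) : ℝ) : ℂ) = psiC a N (θ - s) :=
    Complex.conj_eq_iff_re.1 (ha.conj_psiC N _)
  rw [h, psiC, Finset.mul_sum]
  refine Finset.sum_congr rfl fun n _ => ?_
  have : Complex.I * n * ((θ - s : ℝ) : ℂ) = Complex.I * n * ((-s : ℝ) : ℂ) + Complex.I * n * θ := by
    push_cast; ring
  rw [psiCoeff, this, Complex.exp_add]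
  push_cast
  ring

theorem IsTrigPoly.sum {κ : Type*} (T : Finset κ) {h : κ → ℝ → ℝ} {F : Finset ℤ} {c : κ → ℤ → ℂ}
    (hh : ∀ k, IsTrigPoly (h k) F (c k)) (t : κ → ℝ) :
    IsTrigPoly (fun θ => ∑ k ∈ T, t k * h k θ) F (fun n => ∑ k ∈ T, t k * c k n) := by
  intro θ
  push_cast
  simp only [hh _ θ, Finset.mul_sum, Finset.sum_mul]
  rw [Finset.sum_comm]
  exact Finset.sum_congr rfl fun n _ => Finset.sum_congr rfl fun k _ => by ring

theorem IsField.measurable_beta (hX : IsField μ X w C) (ha : IsWindow a) (N k : ℕ) :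
    Measurable (beta X a N k) :=
  hX.measurable_integral (ha.isTrigPoly_psi N (k * (2 * Real.pi / N))).continuous

theorem neg_mem_band {l : ℤ} (hl : l ∈ band N) : -l ∈ band N := by
  simp only [band, Finset.mem_filter, Finset.mem_Icc, abs_neg] at hl ⊢
  exact ⟨⟨by omega, by omega⟩, hl.2⟩

theorem sum_band_neg {M : Type*} [AddCommMonoid M] (f : ℤ → M) :
    ∑ l ∈ band N, f (-l) = ∑ l ∈ band N, f l :=
  Finset.sum_bij' (fun l _ => -l) (fun l _ => -l) (fun _ hl => neg_mem_band hl)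
    (fun _ hl => neg_mem_band hl) (by simp) (by simp) (by simp)

theorem sum_band_eq_zero_of_odd {f : ℤ → ℝ} (hf : ∀ l, f (-l) = -f l) : ∑ l ∈ band N, f l = 0 := by
  have := sum_band_neg (N := N) f
  simp only [hf, Finset.sum_neg_distrib] at this
  linarith

theorem weight_neg (hX : IsField μ X w C) (ha : IsWindow a) (N : ℕ) (l : ℤ) :
    weight C a N (-l) = weight C a N l := by
  rw [weight, weight, hX.spectrum_neg, ← ha.even (4 * l / N)]
  congr 3; push_cast; ring

theorem weight_nonneg (hX : IsField μ X w C) (a : ℝ → ℝ) (N : ℕ) (l : ℤ) : 0 ≤ weight C a N l :=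
  mul_nonneg (hX.spectrum_nonneg l) (sq_nonneg _)

theorem sigmaSq_nonneg (hX : IsField μ X w C) (a : ℝ → ℝ) (N : ℕ) : 0 ≤ sigmaSq C a N :=
  mul_nonneg (by positivity) (Finset.sum_nonneg fun l _ => weight_nonneg hX a N l)

variable [NeZero N]

/-- The `x`-th sampling point. -/
def angle (N : ℕ) (x : ZMod N) : ℝ := (x.val + 1 : ℕ) * (2 * Real.pi / N)

/-- A matrix that represents the normalized wavelet coefficients as linear combinations of
independent standard Gaussian variables. -/
def hartley (C : ℤ → ℝ) (a : ℝ → ℝ) (N : ℕ) (x : ZMod N) (l : band N) : ℝ :=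
  Real.sqrt (weight C a N l / N) * (Real.cos (l * angle N x) + Real.sin (l * angle N x)) /
    Real.sqrt (sigmaSq C a N)

theorem norm_sum_psiCoeff_sq (N : ℕ) [NeZero N] (t : ZMod N → ℝ) (n : ℤ) :
    ‖∑ x, (t x : ℂ) * psiCoeff a N (angle N x) n‖ ^ 2 = a (4 * n / N) ^ 2 / N *
      ((∑ x, t x * Real.cos (n * angle N x)) ^ 2 + (∑ x, t x * Real.sin (n * angle N x)) ^ 2) := by
  have e : ∑ x, (t x : ℂ) * psiCoeff a N (angle N x) n =
      ((1 / Real.sqrt N * a (4 * n / N) : ℝ) : ℂ) *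
        (((∑ x, t x * Real.cos (n * angle N x) : ℝ) : ℂ) -
          ((∑ x, t x * Real.sin (n * angle N x) : ℝ) : ℂ) * Complex.I) := by
    push_cast
    rw [Finset.sum_mul, ← Finset.sum_sub_distrib, Finset.mul_sum]
    refine Finset.sum_congr rfl fun x _ => ?_
    have : Complex.I * n * ((-angle N x : ℝ) : ℂ) = (-(n * angle N x : ℂ)) * Complex.I := by
      push_cast; ring
    rw [psiCoeff, this, Complex.exp_mul_I, Complex.cos_neg, Complex.sin_neg]
    push_cast
    ring
  rw [e]
  generalize ∑ x, t x * Real.cos (n * angle N x) = u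
  generalize ∑ x, t x * Real.sin (n * angle N x) = v
  rw [norm_mul, mul_pow, Complex.norm_real, Real.norm_eq_abs, sq_abs, mul_pow, div_pow,
    Real.sq_sqrt (by positivity), ← Complex.normSq_eq_norm_sq]
  congr 1
  · ring
  · simp [Complex.normSq_apply]; ring

/-- Why `cos + sin` can replace the complex exponential: in the square of `c + s` the cross term is
odd in the frequency and cancels over the symmetric band, leaving `c^2 + s^2`. Both sides are the
variance of the same linear functional in the two models. -/
theorem sum_sq_hartley (hX : IsField μ X w C) (ha : IsWindow a) (N : ℕ) [NeZero N]
    (t : ZMod N → ℝ) : ∑ l, (∑ x, t x * hartley C a N x l) ^ 2 =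
      ∑ n ∈ band N, ‖∑ x, ((t x / Real.sqrt (sigmaSq C a N) : ℝ) : ℂ) *
        psiCoeff a N (angle N x) n‖ ^ 2 * C n := by
  set σ := Real.sqrt (sigmaSq C a N) with hσ
  set c : ℤ → ℝ := fun l => ∑ x, t x / σ * Real.cos (l * angle N x) with hc
  set s : ℤ → ℝ := fun l => ∑ x, t x / σ * Real.sin (l * angle N x) with hs
  have e1 : ∀ l : band N, (∑ x, t x * hartley C a N x l) ^ 2 =
      weight C a N l / N * (c l ^ 2 + s l ^ 2) + 2 * (weight C a N l / N * (c l * s l)) := by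
    intro l
    have : ∑ x, t x * hartley C a N x l = Real.sqrt (weight C a N l / N) * (c l + s l) := by
      simp only [hc, hs, ← Finset.sum_add_distrib, Finset.mul_sum]
      refine Finset.sum_congr rfl fun x _ => ?_
      rw [hartley]; ring
    rw [this, mul_pow, Real.sq_sqrt (div_nonneg (weight_nonneg hX a N l) (by positivity))]
    ring
  have hodd : ∑ l ∈ band N, weight C a N l / N * (c l * s l) = 0 := by
    refine sum_band_eq_zero_of_odd fun l => ?_
    have h1 : c (-l) = c l := Finset.sum_congr rfl fun x _ => by
      rw [Int.cast_neg, neg_mul, Real.cos_neg]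
    have h2 : s (-l) = -s l := by
      simp only [hs, ← Finset.sum_neg_distrib]
      exact Finset.sum_congr rfl fun x _ => by rw [Int.cast_neg, neg_mul, Real.sin_neg, mul_neg]
    rw [weight_neg hX ha, h1, h2]; ring
  simp only [e1]
  rw [Finset.sum_add_distrib, ← Finset.mul_sum,
    Finset.sum_coe_sort (band N) (fun l => weight C a N l / N * (c l * s l)),
    Finset.sum_coe_sort (band N) (fun l => weight C a N l / N * (c l ^ 2 + s l ^ 2)), hodd,
    mul_zero, add_zero]
  refine Finset.sum_congr rfl fun n _ => ?_
  rw [norm_sum_psiCoeff_sq, weight]; ring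

theorem integral_cexp_gaussPi {ι : Type*} [Fintype ι] (s : ι → ℝ) :
    ∫ g, Complex.exp (Complex.I * ((∑ l, s l * g l : ℝ) : ℂ)) ∂gaussPi ι =
      Complex.exp (-((∑ l, s l ^ 2 : ℝ) : ℂ) / 2) := by
  have e : ∀ g : ι → ℝ, Complex.exp (Complex.I * ((∑ l, s l * g l : ℝ) : ℂ)) =
      ∏ l, Complex.exp (s l * g l * Complex.I) := by
    intro g
    rw [← Complex.exp_sum]
    congr 1
    push_cast
    rw [Finset.mul_sum]
    exact Finset.sum_congr rfl fun l _ => by ring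
  simp only [e]
  rw [integral_fintype_prod_eq_prod (fun l (x : ℝ) => Complex.exp (s l * x * Complex.I))]
  simp only [← charFun_apply_real, charFun_gaussianReal, ← Complex.exp_sum]
  congr 1
  push_cast
  simp only [mul_zero, zero_mul, zero_sub, one_mul, ← neg_div, ← Finset.sum_div,
    Finset.sum_neg_distrib]

/-- The vector of normalized wavelet coefficients. -/
def betaVec (X : ℝ → Ω → ℝ) (C : ℤ → ℝ) (a : ℝ → ℝ) (N : ℕ) (ω : Ω) (x : ZMod N) : ℝ :=
  betaHat X C a N (x.val + 1) ω

theorem IsField.measurable_betaVec (hX : IsField μ X w C) (ha : IsWindow a) :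
    Measurable (betaVec X C a N) :=
  measurable_pi_lambda _ fun x => (hX.measurable_beta ha N (x.val + 1)).div_const _

/-- Equality of characteristic functions. A linear functional of the coefficients is the integral of
the field against one trigonometric polynomial, hence centred Gaussian, and the variances agree by
`sum_sq_hartley`. -/
theorem IsField.map_betaVec (hX : IsField μ X w C) (ha : IsWindow a) (hB : IsGaussianProcess X μ) :
    μ.map (betaVec X C a N) =
      (gaussPi (band N)).map (fun g x => ∑ l, hartley C a N x l * g l) := by
  have hm : Measurable (fun (g : band N → ℝ) (x : ZMod N) => ∑ l, hartley C a N x l * g l) := by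
    fun_prop
  have hp1 := Measure.isProbabilityMeasure_map (μ := μ)
    (hX.measurable_betaVec ha (N := N)).aemeasurable
  have hp2 := Measure.isProbabilityMeasure_map (μ := gaussPi (band N)) hm.aemeasurable
  refine Measure.ext_of_charFunDual ?_
  ext L
  set t : ZMod N → ℝ := fun x => L (Pi.single x 1) with ht
  have hL : ∀ v : ZMod N → ℝ, L v = ∑ x, t x * v x := by
    intro v
    have : v = ∑ x, v x • (Pi.single x (1 : ℝ) : ZMod N → ℝ) := by
      ext y
      rw [Finset.sum_apply, Finset.sum_eq_single y] <;> simp +contextual [eq_comm]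
    conv_lhs => rw [this]
    rw [map_sum]
    exact Finset.sum_congr rfl fun x _ => by rw [map_smul, smul_eq_mul, mul_comm]
  rw [charFunDual_apply, charFunDual_apply,
    integral_map (hX.measurable_betaVec ha).aemeasurable (by fun_prop),
    integral_map hm.aemeasurable (by fun_prop)]
  have hR : ∀ g : band N → ℝ, L (fun x => ∑ l, hartley C a N x l * g l) =
      ∑ l, (∑ x, t x * hartley C a N x l) * g l := by
    intro g
    rw [hL]
    simp only [Finset.mul_sum, Finset.sum_mul]
    rw [Finset.sum_comm]
    exact Finset.sum_congr rfl fun _ _ => Finset.sum_congr rfl fun _ _ => by ring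
  simp only [hR, mul_comm _ Complex.I]
  rw [integral_cexp_gaussPi, sum_sq_hartley hX ha N t]
  have htrig := IsTrigPoly.sum (Finset.univ : Finset (ZMod N))
    (fun x => ha.isTrigPoly_psi N (angle N x)) (fun x => t x / Real.sqrt (sigmaSq C a N))
  refine hX.integral_cexp hB htrig (Z := fun ω => L (betaVec X C a N ω))
    (L.continuous.measurable.comp (hX.measurable_betaVec ha)).aemeasurable ?_
  have hae : ∀ᵐ ω ∂μ, ∀ x : ZMod N, (beta X a N (x.val + 1) ω : ℂ) =
      ∑ n ∈ band N, psiCoeff a N (angle N x) n * w (-n) ω :=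
    ae_all_iff.2 fun x => hX.integral_mul_trigPoly (ha.isTrigPoly_psi N (angle N x))
  filter_upwards [hae] with ω hω
  rw [hL]
  simp only [betaVec, betaHat]
  push_cast
  simp only [hω, Finset.mul_sum, Finset.sum_mul, Finset.sum_div]
  rw [Finset.sum_comm]
  exact Finset.sum_congr rfl fun _ _ => Finset.sum_congr rfl fun _ _ => by ring

end Law

end

/-! ### Circulant covariance, Fejér identities, reduction to polynomials -/

section

/-! ### Covariance structure of the wavelet coefficients -/

section Covariance

variable {Ω : Type*} [MeasurableSpace Ω] {μ : Measure Ω} [IsProbabilityMeasure μ]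
  {X : ℝ → Ω → ℝ} {w : ℤ → Ω → ℂ} {C : ℤ → ℝ} {a : ℝ → ℝ} {N : ℕ} [NeZero N]

theorem sum_range_eq_sum_zmod {M : Type*} [AddCommMonoid M] (f : ℕ → M) :
    ∑ n ∈ Finset.range N, f n = ∑ x : ZMod N, f x.val :=
  (Finset.sum_bij' (fun (x : ZMod N) _ => x.val) (fun n _ => (Nat.cast n : ZMod N))
    (fun x _ => Finset.mem_range.2 x.val_lt) (fun _ _ => Finset.mem_univ _)
    (fun x _ => ZMod.natCast_zmod_val x)
    (fun _ hk => ZMod.val_cast_of_lt (Finset.mem_range.1 hk)) (fun _ _ => rfl)).symm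

theorem sum_Icc_eq_sum_zmod {M : Type*} [AddCommMonoid M] (f : ℕ → M) :
    ∑ k ∈ Finset.Icc 1 N, f k = ∑ x : ZMod N, f (x.val + 1) := by
  rw [← sum_range_eq_sum_zmod fun k => f (k + 1), Finset.range_eq_Ico,
    Finset.sum_Ico_add' f 0 N 1]
  rfl

theorem stdAddChar_mul_add_one (n : ℤ) (x : ZMod N) :
    (ZMod.stdAddChar ((n : ZMod N) * (x + 1)) : ℂ) =
      Complex.exp (((n * angle N x : ℝ) : ℂ) * Complex.I) := by
  have : (n : ZMod N) * (x + 1) = ((n * (x.val + 1 : ℕ) : ℤ) : ZMod N) := by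
    push_cast
    rw [ZMod.natCast_zmod_val]
  rw [this, ZMod.stdAddChar_coe]
  congr 1
  simp only [angle]
  push_cast
  ring

theorem stdAddChar_mul_sub (n : ℤ) (x y : ZMod N) :
    (ZMod.stdAddChar ((n : ZMod N) * (x - y)) : ℂ) =
      Complex.exp (((n * (angle N x - angle N y) : ℝ) : ℂ) * Complex.I) := by
  have : (n : ZMod N) * (x - y) = n * (x + 1) + ((-n : ℤ) : ZMod N) * (y + 1) := by
    push_cast; ring
  rw [this, AddChar.map_add_eq_mul, stdAddChar_mul_add_one, stdAddChar_mul_add_one,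
    ← Complex.exp_add]
  congr 1
  push_cast
  ring

/-- The share of the frequency `l` in the variance of a wavelet coefficient. -/
def share (C : ℤ → ℝ) (a : ℝ → ℝ) (N : ℕ) (l : ℤ) : ℝ := weight C a N l / N / sigmaSq C a N

theorem share_nonneg (hX : IsField μ X w C) (a : ℝ → ℝ) (N : ℕ) (l : ℤ) : 0 ≤ share C a N l :=
  div_nonneg (div_nonneg (weight_nonneg hX a N l) (by positivity)) (sigmaSq_nonneg hX a N)

theorem share_neg (hX : IsField μ X w C) (ha : IsWindow a) (N : ℕ) (l : ℤ) :
    share C a N (-l) = share C a N l := by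
  rw [share, share, weight_neg hX ha]

theorem sum_share (h : 0 < sigmaSq C a N) : ∑ l ∈ band N, share C a N l = 1 := by
  simp only [share, ← Finset.sum_div]
  rw [div_eq_one_iff_eq h.ne', sigmaSq]
  ring

/-- The product of two `cos + sin` kernels is the cosine of the difference plus the sine of the sum.
The latter is odd in `l` and cancels, so the covariance is stationary. -/
theorem cov_hartley (hX : IsField μ X w C) (ha : IsWindow a) (x y : ZMod N) :
    (cov (hartley C a N) x y : ℂ) =
      ∑ l ∈ band N, (share C a N l : ℂ) * ZMod.stdAddChar ((l : ZMod N) * (x - y)) := by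
  have e1 : cov (hartley C a N) x y =
      ∑ l ∈ band N, share C a N l * Real.cos (l * (angle N x - angle N y)) +
        ∑ l ∈ band N, share C a N l * Real.sin (l * (angle N x + angle N y)) := by
    rw [cov, ← Finset.sum_add_distrib, ← Finset.sum_coe_sort (band N)]
    refine Finset.sum_congr rfl fun l _ => ?_
    rw [mul_sub, mul_add, Real.cos_sub, Real.sin_add]
    have h1 := Real.mul_self_sqrt (div_nonneg (weight_nonneg hX a N l) (Nat.cast_nonneg (α := ℝ) N))
    have h2 := Real.mul_self_sqrt (sigmaSq_nonneg hX a N)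
    have h3 : share C a N l = (Real.sqrt (weight C a N l / N) / Real.sqrt (sigmaSq C a N)) ^ 2 := by
      rw [div_pow, sq, sq, h1, h2, share]
    rw [h3]
    simp only [hartley]
    ring
  have e2 : ∑ l ∈ band N, share C a N l * Real.sin (l * (angle N x + angle N y)) = 0 :=
    sum_band_eq_zero_of_odd fun l => by
      rw [share_neg hX ha, Int.cast_neg, neg_mul, Real.sin_neg, mul_neg]
  have e3 : ∑ l ∈ band N, share C a N l * Real.sin (l * (angle N x - angle N y)) = 0 :=
    sum_band_eq_zero_of_odd fun l => by
      rw [share_neg hX ha, Int.cast_neg, neg_mul, Real.sin_neg, mul_neg]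
  have e4 : ∑ l ∈ band N, (share C a N l : ℂ) * ZMod.stdAddChar ((l : ZMod N) * (x - y)) =
      ((∑ l ∈ band N, share C a N l * Real.cos (l * (angle N x - angle N y)) : ℝ) : ℂ) +
      ((∑ l ∈ band N, share C a N l * Real.sin (l * (angle N x - angle N y)) : ℝ) : ℂ) *
        Complex.I := by
    push_cast
    rw [Finset.sum_mul, ← Finset.sum_add_distrib]
    refine Finset.sum_congr rfl fun l _ => ?_
    rw [stdAddChar_mul_sub, Complex.exp_mul_I]
    push_cast
    ring
  rw [e4, e3, e1, e2]
  simp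

/-- The distribution of `share` on residue classes. -/
def residueShare (C : ℤ → ℝ) (a : ℝ → ℝ) (N : ℕ) (z : ZMod N) : ℝ :=
  ∑ l ∈ (band N).filter (fun l : ℤ => (l : ZMod N) = z), share C a N l

theorem isSpectrum_residueShare (hX : IsField μ X w C) (ha : IsWindow a) :
    IsSpectrum (residueShare C a N) (fun m => cov (hartley C a N) m 0) := by
  intro m
  rw [cov_hartley hX ha, sub_zero,
    ← Finset.sum_fiberwise_of_maps_to (s := band N) (t := Finset.univ)
      (g := fun l : ℤ => (l : ZMod N)) (fun _ _ => Finset.mem_univ _)]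
  refine Finset.sum_congr rfl fun z _ => ?_
  rw [residueShare, Complex.ofReal_sum, Finset.sum_mul]
  refine Finset.sum_congr rfl fun l hl => ?_
  rw [(Finset.mem_filter.1 hl).2]

theorem cov_hartley_eq_sub (hX : IsField μ X w C) (ha : IsWindow a) (x y : ZMod N) :
    cov (hartley C a N) x y = cov (hartley C a N) (x - y) 0 := by
  have : (cov (hartley C a N) x y : ℂ) = cov (hartley C a N) (x - y) 0 := by
    rw [cov_hartley hX ha, cov_hartley hX ha, sub_zero]
  exact_mod_cast this

theorem isWeight_residueShare (hX : IsField μ X w C) (h : 0 < sigmaSq C a N) :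
    IsWeight (residueShare C a N) where
  nonneg z := Finset.sum_nonneg fun l _ => share_nonneg hX a N l
  sum_eq_one := by
    rw [← sum_share h]
    exact Finset.sum_fiberwise_of_maps_to (g := fun l : ℤ => (l : ZMod N))
      (fun _ _ => Finset.mem_univ _) _

/-- Since `|l| ≤ N/2` on the band, two distinct frequencies can agree mod `N` only if they are
`±N/2`. -/
theorem residueShare_le {B : ℝ} (hB0 : 0 ≤ B) (hB : ∀ l ∈ band N, share C a N l ≤ B) (z : ZMod N) :
    residueShare C a N z ≤ 2 * B := by
  have hsub : (band N).filter (fun l : ℤ => (l : ZMod N) = z) ⊆ {z.valMinAbs, -z.valMinAbs} := by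
    intro l hl
    rw [Finset.mem_filter] at hl
    obtain ⟨hl, rfl⟩ := hl
    have h2 : 2 * |l| ≤ N := (Finset.mem_filter.1 hl).2.2
    have h3 := neg_abs_le l
    have h4 := le_abs_self l
    have hN := Nat.pos_of_ne_zero (NeZero.ne N)
    rw [Finset.mem_insert, Finset.mem_singleton]
    -- `valMinAbs` takes values in `(-N/2, N/2]`, so the endpoint `-N/2` is represented by its
    -- negative.
    rcases eq_or_ne (l * 2) (-N) with h | h
    · right
      rw [eq_comm, neg_eq_iff_eq_neg, ZMod.valMinAbs_spec]
      refine ⟨?_, by constructor <;> omega⟩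
      have : ((l * 2 + N : ℤ) : ZMod N) = 0 := by rw [h]; simp
      push_cast at this ⊢
      rw [ZMod.natCast_self, add_zero, mul_two] at this
      exact eq_neg_of_add_eq_zero_left this
    · left
      rw [eq_comm, ZMod.valMinAbs_spec]
      exact ⟨rfl, by constructor <;> omega⟩
  have hcard := (Finset.card_le_card hsub).trans Finset.card_le_two
  calc residueShare C a N z
      ≤ ((band N).filter (fun l : ℤ => (l : ZMod N) = z)).card • B :=
        Finset.sum_le_card_nsmul _ _ _ fun l hl => hB l (Finset.mem_filter.1 hl).1
    _ ≤ 2 * B := by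
        rw [nsmul_eq_mul]
        exact mul_le_mul_of_nonneg_right (by exact_mod_cast hcard) hB0

/-- Residue shares are at most `B = 2c/N`, so the spectral bounds become `N^4 B^3 = N (2c)^3` for
cycles and `N^2 B / N = 2c` for double sums. -/
theorem isRegularCov_hartley (hX : IsField μ X w C) (ha : IsWindow a) (h : 0 < sigmaSq C a N)
    {c : ℝ} (hc : 0 ≤ c) (hle : ∀ l ∈ band N, share C a N l ≤ c / N) :
    IsRegularCov (hartley C a N) (max (2 * c) ((2 * c) ^ 3)) := by
  have hN : (0 : ℝ) < N := by exact_mod_cast Nat.pos_of_ne_zero (NeZero.ne N)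
  have hs := isSpectrum_residueShare (N := N) hX ha
  have hw := isWeight_residueShare hX h
  have hb := residueShare_le (by positivity) hle
  refine ⟨Fintype.card_pos, le_max_of_le_left (by positivity), fun x => ?_, ?_, fun b hb2 => ?_⟩
  · have : (cov (hartley C a N) x x : ℂ) = 1 := by
      rw [cov_hartley hX ha, sub_self]
      simp only [mul_zero, AddChar.map_zero_eq_one, mul_one]
      exact_mod_cast sum_share h
    exact_mod_cast this
  · intro s j j' h1 h2
    rw [ZMod.card]
    have := hs.cycle_le hw hb h1 h2
    simp only [← cov_hartley_eq_sub hX ha] at this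
    refine this.trans ?_
    calc (N : ℝ) ^ 4 * (2 * (c / N)) ^ 3 = N * (2 * c) ^ 3 := by field_simp
      _ ≤ _ := by gcongr; exact le_max_right _ _
  · rw [ZMod.card]
    have := hs.sum_sum_pow_le hw hb (n := b) (by omega)
    simp only [← cov_hartley_eq_sub hX ha] at this
    calc 1 / (N : ℝ) * ∑ x, ∑ y, cov (hartley C a N) x y ^ b
        ≤ 1 / (N : ℝ) * ((N : ℝ) ^ 2 * (2 * (c / N))) := by gcongr
      _ = 2 * c := by field_simp
      _ ≤ _ := le_max_left _ _

theorem fejer_eq (n : ℤ) : (fejer N (n * (2 * Real.pi / N)) : ℂ) =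
    1 / (2 * Real.pi * N) * ∑ x : ZMod N, ∑ y : ZMod N, ZMod.stdAddChar ((n : ZMod N) * (x - y)) := by
  have e : ∑ k ∈ Finset.Icc 1 N,
      Complex.exp (Complex.I * ((n * (2 * Real.pi / N) : ℝ) : ℂ) * k) =
        ∑ x : ZMod N, ZMod.stdAddChar ((n : ZMod N) * (x + 1)) := by
    rw [sum_Icc_eq_sum_zmod]
    refine Finset.sum_congr rfl fun x _ => ?_
    rw [stdAddChar_mul_add_one]
    congr 1
    simp only [angle]
    push_cast
    ring
  rw [fejer, e]
  push_cast
  rw [← Complex.mul_conj', map_sum, Finset.sum_mul_sum]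
  congr 1
  refine Finset.sum_congr rfl fun x _ => Finset.sum_congr rfl fun y _ => ?_
  rw [conj_stdAddChar, ← AddChar.map_add_eq_mul]
  congr 1
  ring

theorem fejer_nonneg (N : ℕ) (t : ℝ) : 0 ≤ fejer N t := by
  unfold fejer
  positivity

theorem fejer_zero : fejer N 0 = N / (2 * Real.pi) := by
  have hN : (N : ℝ) ≠ 0 := by exact_mod_cast NeZero.ne N
  simp [fejer]
  field_simp

/-- Summing a function on `ℤ/N × ℤ/N` that depends on the difference only, in terms of Fejér's
kernel. -/
theorem sum_sum_eq_fejer {κ : Type*} (T : Finset κ) (c : κ → ℝ) (n : κ → ℤ)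
    {f : ZMod N → ZMod N → ℝ}
    (hf : ∀ x y, (f x y : ℂ) = ∑ t ∈ T, (c t : ℂ) * ZMod.stdAddChar ((n t : ZMod N) * (x - y))) :
    ∑ x, ∑ y, f x y = 2 * Real.pi * N * ∑ t ∈ T, c t * fejer N (n t * (2 * Real.pi / N)) := by
  have hN : (N : ℂ) ≠ 0 := by exact_mod_cast NeZero.ne N
  have hpi : (Real.pi : ℂ) ≠ 0 := by exact_mod_cast Real.pi_ne_zero
  have h1 : ∀ t, 2 * Real.pi * N * (fejer N (n t * (2 * Real.pi / N)) : ℂ) =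
      ∑ x : ZMod N, ∑ y : ZMod N, ZMod.stdAddChar ((n t : ZMod N) * (x - y)) := by
    intro t
    rw [fejer_eq, ← mul_assoc, mul_one_div_cancel, one_mul]
    simp [hN, hpi]
  have : ((∑ x, ∑ y, f x y : ℝ) : ℂ) =
      ((2 * Real.pi * N * ∑ t ∈ T, c t * fejer N (n t * (2 * Real.pi / N)) : ℝ) : ℂ) := by
    calc ((∑ x, ∑ y, f x y : ℝ) : ℂ)
        = ∑ x, ∑ y, ∑ t ∈ T, (c t : ℂ) * ZMod.stdAddChar ((n t : ZMod N) * (x - y)) := by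
          simp only [Complex.ofReal_sum, hf]
      _ = ∑ t ∈ T, ∑ x, ∑ y, (c t : ℂ) * ZMod.stdAddChar ((n t : ZMod N) * (x - y)) := by
          rw [Finset.sum_comm]
          simp only [Finset.sum_comm (s := T)]
          rw [Finset.sum_comm]
      _ = ∑ t ∈ T, (c t : ℂ) * (2 * Real.pi * N * (fejer N (n t * (2 * Real.pi / N)) : ℂ)) := by
          simp only [h1, Finset.mul_sum]
      _ = _ := by
          push_cast
          rw [Finset.mul_sum]
          exact Finset.sum_congr rfl fun t _ => by ring
  exact_mod_cast this

theorem mul_eq_sum_product {κ κ' : Type*} {T : Finset κ} {T' : Finset κ'} {c : κ → ℝ} {c' : κ' → ℝ}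
    {n : κ → ℤ} {n' : κ' → ℤ} {u v : ℝ} {m : ZMod N}
    (hu : (u : ℂ) = ∑ t ∈ T, (c t : ℂ) * ZMod.stdAddChar ((n t : ZMod N) * m))
    (hv : (v : ℂ) = ∑ t ∈ T', (c' t : ℂ) * ZMod.stdAddChar ((n' t : ZMod N) * m)) :
    ((u * v : ℝ) : ℂ) = ∑ t ∈ T ×ˢ T', ((c t.1 * c' t.2 : ℝ) : ℂ) *
      ZMod.stdAddChar (((n t.1 + n' t.2 : ℤ) : ZMod N) * m) := by
  rw [Complex.ofReal_mul, hu, hv, Finset.sum_mul_sum, Finset.sum_product]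
  refine Finset.sum_congr rfl fun t _ => Finset.sum_congr rfl fun t' _ => ?_
  rw [Int.cast_add, add_mul, AddChar.map_add_eq_mul]
  push_cast
  ring

/-- The cube of the covariance expands over triples of frequencies, and the double sum of each
character is `2πN` times Fejér's kernel; hence `12π = (6/N) · 2πN`. If `σ_N = 0`, both sides are
zero. -/
theorem skewVar_hartley (hX : IsField μ X w C) (ha : IsWindow a) :
    skewVar (hartley C a N) = sigmaSSq C a N := by
  have hN : (N : ℝ) ≠ 0 := by exact_mod_cast NeZero.ne N
  have h1 := cov_hartley (N := N) hX ha
  have h3 := fun x y => mul_eq_sum_product (h1 x y) (mul_eq_sum_product (h1 x y) (h1 x y))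
  simp only [skewVar, pow_succ, pow_zero, one_mul, mul_assoc]
  rw [sum_sum_eq_fejer _ _ _ h3, sigmaSSq]
  simp only [Finset.sum_product, Finset.mul_sum, ZMod.card]
  refine Finset.sum_congr rfl fun l₁ _ => Finset.sum_congr rfl fun l₂ _ =>
    Finset.sum_congr rfl fun l₃ _ => ?_
  simp only [share]
  push_cast
  rw [← add_assoc]
  generalize fejer N _ = F
  rcases eq_or_ne (sigmaSq C a N) 0 with h | h
  · simp [h]
  · field_simp
    ring

theorem kurtVar_hartley (hX : IsField μ X w C) (ha : IsWindow a) :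
    kurtVar (hartley C a N) = sigmaU1Sq C a N + sigmaU2Sq C a N := by
  have hN : (N : ℝ) ≠ 0 := by exact_mod_cast NeZero.ne N
  have h1 := cov_hartley (N := N) hX ha
  have h2 := fun x y => mul_eq_sum_product (h1 x y) (h1 x y)
  have h4 := fun x y => mul_eq_sum_product (h1 x y) (mul_eq_sum_product (h1 x y) (h2 x y))
  simp only [kurtVar, pow_succ, pow_zero, one_mul, mul_assoc]
  rw [sum_sum_eq_fejer _ _ _ h2, sum_sum_eq_fejer _ _ _ h4, sigmaU1Sq, sigmaU2Sq]
  simp only [Finset.sum_product, Finset.mul_sum, ZMod.card]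
  congr 1
  · refine Finset.sum_congr rfl fun l₁ _ => Finset.sum_congr rfl fun l₂ _ => ?_
    simp only [share]
    push_cast
    generalize fejer N _ = F
    rcases eq_or_ne (sigmaSq C a N) 0 with h | h
    · simp [h]
    · field_simp
  · refine Finset.sum_congr rfl fun l₁ _ => Finset.sum_congr rfl fun l₂ _ =>
      Finset.sum_congr rfl fun l₃ _ => Finset.sum_congr rfl fun l₄ _ => ?_
    simp only [share]
    push_cast
    rw [← add_assoc, ← add_assoc]
    generalize fejer N _ = F
    rcases eq_or_ne (sigmaSq C a N) 0 with h | h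
    · simp [h]
    · field_simp

theorem intCast_ne_zero_of_mem_band {l : ℤ} (hl : l ∈ band N) : (l : ZMod N) ≠ 0 := by
  have hN := Nat.pos_of_ne_zero (NeZero.ne N)
  have h := (Finset.mem_filter.1 hl).2
  rw [Ne, ZMod.intCast_zmod_eq_zero_iff_dvd]
  intro hd
  have := Int.le_of_dvd (by omega) ((dvd_abs _ _).2 hd)
  omega

/-- No frequency of the band is a multiple of `N`. It follows that the `H_1` part of `b^3 = H_3(b) +
3 H_1(b)` drops out of the skewness identically. -/
theorem sum_hartley (C : ℤ → ℝ) (a : ℝ → ℝ) (l : band N) : ∑ x, hartley C a N x l = 0 := by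
  have h : ∑ x : ZMod N, Complex.exp (((l * angle N x : ℝ) : ℂ) * Complex.I) = 0 := by
    simp only [← stdAddChar_mul_add_one]
    have := Fintype.sum_equiv (Equiv.addRight (1 : ZMod N))
      (fun x => (ZMod.stdAddChar (((l : ℤ) : ZMod N) * (x + 1)) : ℂ))
      (fun x => (ZMod.stdAddChar (((l : ℤ) : ZMod N) * x) : ℂ)) (fun x => by rw [Equiv.coe_addRight])
    have h0 : ((l : ℤ) : ZMod N) ≠ 0 := intCast_ne_zero_of_mem_band l.property
    exact this.trans ((sum_stdAddChar_mul _).trans (if_neg h0))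
  have hre := congrArg Complex.re h
  have him := congrArg Complex.im h
  simp only [Complex.re_sum, Complex.im_sum, Complex.exp_ofReal_mul_I_re,
    Complex.exp_ofReal_mul_I_im, Complex.zero_re, Complex.zero_im] at hre him
  simp only [hartley, ← Finset.sum_div, ← Finset.mul_sum, Finset.sum_add_distrib, hre, him]
  simp

open MvPolynomial in
theorem eval_lin {ι K : Type} [Fintype ι] (A : K → ι → ℝ) (k : K) (g : ι → ℝ) :
    eval g (lin A k) = ∑ i, A k i * g i := by
  simp [lin]

open MvPolynomial in
theorem eval_hermSum {ι K : Type} [Fintype ι] [DecidableEq ι] [Fintype K] (A : K → ι → ℝ) (q : ℕ)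
    (g : ι → ℝ) : eval g (hermSum A q) =
      1 / Real.sqrt (Fintype.card K) * ∑ k, herm (∑ i, A k i * g i) q := by
  simp only [hermSum, singlePoly, map_sum, map_mul, eval_C, hermLin, map_herm, eval_lin,
    Finset.mul_sum]

theorem sum_sum_hartley_mul (C : ℤ → ℝ) (a : ℝ → ℝ) (g : band N → ℝ) :
    ∑ x, ∑ l, hartley C a N x l * g l = 0 := by
  rw [Finset.sum_comm]
  simp only [← Finset.sum_mul, sum_hartley, zero_mul, Finset.sum_const_zero]

theorem eval_skewPoly_hartley (C : ℤ → ℝ) (a : ℝ → ℝ) (g : band N → ℝ) :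
    MvPolynomial.eval g (skewPoly (hartley C a N)) =
      1 / Real.sqrt N * ∑ x, (∑ l, hartley C a N x l * g l) ^ 3 := by
  rw [skewPoly, eval_hermSum, ZMod.card]
  have h : ∀ b : ℝ, herm b 3 = b ^ 3 - 3 * b := fun b => by simp only [herm]; push_cast; ring
  simp only [h, Finset.sum_sub_distrib, ← Finset.mul_sum, sum_sum_hartley_mul]
  ring

theorem eval_kurtPoly_hartley (C : ℤ → ℝ) (a : ℝ → ℝ) (g : band N → ℝ) :
    MvPolynomial.eval g (kurtPoly (hartley C a N)) =
      1 / Real.sqrt N * ∑ x, ((∑ l, hartley C a N x l * g l) ^ 4 - 3) := by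
  rw [kurtPoly, map_add, map_mul, MvPolynomial.eval_C, eval_hermSum, eval_hermSum, ZMod.card,
    mul_left_comm, ← mul_add, Finset.mul_sum, ← Finset.sum_add_distrib]
  congr 1
  refine Finset.sum_congr rfl fun x _ => ?_
  simp only [herm]
  push_cast
  ring

/-- The joint law of the skewness and the kurtosis. -/
theorem IsField.integral_skewness_kurtosis (hX : IsField μ X w C) (ha : IsWindow a)
    (hB : IsGaussianProcess X μ) (p q : ℕ) :
    Integrable (fun ω => normSkewness X C a N ω ^ p * normKurtosis X C a N ω ^ q) μ ∧
    ∫ ω, normSkewness X C a N ω ^ p * normKurtosis X C a N ω ^ q ∂μ =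
      gaussE (skewPoly (hartley C a N) ^ p * kurtPoly (hartley C a N) ^ q) /
        (sigmaS C a N ^ p * sigmaU C a N ^ q) := by
  -- A continuous function of the coefficient vector, so equality in law transports both
  -- integrability and the integral.
  set F : (ZMod N → ℝ) → ℝ := fun v => (1 / Real.sqrt N * ∑ x, v x ^ 3) ^ p *
    (1 / Real.sqrt N * ∑ x, (v x ^ 4 - 3)) ^ q / (sigmaS C a N ^ p * sigmaU C a N ^ q) with hF
  have hFm : Continuous F := by fun_prop
  have hbm := hX.measurable_betaVec ha (N := N)
  have hm : Measurable (fun (g : band N → ℝ) (x : ZMod N) => ∑ l, hartley C a N x l * g l) := by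
    fun_prop
  have e1 : (fun ω => normSkewness X C a N ω ^ p * normKurtosis X C a N ω ^ q) =
      F ∘ betaVec X C a N := by
    ext ω
    simp only [hF, Function.comp, normSkewness, normKurtosis, skewness, kurtosis, betaVec,
      sum_Icc_eq_sum_zmod, div_pow]
    ring
  have e2 : F ∘ (fun (g : band N → ℝ) (x : ZMod N) => ∑ l, hartley C a N x l * g l) =
      fun g => MvPolynomial.eval g (skewPoly (hartley C a N) ^ p * kurtPoly (hartley C a N) ^ q) /
        (sigmaS C a N ^ p * sigmaU C a N ^ q) := by
    ext g
    simp only [hF, Function.comp, map_mul, map_pow, eval_skewPoly_hartley, eval_kurtPoly_hartley]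
  rw [e1]
  constructor
  · rw [← integrable_map_measure hFm.aestronglyMeasurable hbm.aemeasurable, hX.map_betaVec ha hB,
      integrable_map_measure hFm.aestronglyMeasurable hm.aemeasurable, e2]
    exact (integrable_eval _).div_const _
  · change ∫ ω, F (betaVec X C a N ω) ∂μ = _
    rw [← integral_map hbm.aemeasurable hFm.aestronglyMeasurable, hX.map_betaVec ha hB,
      integral_map hm.aemeasurable hFm.aestronglyMeasurable, gaussE_apply, ← integral_div]
    exact congrArg (fun f => ∫ g, f g ∂gaussPi (band N)) e2

end Covariance

end

/-! ### Size of the shares and lower bounds for the variances -/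

section

/-! ### Lower and upper bounds as the resolution increases -/

section Asymptotics

variable {Ω : Type*} [MeasurableSpace Ω] {μ : Measure Ω} [IsProbabilityMeasure μ]
  {X : ℝ → Ω → ℝ} {w : ℤ → Ω → ℂ} {C : ℤ → ℝ} {a : ℝ → ℝ}

theorem IsWindow.sq_le_one (ha : IsWindow a) (ξ : ℝ) : a ξ ^ 2 ≤ 1 := by
  obtain ⟨φ, -, h01, -, -, h⟩ := ha.littlewoodPaley
  rw [h]
  linarith [(h01 (ξ / 2)).2, (h01 ξ).1]

/-- Choose `u` with `φ u = 1/2`; then `1/2 < u ≤ 1`. Hence `φ (u/2) = 1` and `φ (2u) = 0`, and `a^2`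
equals `1/2` at both `u` and `2u`. Such a pair supplies the triples `u + u - 2u = 0` needed for the
skewness. -/
theorem IsWindow.exists_point (ha : IsWindow a) : ∃ u δ : ℝ, 0 < δ ∧
    (∀ ξ, |ξ - u| ≤ δ → 1 / 4 ≤ a ξ ^ 2) ∧ ∀ ξ, |ξ - 2 * u| ≤ 2 * δ → 1 / 4 ≤ a ξ ^ 2 := by
  obtain ⟨φ, hφ, h01, h1, h0, h⟩ := ha.littlewoodPaley
  have hφ1 : φ (1 / 2) = 1 := h1 _ (by norm_num)
  have hφ2 : φ 2 = 0 := h0 _ (by norm_num)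
  obtain ⟨u, hu, hu2⟩ : (1 / 2 : ℝ) ∈ φ '' Set.Icc (1 / 2) 2 :=
    intermediate_value_Icc' (by norm_num) hφ.continuous.continuousOn
      ⟨by rw [hφ2]; norm_num, by rw [hφ1]; norm_num⟩
  have hu1 : u ≤ 1 := by
    by_contra! hc
    rw [h0 u (by rwa [abs_of_pos (by linarith)])] at hu2
    norm_num at hu2
  have hu0 : 1 / 2 < u := lt_of_le_of_ne hu.1 (by rintro rfl; rw [hφ1] at hu2; norm_num at hu2)
  have e1 : a u ^ 2 = 1 / 2 := by
    rw [h, hu2, h1 _ (by rw [abs_of_pos] <;> linarith)]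
    norm_num
  have e2 : a (2 * u) ^ 2 = 1 / 2 := by
    rw [h, mul_div_cancel_left₀ _ two_ne_zero, hu2, h0 _ (by rw [abs_of_pos] <;> linarith)]
    norm_num
  have hcont : Continuous fun ξ => a ξ ^ 2 := ha.smooth.continuous.pow 2
  have key : ∀ v, a v ^ 2 = 1 / 2 → ∃ ε > 0, ∀ ξ, |ξ - v| < ε → 1 / 4 ≤ a ξ ^ 2 := by
    intro v hv
    obtain ⟨ε, hε, hε'⟩ := Metric.continuous_iff.1 hcont v (1 / 4) (by norm_num)
    refine ⟨ε, hε, fun ξ hξ => ?_⟩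
    have := hε' ξ (by rwa [Real.dist_eq])
    rw [Real.dist_eq, hv, abs_lt] at this
    linarith [this.1]
  obtain ⟨ε₁, hε₁, h₁⟩ := key u e1
  obtain ⟨ε₂, hε₂, h₂⟩ := key (2 * u) e2
  have hm : 0 < min ε₁ ε₂ := lt_min hε₁ hε₂
  refine ⟨u, min ε₁ ε₂ / 4, by positivity, fun ξ hξ => h₁ ξ ?_, fun ξ hξ => h₂ ξ ?_⟩
  · have := min_le_left ε₁ ε₂
    linarith
  · have := min_le_right ε₁ ε₂
    linarith

/-- On the band `|l|` lies between `N/8` and `N/2`, so the power law is comparable to `N^(-α)`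
throughout; this factor later cancels in the shares. -/
theorem exists_weight_bounds (hX : IsField μ X w C) (ha : IsWindow a) (hA : RegularSpectrum C) :
    ∃ b B α : ℝ, 0 < b ∧ 0 < B ∧ ∀ N : ℕ, 0 < N → ∀ l ∈ band N,
      b * (N : ℝ) ^ (-α) * a (4 * l / N) ^ 2 ≤ weight C a N l ∧
        weight C a N l ≤ B * (N : ℝ) ^ (-α) := by
  obtain ⟨c₁, c₂, α, g, hc₁, hα, hg, hC⟩ := hA
  have hc₂ : 0 < c₂ := hc₁.trans_le ((hg 0).1.trans (hg 0).2)
  refine ⟨c₁, c₂ * (1 / 8) ^ (-α), α, hc₁, by positivity, fun N hN l hl => ?_⟩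
  have hN' : (0 : ℝ) < N := by exact_mod_cast hN
  obtain ⟨hl1, hl2⟩ := (Finset.mem_filter.1 hl).2
  rw [Int.abs_eq_natAbs] at hl1 hl2
  have hl0 : 1 ≤ l.natAbs := by omega
  have hCl : C l = g l.natAbs * (l.natAbs : ℝ) ^ (-α) := by
    rw [← hC _ hl0]
    rcases Int.natAbs_eq l with h | h
    · rw [← h]
    · conv_lhs => rw [h]
      exact hX.spectrum_neg _
  have hpos : (0 : ℝ) < l.natAbs := by exact_mod_cast hl0
  have h1 : (N : ℝ) ^ (-α) ≤ (l.natAbs : ℝ) ^ (-α) :=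
    Real.rpow_le_rpow_of_nonpos hpos (by exact_mod_cast (by omega : l.natAbs ≤ N)) (by linarith)
  have h2 : (l.natAbs : ℝ) ^ (-α) ≤ (1 / 8) ^ (-α) * (N : ℝ) ^ (-α) := by
    rw [← Real.mul_rpow (by norm_num) hN'.le]
    have : (N : ℝ) ≤ 8 * l.natAbs := by exact_mod_cast (by omega : N ≤ 8 * l.natAbs)
    exact Real.rpow_le_rpow_of_nonpos (by positivity) (by linarith) (by linarith)
  have hg1 := (hg l.natAbs).1
  have hg2 := (hg l.natAbs).2
  have hD : 0 < (N : ℝ) ^ (-α) := by positivity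
  have hg0 := hc₁.le.trans hg1
  rw [weight, hCl]
  constructor
  · gcongr
  · calc g l.natAbs * (l.natAbs : ℝ) ^ (-α) * a (4 * l / N) ^ 2
        ≤ c₂ * ((1 / 8) ^ (-α) * (N : ℝ) ^ (-α)) * 1 := by
          gcongr
          exact ha.sq_le_one _
      _ = _ := by ring

theorem card_band_le (N : ℕ) : (band N).card ≤ 2 * N + 1 := by
  refine (Finset.card_filter_le _ _).trans ?_
  rw [Int.card_Icc]
  omega

theorem share_eq (N : ℕ) [NeZero N] (l : ℤ) :
    share C a N l = weight C a N l / ∑ l ∈ band N, weight C a N l := by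
  have hN : (N : ℝ) ≠ 0 := by exact_mod_cast NeZero.ne N
  rw [share, sigmaSq]
  field_simp

theorem exists_share_bounds (hX : IsField μ X w C) (ha : IsWindow a) (hA : RegularSpectrum C) :
    ∃ κ c : ℝ, 0 < κ ∧ 0 < c ∧ ∀ᶠ N : ℕ in atTop, 0 < sigmaSq C a N ∧
      (∀ l ∈ band N, share C a N l ≤ c / N) ∧ ∃ L : Finset ℤ, κ * N ≤ L.card ∧
        (∀ l ∈ L, l ∈ band N ∧ κ / N ≤ share C a N l) ∧
        ∀ l ∈ L, ∀ l' ∈ L, -(l + l') ∈ band N ∧ κ / N ≤ share C a N (-(l + l')) := by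
  obtain ⟨b, B, α, hb, hB, hw⟩ := exists_weight_bounds hX ha hA
  obtain ⟨u, δ, hδ, h1, h2⟩ := ha.exists_point
  -- With `D = N^(-α)`, the total weight lies between `δ b N D / 16` and `3 N B D`, single weights
  -- are at most `B D`, and those where `a^2 ≥ 1/4` are at least `b D / 4`. The quotients give these
  -- constants.
  refine ⟨min (δ / 4) (b / (12 * B)), 16 * B / (δ * b), by positivity, by positivity, ?_⟩
  filter_upwards [eventually_ge_atTop 1, eventually_ge_atTop ⌈4 / δ⌉₊] with N hN1 hNδ
  have : NeZero N := ⟨by omega⟩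
  have hN : (0 : ℝ) < N := by exact_mod_cast hN1
  have hNδ' : 4 ≤ N * δ := by
    have := Nat.ceil_le.1 hNδ
    rwa [div_le_iff₀ hδ] at this
  set D := (N : ℝ) ^ (-α) with hD'
  have hD : 0 < D := by positivity
  have hmem : ∀ l : ℤ, 1 / 4 ≤ a (4 * l / N) ^ 2 → l ∈ band N := by
    intro l hl
    by_contra hc
    rw [ha.eq_zero_of_notMem_band hN1 hc] at hl
    norm_num at hl
  have hlow : ∀ l : ℤ, 1 / 4 ≤ a (4 * l / N) ^ 2 → b * D / 4 ≤ weight C a N l := by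
    intro l hl
    refine le_trans ?_ (hw N hN1 l (hmem l hl)).1
    have := mul_le_mul_of_nonneg_left hl (by positivity : 0 ≤ b * D)
    linarith
  -- The frequencies with `4l/N` within `δ` of `u`. There are more than `Nδ/2 - 1` of them, hence at
  -- least `Nδ/4` once `Nδ ≥ 4`, and sums of two of them land within `2δ` of `2u`.
  set L := Finset.Icc ⌈N * (u - δ) / 4⌉ ⌊N * (u + δ) / 4⌋ with hL
  have hLa : ∀ l ∈ L, |4 * (l : ℝ) / N - u| ≤ δ := by
    intro l hl
    rw [hL, Finset.mem_Icc, Int.ceil_le, Int.le_floor] at hl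
    rw [abs_le, neg_le_sub_iff_le_add, sub_le_iff_le_add, div_le_iff₀ hN]
    constructor
    · rw [← sub_le_iff_le_add, le_div_iff₀ hN]; linarith [hl.1]
    · linarith [hl.2]
  have hL1 : ∀ l ∈ L, 1 / 4 ≤ a (4 * l / N) ^ 2 := fun l hl => h1 _ (hLa l hl)
  have hL2 : ∀ l ∈ L, ∀ l' ∈ L, 1 / 4 ≤ a (4 * (-(l + l') : ℤ) / N) ^ 2 := by
    intro l hl l' hl'
    rw [← ha.even]
    refine h2 _ ?_
    have e : -(4 * ((-(l + l') : ℤ) : ℝ) / N) - 2 * u =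
        (4 * (l : ℝ) / N - u) + (4 * (l' : ℝ) / N - u) := by push_cast; ring
    rw [e]
    exact (abs_add_le _ _).trans (by linarith [hLa l hl, hLa l' hl'])
  have hcard : δ / 4 * N ≤ L.card := by
    rw [hL, Int.card_Icc]
    have e1 := Int.lt_floor_add_one (N * (u + δ) / 4)
    have e2 := Int.ceil_lt_add_one (N * (u - δ) / 4)
    have e3 := Int.self_le_toNat (⌊N * (u + δ) / 4⌋ + 1 - ⌈N * (u - δ) / 4⌉)
    have e4 : ((⌊N * (u + δ) / 4⌋ + 1 - ⌈N * (u - δ) / 4⌉ : ℤ) : ℝ) ≤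
      ((⌊N * (u + δ) / 4⌋ + 1 - ⌈N * (u - δ) / 4⌉).toNat : ℝ) := by exact_mod_cast e3
    refine le_trans ?_ e4
    push_cast
    linarith
  set T := ∑ l ∈ band N, weight C a N l with hT
  have hTlow : δ * b * (N * D) / 16 ≤ T := by
    calc δ * b * (N * D) / 16 = δ / 4 * N * (b * D / 4) := by ring
      _ ≤ L.card * (b * D / 4) := by gcongr
      _ ≤ ∑ l ∈ L, weight C a N l := by
        rw [← nsmul_eq_mul]
        exact Finset.card_nsmul_le_sum _ _ _ fun l hl => hlow l (hL1 l hl)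
      _ ≤ T := Finset.sum_le_sum_of_subset_of_nonneg (fun l hl => hmem l (hL1 l hl))
          fun l _ _ => weight_nonneg hX a N l
  have hTup : T ≤ 3 * N * (B * D) := by
    calc T ≤ (band N).card • (B * D) :=
          Finset.sum_le_card_nsmul _ _ _ fun l hl => (hw N hN1 l hl).2
      _ ≤ 3 * N * (B * D) := by
        rw [nsmul_eq_mul]
        gcongr
        exact_mod_cast (card_band_le N).trans (by omega)
  have hT0 : 0 < T := lt_of_lt_of_le (by positivity) hTlow
  have hshare : ∀ l : ℤ, 1 / 4 ≤ a (4 * l / N) ^ 2 →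
      min (δ / 4) (b / (12 * B)) / N ≤ share C a N l := by
    intro l hl
    rw [share_eq]
    calc min (δ / 4) (b / (12 * B)) / N ≤ b / (12 * B) / N := by
          gcongr; exact min_le_right _ _
      _ = (b * D / 4) / (3 * N * (B * D)) := by field_simp; norm_num
      _ ≤ weight C a N l / T := by
          have := hlow l hl
          have := weight_nonneg hX a N l
          gcongr
  refine ⟨?_, fun l hl => ?_, L, ?_, fun l hl => ⟨hmem l (hL1 l hl), hshare l (hL1 l hl)⟩,
    fun l hl l' hl' => ⟨hmem _ (hL2 l hl l' hl'), hshare _ (hL2 l hl l' hl')⟩⟩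
  · rw [sigmaSq]
    positivity
  · rw [share_eq]
    calc weight C a N l / T ≤ B * D / (δ * b * (N * D) / 16) := by
          have := (hw N hN1 l hl).2
          gcongr
      _ = _ := by field_simp
  · refine le_trans ?_ hcard
    gcongr
    exact min_le_left _ _

theorem sigmaSSq_eq (C : ℤ → ℝ) (a : ℝ → ℝ) (N : ℕ) :
    sigmaSSq C a N = 12 * Real.pi * ∑ l₁ ∈ band N, ∑ l₂ ∈ band N, ∑ l₃ ∈ band N,
      share C a N l₁ * share C a N l₂ * share C a N l₃ *
        fejer N ((l₁ + l₂ + l₃) * (2 * Real.pi / N)) := by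
  rw [sigmaSSq]
  simp only [Finset.mul_sum, share]
  refine Finset.sum_congr rfl fun l₁ _ => Finset.sum_congr rfl fun l₂ _ =>
    Finset.sum_congr rfl fun l₃ _ => ?_
  ring

theorem sigmaU1Sq_eq (C : ℤ → ℝ) (a : ℝ → ℝ) (N : ℕ) :
    sigmaU1Sq C a N = 144 * Real.pi * ∑ l₁ ∈ band N, ∑ l₂ ∈ band N,
      share C a N l₁ * share C a N l₂ * fejer N ((l₁ + l₂) * (2 * Real.pi / N)) := by
  rw [sigmaU1Sq]
  simp only [Finset.mul_sum, share]
  refine Finset.sum_congr rfl fun l₁ _ => Finset.sum_congr rfl fun l₂ _ => ?_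
  ring

theorem sigmaU2Sq_nonneg (hX : IsField μ X w C) (a : ℝ → ℝ) (N : ℕ) : 0 ≤ sigmaU2Sq C a N := by
  have hs := sigmaSq_nonneg hX a N
  have hp := Real.pi_pos
  refine mul_nonneg (by positivity) (Finset.sum_nonneg fun l₁ _ => Finset.sum_nonneg fun l₂ _ =>
    Finset.sum_nonneg fun l₃ _ => Finset.sum_nonneg fun l₄ _ => ?_)
  have := weight_nonneg hX a N
  have := fejer_nonneg N
  have h1 := this ((l₁ + l₂ + l₃ + l₄) * (2 * Real.pi / N))
  exact mul_nonneg (mul_nonneg (mul_nonneg (mul_nonneg (weight_nonneg hX a N _)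
    (weight_nonneg hX a N _)) (weight_nonneg hX a N _)) (weight_nonneg hX a N _)) h1

/-- All terms are nonnegative, so keep only `l₁, l₂ ∈ L` and `l₃ = -(l₁ + l₂)`, where Fejér's kernel
is `N/(2π)`. This leaves `12π (κN)^2 (κ/N)^3 N/(2π) = 6κ^5`. -/
theorem le_sigmaSSq (hX : IsField μ X w C) {N : ℕ} [NeZero N] {κ : ℝ} (hκ : 0 < κ) {L : Finset ℤ}
    (hcard : κ * N ≤ L.card) (h1 : ∀ l ∈ L, l ∈ band N ∧ κ / N ≤ share C a N l)
    (h2 : ∀ l ∈ L, ∀ l' ∈ L, -(l + l') ∈ band N ∧ κ / N ≤ share C a N (-(l + l'))) :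
    6 * κ ^ 5 ≤ sigmaSSq C a N := by
  have hN : (0 : ℝ) < N := by exact_mod_cast Nat.pos_of_ne_zero (NeZero.ne N)
  have hpi := Real.pi_pos
  have hs := share_nonneg hX a N
  have hL : L ⊆ band N := fun l hl => (h1 l hl).1
  have hf := fejer_nonneg N
  have hterm : ∀ l₁ ∈ L, ∀ l₂ ∈ L, (κ / N) ^ 3 * (N / (2 * Real.pi)) ≤
      ∑ l₃ ∈ band N, share C a N l₁ * share C a N l₂ * share C a N l₃ *
        fejer N ((l₁ + l₂ + l₃) * (2 * Real.pi / N)) := by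
    intro l₁ hl₁ l₂ hl₂
    refine le_trans ?_ (Finset.single_le_sum
      (fun l₃ _ => mul_nonneg (mul_nonneg (mul_nonneg (hs _) (hs _)) (hs _)) (hf _))
      (h2 l₁ hl₁ l₂ hl₂).1)
    have e : ((l₁ + l₂ + (-(l₁ + l₂) : ℤ)) * (2 * Real.pi / N) : ℝ) = 0 := by push_cast; ring
    rw [e, fejer_zero, pow_succ, sq]
    have := (h1 l₁ hl₁).2
    have := (h1 l₂ hl₂).2
    have := (h2 l₁ hl₁ l₂ hl₂).2
    have := hs l₁
    have := hs l₂
    gcongr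
  rw [sigmaSSq_eq]
  calc 6 * κ ^ 5 = 12 * Real.pi * ((κ * N) * ((κ * N) * ((κ / N) ^ 3 * (N / (2 * Real.pi))))) := by
        field_simp; norm_num
    _ ≤ 12 * Real.pi * (L.card * (L.card * ((κ / N) ^ 3 * (N / (2 * Real.pi))))) := by gcongr
    _ = 12 * Real.pi * ∑ l₁ ∈ L, ∑ l₂ ∈ L, (κ / N) ^ 3 * (N / (2 * Real.pi)) := by
        simp only [Finset.sum_const, nsmul_eq_mul]
    _ ≤ 12 * Real.pi * ∑ l₁ ∈ L, ∑ l₂ ∈ L, ∑ l₃ ∈ band N,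
          share C a N l₁ * share C a N l₂ * share C a N l₃ *
            fejer N ((l₁ + l₂ + l₃) * (2 * Real.pi / N)) := by
        gcongr with l₁ hl₁ l₂ hl₂
        exact hterm l₁ hl₁ l₂ hl₂
    _ ≤ _ := by
        have hnn : ∀ l₁ l₂, 0 ≤ ∑ l₃ ∈ band N, share C a N l₁ * share C a N l₂ * share C a N l₃ *
            fejer N ((l₁ + l₂ + l₃) * (2 * Real.pi / N)) := fun l₁ l₂ =>
          Finset.sum_nonneg fun l₃ _ =>
            mul_nonneg (mul_nonneg (mul_nonneg (hs _) (hs _)) (hs _)) (hf _)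
        refine mul_le_mul_of_nonneg_left ?_ (by positivity)
        refine (Finset.sum_le_sum fun l₁ _ => Finset.sum_le_sum_of_subset_of_nonneg hL
          fun l₂ _ _ => hnn l₁ l₂).trans ?_
        exact Finset.sum_le_sum_of_subset_of_nonneg hL fun l₁ _ _ =>
          Finset.sum_nonneg fun l₂ _ => hnn l₁ l₂

/-- Keep only `l₂ = -l₁` with `l₁ ∈ L`. The quadratic part alone bounds the kurtosis variance below,
so four-frequency resonances are not needed. -/
theorem le_sigmaU1Sq (hX : IsField μ X w C) (ha : IsWindow a) {N : ℕ} [NeZero N] {κ : ℝ}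
    (hκ : 0 < κ) {L : Finset ℤ} (hcard : κ * N ≤ L.card)
    (h1 : ∀ l ∈ L, l ∈ band N ∧ κ / N ≤ share C a N l) : 72 * κ ^ 3 ≤ sigmaU1Sq C a N := by
  have hN : (0 : ℝ) < N := by exact_mod_cast Nat.pos_of_ne_zero (NeZero.ne N)
  have hpi := Real.pi_pos
  have hs := share_nonneg hX a N
  have hL : L ⊆ band N := fun l hl => (h1 l hl).1
  have hf := fejer_nonneg N
  rw [sigmaU1Sq_eq]
  calc 72 * κ ^ 3 = 144 * Real.pi * ((κ * N) * ((κ / N) ^ 2 * (N / (2 * Real.pi)))) := by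
        field_simp; norm_num
    _ ≤ 144 * Real.pi * (L.card * ((κ / N) ^ 2 * (N / (2 * Real.pi)))) := by gcongr
    _ = 144 * Real.pi * ∑ l₁ ∈ L, (κ / N) ^ 2 * (N / (2 * Real.pi)) := by
        simp only [Finset.sum_const, nsmul_eq_mul]
    _ ≤ 144 * Real.pi * ∑ l₁ ∈ L, ∑ l₂ ∈ band N,
          share C a N l₁ * share C a N l₂ * fejer N ((l₁ + l₂) * (2 * Real.pi / N)) := by
        gcongr with l₁ hl₁
        refine le_trans ?_ (Finset.single_le_sum
          (fun l₂ _ => mul_nonneg (mul_nonneg (hs _) (hs _)) (hf _)) (neg_mem_band (h1 l₁ hl₁).1))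
        have e : ((l₁ + (-l₁ : ℤ)) * (2 * Real.pi / N) : ℝ) = 0 := by push_cast; ring
        rw [e, fejer_zero, share_neg hX ha, sq]
        have := (h1 l₁ hl₁).2
        have := hs l₁
        gcongr
    _ ≤ _ := by
        refine mul_le_mul_of_nonneg_left ?_ (by positivity)
        exact Finset.sum_le_sum_of_subset_of_nonneg hL fun l₁ _ _ => Finset.sum_nonneg fun l₂ _ =>
          mul_nonneg (mul_nonneg (hs _) (hs _)) (hf _)

instance (j : ℕ) : NeZero (res j) := ⟨by simp [res]⟩

theorem tendsto_res : Tendsto res atTop atTop :=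
  (tendsto_pow_atTop_atTop_of_one_lt (one_lt_two : (1 : ℕ) < 2)).comp (tendsto_add_atTop_nat 2)

/-- For large `N` the covariance of the wavelet coefficients is regular and the variances of the
skewness and the kurtosis are bounded below. -/
theorem exists_eventually_isRegularCov (hX : IsField μ X w C) (ha : IsWindow a)
    (hA : RegularSpectrum C) : ∃ c v : ℝ, 0 ≤ c ∧ 0 < v ∧ ∀ᶠ j : ℕ in atTop,
      IsRegularCov (hartley C a (res j)) c ∧ v ≤ sigmaS C a (res j) ∧ v ≤ sigmaU C a (res j) := by
  obtain ⟨κ, c, hκ, hc, h⟩ := exists_share_bounds hX ha hA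
  refine ⟨max (2 * c) ((2 * c) ^ 3), min (Real.sqrt (6 * κ ^ 5)) (Real.sqrt (72 * κ ^ 3)),
    by positivity, by positivity, ?_⟩
  filter_upwards [tendsto_res.eventually h] with j ⟨h0, hle, L, hcard, h1, h2⟩
  refine ⟨isRegularCov_hartley hX ha h0 hc.le hle, (min_le_left _ _).trans ?_,
    (min_le_right _ _).trans ?_⟩
  · exact Real.sqrt_le_sqrt (le_sigmaSSq hX hκ hcard h1 h2)
  · refine Real.sqrt_le_sqrt ?_
    have := le_sigmaU1Sq hX ha hκ hcard h1
    have := sigmaU2Sq_nonneg hX a (res j)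
    linarith

end Asymptotics

end

/-! ### From moments to characteristic functions -/

section

/-! ### The method of moments -/

section Moments

/-- The Taylor polynomial of `y ↦ exp (iy)`. -/
def expTaylor (n : ℕ) (y : ℝ) : ℂ := ∑ m ∈ Finset.range n, Complex.I ^ m / m.factorial * (y : ℂ) ^ m

theorem hasDerivAt_expTaylor_succ (n : ℕ) (y : ℝ) :
    HasDerivAt (expTaylor (n + 1)) (Complex.I * expTaylor n y) y := by
  have h : ∀ m : ℕ, HasDerivAt (fun y : ℝ => Complex.I ^ m / m.factorial * (y : ℂ) ^ m)
      (Complex.I ^ m / m.factorial * (m * (y : ℂ) ^ (m - 1))) y := fun m =>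
    ((hasDerivAt_pow m (y : ℂ)).comp_ofReal).const_mul _
  have hs := HasDerivAt.fun_sum (u := Finset.range (n + 1)) fun m _ => h m
  refine hs.congr_deriv ?_
  rw [Finset.sum_range_succ', expTaylor, Finset.mul_sum]
  simp only [Nat.cast_zero, zero_mul, mul_zero, add_zero, Nat.add_sub_cancel]
  refine Finset.sum_congr rfl fun m _ => ?_
  have : (m.factorial : ℂ) ≠ 0 := by exact_mod_cast m.factorial_ne_zero
  have : ((m + 1 : ℕ) : ℂ) ≠ 0 := by exact_mod_cast m.succ_ne_zero
  rw [Nat.factorial_succ]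
  push_cast at this ⊢
  field_simp
  ring

/-- Along `t ↦ t y` the derivative of one remainder is `i y` times the preceding remainder; the mean
value inequality integrates the bound. -/
theorem norm_cexp_sub_expTaylor_le (n : ℕ) (y : ℝ) :
    ‖Complex.exp (Complex.I * y) - expTaylor n y‖ ≤ |y| ^ n / n.factorial := by
  induction n generalizing y with
  | zero => simp [expTaylor, Complex.norm_exp]
  | succ n ih =>
    have hE : ∀ t : ℝ, HasDerivAt (fun t : ℝ => Complex.exp (Complex.I * ((t * y : ℝ) : ℂ)))
        (Complex.I * y * Complex.exp (Complex.I * ((t * y : ℝ) : ℂ))) t := by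
      intro t
      have h1 : HasDerivAt (fun t : ℝ => Complex.I * ((t * y : ℝ) : ℂ)) (Complex.I * y) t := by
        have := ((hasDerivAt_id t).mul_const y).ofReal_comp.const_mul Complex.I
        simpa using this
      simpa [mul_comm] using h1.cexp
    have hT : ∀ t : ℝ, HasDerivAt (fun t : ℝ => expTaylor (n + 1) (t * y))
        (y * (Complex.I * expTaylor n (t * y))) t := by
      intro t
      have := (hasDerivAt_expTaylor_succ n (t * y)).scomp t ((hasDerivAt_id t).mul_const y)
      simpa [Function.comp_def] using this
    have hf := fun t => (hE t).sub (hT t)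
    have key := image_norm_le_of_norm_deriv_right_le_deriv_boundary (a := 0) (b := 1)
      (f := fun t : ℝ => Complex.exp (Complex.I * ((t * y : ℝ) : ℂ)) - expTaylor (n + 1) (t * y))
      (B := fun t => |y| ^ (n + 1) / (n + 1).factorial * t ^ (n + 1))
      (B' := fun t => |y| ^ (n + 1) / (n + 1).factorial * ((n + 1 : ℕ) * t ^ n))
      (fun t _ => (hf t).continuousAt.continuousWithinAt)
      (fun t _ => (hf t).hasDerivWithinAt) (by simp [expTaylor, Finset.sum_range_succ'])
      (fun t => by simpa using (hasDerivAt_pow (n + 1) t).const_mul (|y| ^ (n + 1) / (n + 1).factorial))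
      (fun t ht => ?_)
    · simpa using key (Set.right_mem_Icc.2 zero_le_one)
    · have e : Complex.I * y * Complex.exp (Complex.I * ((t * y : ℝ) : ℂ)) -
          y * (Complex.I * expTaylor n (t * y)) =
          Complex.I * y * (Complex.exp (Complex.I * ((t * y : ℝ) : ℂ)) - expTaylor n (t * y)) := by
        ring
      rw [e, norm_mul, norm_mul, Complex.norm_I, one_mul, Complex.norm_real, Real.norm_eq_abs]
      refine (mul_le_mul_of_nonneg_left (ih (t * y)) (abs_nonneg y)).trans (le_of_eq ?_)
      rw [abs_mul, abs_of_nonneg ht.1, Nat.factorial_succ]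
      have : (n.factorial : ℝ) ≠ 0 := by exact_mod_cast n.factorial_ne_zero
      have : ((n : ℝ) + 1) ≠ 0 := by positivity
      push_cast
      field_simp
      ring

variable {Ω Ω' : Type*} [MeasurableSpace Ω] [MeasurableSpace Ω']

theorem integral_expTaylor {μ : Measure Ω} {Y : Ω → ℝ} (hY : ∀ m, Integrable (fun ω => Y ω ^ m) μ)
    (n : ℕ) : Integrable (fun ω => expTaylor n (Y ω)) μ ∧ ∫ ω, expTaylor n (Y ω) ∂μ =
      ∑ m ∈ Finset.range n, Complex.I ^ m / m.factorial * ((∫ ω, Y ω ^ m ∂μ : ℝ) : ℂ) := by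
  have hi : ∀ m : ℕ, Integrable (fun ω => Complex.I ^ m / m.factorial * (Y ω : ℂ) ^ m) μ := by
    intro m
    have := ((hY m).ofReal (𝕜 := ℂ)).const_mul (Complex.I ^ m / m.factorial)
    simpa using this
  refine ⟨integrable_finsetSum _ fun m _ => hi m, ?_⟩
  simp only [expTaylor]
  rw [integral_finsetSum _ fun m _ => hi m]
  refine Finset.sum_congr rfl fun m _ => ?_
  rw [integral_const_mul, ← integral_complex_ofReal]
  push_cast
  rfl

/-- The even order makes the remainder an ordinary moment rather than an absolute one. -/
theorem norm_integral_cexp_sub_le {μ : Measure Ω} [IsProbabilityMeasure μ] {Y : Ω → ℝ}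
    (hm : AEMeasurable Y μ) (hY : ∀ m, Integrable (fun ω => Y ω ^ m) μ) (M : ℕ) :
    ‖∫ ω, Complex.exp (Complex.I * Y ω) ∂μ - ∑ m ∈ Finset.range (2 * M),
      Complex.I ^ m / m.factorial * ((∫ ω, Y ω ^ m ∂μ : ℝ) : ℂ)‖ ≤
        (∫ ω, Y ω ^ (2 * M) ∂μ) / (2 * M).factorial := by
  have hi : Integrable (fun ω => Complex.exp (Complex.I * Y ω)) μ := by
    refine (integrable_const (1 : ℝ)).mono' (by fun_prop) (ae_of_all _ fun ω => ?_)
    rw [Complex.norm_exp_I_mul_ofReal]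
  rw [← (integral_expTaylor hY (2 * M)).2, ← integral_sub hi (integral_expTaylor hY (2 * M)).1,
    ← integral_div]
  refine norm_integral_le_of_norm_le ((hY (2 * M)).div_const _) (ae_of_all _ fun ω => ?_)
  refine (norm_cexp_sub_expTaylor_le (2 * M) (Y ω)).trans (le_of_eq ?_)
  rw [pow_mul, sq_abs, ← pow_mul]

/-- Convergence of moments to those of a law with rapidly decreasing `E Z^{2M} / (2M)!` implies
convergence of characteristic functions. -/
theorem tendsto_integral_cexp_of_moments {μ : Measure Ω} [IsProbabilityMeasure μ]
    {ν : Measure Ω'} [IsProbabilityMeasure ν] {Y : ℕ → Ω → ℝ} {Z : Ω' → ℝ}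
    (hmY : ∀ j, AEMeasurable (Y j) μ) (hmZ : AEMeasurable Z ν)
    (hY : ∀ j m, Integrable (fun ω => Y j ω ^ m) μ) (hZ : ∀ m, Integrable (fun ω => Z ω ^ m) ν)
    (hlim : ∀ m, Tendsto (fun j => ∫ ω, Y j ω ^ m ∂μ) atTop (𝓝 (∫ ω, Z ω ^ m ∂ν)))
    (hdecay : Tendsto (fun M : ℕ => (∫ ω, Z ω ^ (2 * M) ∂ν) / (2 * M).factorial) atTop (𝓝 0)) :
    Tendsto (fun j => ∫ ω, Complex.exp (Complex.I * Y j ω) ∂μ) atTop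
      (𝓝 (∫ ω, Complex.exp (Complex.I * Z ω) ∂ν)) := by
  rw [Metric.tendsto_atTop]
  intro ε hε
  -- Fix the order first. The limit's remainder is below `ε/4`, and by convergence of the moment of
  -- order `2M` so is that of `Y j` for large `j`; the finitely many Taylor terms also converge.
  obtain ⟨M, hM⟩ := (hdecay.eventually (gt_mem_nhds (by positivity : 0 < ε / 4))).exists
  set P : (ℕ → ℝ) → ℂ := fun e => ∑ m ∈ Finset.range (2 * M), Complex.I ^ m / m.factorial * (e m : ℂ)
  have hP : Tendsto (fun j => P fun m => ∫ ω, Y j ω ^ m ∂μ) atTop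
      (𝓝 (P fun m => ∫ ω, Z ω ^ m ∂ν)) :=
    tendsto_finsetSum _ fun m _ => ((Complex.continuous_ofReal.tendsto _).comp (hlim m)).const_mul _
  have h1 := (hlim (2 * M)).div_const ((2 * M).factorial : ℝ)
  have h2 := h1.eventually (gt_mem_nhds hM)
  have h3 := Metric.tendsto_atTop.1 hP (ε / 4) (by positivity)
  obtain ⟨J, hJ⟩ := h3
  obtain ⟨J', hJ'⟩ := eventually_atTop.1 h2
  refine ⟨max J J', fun j hj => ?_⟩
  have b1 := norm_integral_cexp_sub_le (hmY j) (hY j) M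
  have b2 := norm_integral_cexp_sub_le hmZ hZ M
  have b3 := hJ j ((le_max_left _ _).trans hj)
  have b4 := hJ' j ((le_max_right _ _).trans hj)
  rw [dist_eq_norm] at b3 ⊢
  rw [← norm_neg, neg_sub] at b2
  set u := ∫ ω, Complex.exp (Complex.I * Y j ω) ∂μ
  set v := ∫ ω, Complex.exp (Complex.I * Z ω) ∂ν
  set p := P fun m => ∫ ω, Y j ω ^ m ∂μ
  set q := P fun m => ∫ ω, Z ω ^ m ∂ν
  have e : u - v = (u - p) + (p - q) + (q - v) := by ring
  rw [e]
  refine (norm_add₃_le).trans_lt ?_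
  have b1' : ‖u - p‖ ≤ (∫ ω, Y j ω ^ (2 * M) ∂μ) / (2 * M).factorial := b1
  have b2' : ‖q - v‖ ≤ (∫ ω, Z ω ^ (2 * M) ∂ν) / (2 * M).factorial := b2
  linarith

open MvPolynomial

theorem integral_pow_gaussianReal (n : ℕ) : ∫ x : ℝ, x ^ n ∂gaussianReal 0 1 = normalMoment n := by
  induction n using Nat.strong_induction_on with
  | _ n ih =>
    rcases n with _ | n
    · simp [normalMoment]
    · rw [integral_pow_succ_gaussianReal, normalMoment_succ, ih _ (by omega)]

/-- A linear form with coefficients `t`. -/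
def linForm {ι : Type} [Fintype ι] (t : ι → ℝ) : MvPolynomial ι ℝ := lin (fun _ : Unit => t) ()

theorem eval_linForm {ι : Type} [Fintype ι] (t g : ι → ℝ) :
    eval g (linForm t) = ∑ i, t i * g i :=
  eval_lin _ _ _

theorem gaussE_linForm_pow_add_two {ι : Type} [Fintype ι] [DecidableEq ι] (t : ι → ℝ) (n : ℕ) :
    gaussE (linForm t ^ (n + 2)) = (n + 1) * (∑ i, t i ^ 2) * gaussE (linForm t ^ n) := by
  rw [pow_succ', linForm, gaussE_lin_mul, Finset.mul_sum, Finset.sum_mul]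
  refine Finset.sum_congr rfl fun i _ => ?_
  rw [pderiv_pow, pderiv_lin, Nat.add_sub_cancel]
  have : ((n + 1 : ℕ) : MvPolynomial ι ℝ) * lin (fun _ : Unit => t) () ^ n * C (t i) =
      C ((n + 1) * t i) * lin (fun _ : Unit => t) () ^ n := by
    rw [C_mul, map_add, map_natCast, C_1]; push_cast; ring
  rw [this, gaussE_C_mul]
  ring

/-- These are terms of an exponential series, hence tend to zero, which is the decay required by the
method of moments. -/
theorem gaussE_linForm_pow_div {ι : Type} [Fintype ι] [DecidableEq ι] (t : ι → ℝ) (M : ℕ) :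
    gaussE (linForm t ^ (2 * M)) / (2 * M).factorial = ((∑ i, t i ^ 2) / 2) ^ M / M.factorial := by
  induction M with
  | zero => simp
  | succ M ih =>
    rw [show 2 * (M + 1) = 2 * M + 2 by ring, gaussE_linForm_pow_add_two, pow_succ,
      Nat.factorial_succ, Nat.factorial_succ, Nat.factorial_succ]
    have h1 : ((2 * M).factorial : ℝ) ≠ 0 := by exact_mod_cast (2 * M).factorial_ne_zero
    have h2 : (M.factorial : ℝ) ≠ 0 := by exact_mod_cast M.factorial_ne_zero
    have h3 : (M : ℝ) + 1 ≠ 0 := by positivity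
    have h4 : 2 * (M : ℝ) + 1 ≠ 0 := by positivity
    have h5 : 2 * (M : ℝ) + 1 + 1 ≠ 0 := by positivity
    rw [div_eq_div_iff h1 h2] at ih
    push_cast
    rw [div_eq_div_iff (by positivity) (by positivity)]
    linear_combination (2 * (M : ℝ) + 1) * (∑ i, t i ^ 2) * (M + 1) * ih

variable {Ω : Type*} [MeasurableSpace Ω] {μ : Measure Ω} [IsProbabilityMeasure μ]
  {V : ℕ → Ω → Fin 2 → ℝ}

theorem tendsto_integral_eval (h : ∀ p q : ℕ, (∀ j, Integrable (fun ω => V j ω 0 ^ p * V j ω 1 ^ q) μ) ∧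
      Tendsto (fun j => ∫ ω, V j ω 0 ^ p * V j ω 1 ^ q ∂μ) atTop
        (𝓝 (normalMoment p * normalMoment q))) (f : MvPolynomial (Fin 2) ℝ) :
    (∀ j, Integrable (fun ω => eval (V j ω) f) μ) ∧
      Tendsto (fun j => ∫ ω, eval (V j ω) f ∂μ) atTop (𝓝 (gaussE f)) := by
  induction f using MvPolynomial.induction_on' with
  | add p q hp hq =>
    simp only [map_add]
    refine ⟨fun j => (hp.1 j).add (hq.1 j), (hp.2.add hq.2).congr fun j => ?_⟩
    rw [integral_add (hp.1 j) (hq.1 j)]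
  | monomial s c =>
    have e : ∀ j ω, eval (V j ω) (monomial s c) = c * (V j ω 0 ^ s 0 * V j ω 1 ^ s 1) := by
      intro j ω
      rw [eval_monomial, Finsupp.prod_fintype _ _ (fun i => pow_zero _), Fin.prod_univ_two]
    simp only [e]
    refine ⟨fun j => ((h _ _).1 j).const_mul c, ?_⟩
    simp only [integral_const_mul]
    rw [gaussE_monomial, Fin.prod_univ_two, integral_pow_gaussianReal, integral_pow_gaussianReal]
    exact (h _ _).2.const_mul c

/-- The method of moments in the plane. -/
theorem tendsto_integral_cexp_plane (hV : ∀ j, Measurable (V j))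
    (h : ∀ p q : ℕ, (∀ j, Integrable (fun ω => V j ω 0 ^ p * V j ω 1 ^ q) μ) ∧
      Tendsto (fun j => ∫ ω, V j ω 0 ^ p * V j ω 1 ^ q ∂μ) atTop
        (𝓝 (normalMoment p * normalMoment q))) (t : Fin 2 → ℝ) :
    Tendsto (fun j => ∫ ω, Complex.exp (Complex.I * ((∑ i, t i * V j ω i : ℝ) : ℂ)) ∂μ) atTop
      (𝓝 (Complex.exp (-((∑ i, t i ^ 2 : ℝ) : ℂ) / 2))) := by
  rw [← integral_cexp_gaussPi]
  have e : ∀ (g : Fin 2 → ℝ) (m : ℕ), (∑ i, t i * g i) ^ m = eval g (linForm t ^ m) := by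
    intro g m
    rw [map_pow, eval_linForm]
  refine tendsto_integral_cexp_of_moments (fun j => ?_)
    (Continuous.aemeasurable (by fun_prop)) (fun j m => ?_) (fun m => ?_)
    (fun m => ?_) ?_
  · have := hV j
    exact (Finset.measurable_fun_sum _ fun i _ =>
      ((measurable_pi_apply i).comp this).const_mul _).aemeasurable
  · simp only [e]
    exact (tendsto_integral_eval h _).1 j
  · simp only [e]
    exact integrable_eval _
  · simp only [e, ← gaussE_apply]
    exact (tendsto_integral_eval h _).2
  · simp only [e, ← gaussE_apply, gaussE_linForm_pow_div]
    exact FloorSemiring.tendsto_pow_div_factorial_atTop _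

end Moments

end

/-! ### Limits of the normalized moments and the limit law -/

section

/-! ### The central limit theorem -/

section Limit

variable {Ω : Type*} [MeasurableSpace Ω] {μ : Measure Ω} [IsProbabilityMeasure μ]
  {X : ℝ → Ω → ℝ} {w : ℤ → Ω → ℂ} {C : ℤ → ℝ} {a : ℝ → ℝ}

theorem tendsto_div_sqrt_res (B : ℝ) :
    Tendsto (fun j => B / Real.sqrt (res j)) atTop (𝓝 0) :=
  (Real.tendsto_sqrt_atTop.comp (tendsto_natCast_atTop_atTop.comp tendsto_res)).const_div_atTop B

theorem abs_div_pow_mul_pow_le {x y z v s : ℝ} (hv : 0 < v) (hy : v ≤ y) (hz : v ≤ z)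
    (h : |x| ≤ s) (m n : ℕ) : |x / (y ^ m * z ^ n)| ≤ s / (v ^ m * v ^ n) := by
  have hy0 := hv.trans_le hy
  have hz0 := hv.trans_le hz
  rw [abs_div, abs_of_pos (by positivity : 0 < y ^ m * z ^ n)]
  have := (abs_nonneg x).trans h
  gcongr

/-- Dividing the polynomial recursions by powers of the standard deviations turns their coefficients
into those of the normal moments. The error stays `O(N^(-1/2))` because the standard deviations are
bounded below. -/
theorem IsField.tendsto_moments (hX : IsField μ X w C) (ha : IsWindow a) (hA : RegularSpectrum C)
    (hB : IsGaussianProcess X μ) (p q : ℕ) :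
    Tendsto (fun j => ∫ ω, normSkewness X C a (res j) ω ^ p * normKurtosis X C a (res j) ω ^ q ∂μ)
      atTop (𝓝 (normalMoment p * normalMoment q)) := by
  obtain ⟨c, v, hc, hv, hev⟩ := exists_eventually_isRegularCov hX ha hA
  refine tendsto_moments_of_recursion (e := fun j p q => ∫ ω, normSkewness X C a (res j) ω ^ p *
    normKurtosis X C a (res j) ω ^ q ∂μ) (by simp) (fun p q => ?_) (fun q => ?_) p q
  · obtain ⟨B, h⟩ := exists_abs_gaussE_skewPoly_pow_succ_le c hc p q
    refine squeeze_zero_norm' ?_ (tendsto_div_sqrt_res (B / (v ^ (p + 1) * v ^ q)))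
    filter_upwards [hev] with j ⟨hreg, hS, hU⟩
    have hS0 := hv.trans_le hS
    have hU0 := hv.trans_le hU
    have hb := h _ _ _ hreg
    rw [skewVar_hartley hX ha, ZMod.card] at hb
    have hsq : sigmaSSq C a (res j) = sigmaS C a (res j) ^ 2 :=
      (Real.sq_sqrt (Real.sqrt_pos.1 hS0).le).symm
    rw [(hX.integral_skewness_kurtosis ha hB _ _).2, (hX.integral_skewness_kurtosis ha hB _ _).2,
      Real.norm_eq_abs, div_right_comm]
    rw [hsq] at hb
    refine le_trans (le_of_eq ?_) (abs_div_pow_mul_pow_le hv hS hU hb (p + 1) q)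
    congr 1
    -- For `p = 0` the truncated exponent `p - 1` would not match the powers of `sigmaS`, but that
    -- term has coefficient zero.
    rcases p with _ | p
    · simp
    · simp only [Nat.add_sub_cancel]
      field_simp
      ring
  · obtain ⟨B, h⟩ := exists_abs_gaussE_kurtPoly_pow_succ_le c hc q
    refine squeeze_zero_norm' ?_ (tendsto_div_sqrt_res (B / (v ^ 0 * v ^ (q + 1))))
    filter_upwards [hev] with j ⟨hreg, hS, hU⟩
    have hS0 := hv.trans_le hS
    have hU0 := hv.trans_le hU
    have hb := h _ _ _ hreg
    rw [kurtVar_hartley hX ha, ZMod.card] at hb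
    have hsq : sigmaU1Sq C a (res j) + sigmaU2Sq C a (res j) = sigmaU C a (res j) ^ 2 :=
      (Real.sq_sqrt (Real.sqrt_pos.1 hU0).le).symm
    rw [(hX.integral_skewness_kurtosis ha hB _ _).2, (hX.integral_skewness_kurtosis ha hB _ _).2,
      Real.norm_eq_abs, div_right_comm]
    rw [hsq] at hb
    refine le_trans (le_of_eq ?_) (abs_div_pow_mul_pow_le hv hS hU hb 0 (q + 1))
    congr 1
    rcases q with _ | q
    · simp
    · simp only [Nat.add_sub_cancel, pow_zero, one_mul]
      field_simp
      ring

theorem IsField.measurable_normSkewness (hX : IsField μ X w C) (ha : IsWindow a) (N : ℕ) :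
    Measurable (normSkewness X C a N) :=
  ((Finset.measurable_fun_sum _ fun k _ =>
    ((hX.measurable_beta ha N k).div_const _).pow_const 3).const_mul _).div_const _

theorem IsField.measurable_normKurtosis (hX : IsField μ X w C) (ha : IsWindow a) (N : ℕ) :
    Measurable (normKurtosis X C a N) :=
  ((Finset.measurable_fun_sum _ fun k _ =>
    (((hX.measurable_beta ha N k).div_const _).pow_const 4).sub_const 3).const_mul _).div_const _

/-- Lévy's continuity theorem in the plane: the method of moments is applied to each linear
combination of the two statistics, and the limit is the characteristic function of the standard
Gaussian. -/
theorem IsField.tendstoInDistribution (hX : IsField μ X w C) (ha : IsWindow a)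
    (hA : RegularSpectrum C) (hB : IsGaussianProcess X μ) : TendstoInDistribution
      (fun (j : ℕ) (ω : Ω) => !₂[normSkewness X C a (res j) ω, normKurtosis X C a (res j) ω])
      atTop (id : EuclideanSpace ℝ (Fin 2) → EuclideanSpace ℝ (Fin 2)) (fun _ => μ)
      (multivariateGaussian (0 : EuclideanSpace ℝ (Fin 2)) (1 : Matrix (Fin 2) (Fin 2) ℝ)) := by
  set V : ℕ → Ω → Fin 2 → ℝ := fun j ω =>
    ![normSkewness X C a (res j) ω, normKurtosis X C a (res j) ω] with hV
  have hVm : ∀ j, Measurable (V j) := fun j => measurable_pi_iff.2 fun i => by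
    fin_cases i
    · exact hX.measurable_normSkewness ha (res j)
    · exact hX.measurable_normKurtosis ha (res j)
  have hm : ∀ j, Measurable fun ω => WithLp.toLp 2 (V j ω) := fun j =>
    (WithLp.measurable_toLp 2 (Fin 2 → ℝ)).comp (hVm j)
  refine ⟨fun j => (hm j).aemeasurable, aemeasurable_id, ?_⟩
  refine ProbabilityMeasure.tendsto_of_tendsto_charFun fun t => ?_
  have key := tendsto_integral_cexp_plane (μ := μ) hVm (fun p q =>
    ⟨fun j => (hX.integral_skewness_kurtosis ha hB p q).1, hX.tendsto_moments ha hA hB p q⟩) t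
  simp only [ProbabilityMeasure.coe_mk, Measure.map_id, multivariateGaussian_zero_one,
    charFun_stdGaussian]
  have e : (-((∑ i, t i ^ 2 : ℝ) : ℂ) / 2) = -((‖t‖ : ℝ) : ℂ) ^ 2 / 2 := by
    rw [← Complex.ofReal_pow, EuclideanSpace.real_norm_sq_eq]
  rw [e] at key
  refine key.congr fun j => ?_
  rw [charFun_apply, integral_map (hm j).aemeasurable (by fun_prop)]
  congr 1
  ext ω
  congr 1
  rw [mul_comm]
  simp [PiLp.inner_apply, mul_comm]

end Limit

end

end Needlet

end

theorem mainTheorem1 {Ω : Type*} [MeasurableSpace Ω] (μ : Measure Ω) [IsProbabilityMeasure μ]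
    (X : ℝ → Ω → ℝ) (w : ℤ → Ω → ℂ) (C : ℤ → ℝ) (a : ℝ → ℝ)
    (ha : Needlet.IsWindow a)
    (hX : Needlet.IsField μ X w C)
    (hA1 : Needlet.RegularSpectrum C)
    (hB : IsGaussianProcess X μ) :
    (∀ᶠ j : ℕ in atTop, 0 < Needlet.sigmaS C a (Needlet.res j) ∧
      0 < Needlet.sigmaU C a (Needlet.res j)) ∧
    (∀ p₁ p₂ : ℕ,
      (∀ j : ℕ, Integrable (fun ω => Needlet.normSkewness X C a (Needlet.res j) ω ^ p₁ *
        Needlet.normKurtosis X C a (Needlet.res j) ω ^ p₂) μ) ∧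
      Tendsto (fun j : ℕ => ∫ ω, Needlet.normSkewness X C a (Needlet.res j) ω ^ p₁ *
          Needlet.normKurtosis X C a (Needlet.res j) ω ^ p₂ ∂μ) atTop
        (𝓝 (if Even p₁ ∧ Even p₂ then (((p₁ - 1).doubleFactorial * (p₂ - 1).doubleFactorial : ℕ) : ℝ) else 0))) ∧
    TendstoInDistribution
      (fun (j : ℕ) (ω : Ω) => !₂[Needlet.normSkewness X C a (Needlet.res j) ω,
        Needlet.normKurtosis X C a (Needlet.res j) ω])
      atTop (id : EuclideanSpace ℝ (Fin 2) → EuclideanSpace ℝ (Fin 2)) (fun _ => μ)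
      (multivariateGaussian (0 : EuclideanSpace ℝ (Fin 2)) (1 : Matrix (Fin 2) (Fin 2) ℝ)) := by
  refine ⟨?_, fun p₁ p₂ =>
    ⟨fun j => (hX.integral_skewness_kurtosis ha hB p₁ p₂).1, ?_⟩,
    hX.tendstoInDistribution ha hA1 hB⟩
  · obtain ⟨c, v, -, hv, h⟩ := Needlet.exists_eventually_isRegularCov hX ha hA1
    filter_upwards [h] with j hj
    exact ⟨hv.trans_le hj.2.1, hv.trans_le hj.2.2⟩
  · convert hX.tendsto_moments ha hA1 hB p₁ p₂ using 2
    simp only [Needlet.normalMoment]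
    split_ifs <;> simp_all
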